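/- Let $N$ be a natural number, let $\mathbb{W}^N=\{x\in\mathbb{Z}^N: x_1<\dots<x_N\}$, and $\mathsf V(x)=\prod_{j<i}(x_i-x_j)$. The noncolliding Poisson random walk is the continuous time Markov chain $X(\tau)$, $\tau\ge 0$, on $\mathbb{W}^N$ with jump rates $$q(x,x')=\begin{cases}\mathsf V(x')/\mathsf V(x), & x'=x+e_i \text{ for some } i,\\ -N, & x'=x,\\ 0,&\text{otherwise,}\end{cases}$$ where $e_i$ is the $i$-th basis vector; that is, its transition probabilities satisfy $p_h(x,x')=\mathbf 1_{x=x'}+q(x,x')h+o(h)$ as $h\downarrow0$. **Theorem.** Let $a\in\mathbb{W}^N$ be arbitrary. The noncolliding Poisson random walk $X(\tau)$ started from $X(0)=a$ is determinantal: for every $k$ and all pairwise distinct space-time points $(\tau_i,y_i)\in\mathbb{R}_{>0}\times\mathbb{Z}$, $i=1,\dots,k$, $$\mathbb{P}\big(\text{the configuration } X(\tau_i) \text{ contains the point } y_i \text{ for all } i=1,\dots,k\big)=\det\big[K^{\mathrm{Poisson}}_a(\tau_\alpha,y_\alpha;\tau_\beta,y_\beta)\big]_{\alpha,\beta=1}^k,$$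 where for $x_1,x_2\in\mathbb{Z}$ and $\tau_1,\tau_2>0$ $$K^{\mathrm{Poisson}}_a(\tau_1,x_1;\tau_2,x_2)=-\mathbf 1_{x_1\ge x_2}\mathbf 1_{\tau_1>\tau_2}\frac{(\tau_1-\tau_2)^{x_1-x_2}}{(x_1-x_2)!}-\frac{1}{(2\pi \mathrm i)^2}\int_{x_2-\frac12-\mathrm i\infty}^{x_2-\frac12+\mathrm i\infty}dz\oint dw\,\frac{1}{w-z}\,\frac{\Gamma(x_2-z)}{\Gamma(x_1-w+1)}\,\tau_1^{x_1-w}\tau_2^{z-x_2}\prod_{r=1}^N\frac{z-a_r}{w-a_r}.$$ The $z$ contour is the vertical line $\Re z=x_2-\frac12$ traversed upwards, and the integral over it converges absolutely; the $w$ contour is any positively oriented circle, or union of two circles on the two sides of this line, which does not meet the line, passes through no integer, and encircles all the points of $\{\dots,x_1-1,x_1\}\cap\{a_1,\dots,a_N\}$. Moreover, for all $x_1,x_2\in\mathbb{Z}$ and $\tau_1,\tau_2>0$, $$\lim_{\beta\downarrow0}(-\beta)^{x_1-x_2}K^{\mathrm{Bernoulli}}_{a;\beta}\big(\lfloor\beta^{-1}\tau_1\rfloor,x_1;\lfloor\beta^{-1}\tau_2\rfloor,x_2\big)=K^{\mathrm{Poisson}}_a(\tau_1,x_1;\tau_2,x_2),$$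 where for $\beta\in(0,1)$ and integers $t_1,t_2\ge1$ the kernel $K^{\mathrm{Bernoulli}}_{a;\beta}$ of the noncolliding Bernoulli random walk is $$K^{\mathrm{Bernoulli}}_{a;\beta}(t_1,x_1;t_2,x_2)=\mathbf 1_{x_1\ge x_2}\mathbf 1_{t_1>t_2}(-1)^{x_1-x_2+1}\binom{t_1-t_2}{x_1-x_2}+\frac{t_1!}{(t_2-1)!}\frac{1}{(2\pi \mathrm i)^2}\int_{x_2-t_2+\frac12-\mathrm i\infty}^{x_2-t_2+\frac12+\mathrm i\infty}dz\oint dw\,\frac{(z-x_2+1)_{t_2-1}}{(w-x_1)_{t_1+1}}\,\frac{1}{w-z}\,\frac{\sin(\pi w)}{\sin(\pi z)}\Big(\frac{1-\beta}{\beta}\Big)^{w-z}\prod_{r=1}^N\frac{z-a_r}{w-a_r},$$ with $(u)_k=u(u+1)\cdots(u+k-1)$, the $z$ contour the line $\Re z=x_2-t_2+\frac12$ traversed upwards, and the $w$ contour any positively oriented circle, or union of two circles on the two sides of this line, which does not meet the line, passes through no integer, and encircles all the points of $\{x_1-t_1,\dots,x_1\}\cap\{a_1,\dots,a_N\}$.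 -/

import Mathlib

open MeasureTheory Filter Topology
open scoped NNReal Nat

noncomputable section

namespace NoncollidingWalk

/-- The Weyl chamber: strictly increasing integer vectors `x₁ < ⋯ < x_N`. -/
abbrev Weyl (N : ℕ) : Type := {x : Fin N → ℤ // StrictMono x}

/-- The Vandermonde product `∏_{j < i} (x_i - x_j)`. -/
def vandermonde {N : ℕ} (x : Weyl N) : ℝ :=
  ∏ i, ∏ j ∈ Finset.Iio i, ((x.1 i : ℝ) - (x.1 j : ℝ))

/-- Jump rates of the noncolliding Poisson random walk (with the diagonal entry `-N`). -/
def poissonRate {N : ℕ} (x y : Weyl N) : ℝ :=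
  if ∃ i, y.1 = Function.update x.1 i (x.1 i + 1) then vandermonde y / vandermonde x
  else if y = x then -(N : ℝ)
  else 0

/-- Transition function of a continuous time (honest, time homogeneous) Markov chain
on a discrete state space `S`. -/
structure IsTransitionFunction {S : Type*} (p : ℝ≥0 → S → S → ℝ) : Prop where
  nonneg : ∀ t x y, 0 ≤ p t x y
  hasSum_one : ∀ t x, HasSum (fun y => p t x y) 1
  zero_self : ∀ x, p 0 x x = 1
  chapman_kolmogorov : ∀ s t x z, HasSum (fun y => p s x y * p t y z) (p (s + t) x z)

/-- `p` has jump rates `q`: as `h ↓ 0`, `p h x y = δ_{x,y} + q x y * h + o(h)`. -/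
def HasJumpRates {S : Type*} (p : ℝ≥0 → S → S → ℝ) (q : S → S → ℝ) : Prop :=
  ∀ x y, Tendsto (fun h : ℝ≥0 => (p h x y - p 0 x y) / (h : ℝ)) (𝓝[>] 0) (𝓝 (q x y))

/-- `X` is a Markov chain with transition function `p`, started from `a`. -/
structure IsMarkovChain {Ω S : Type*} [MeasurableSpace Ω] (μ : Measure Ω)
    (X : ℝ≥0 → Ω → S) (p : ℝ≥0 → S → S → ℝ) (a : S) : Prop where
  measurableSet : ∀ t x, MeasurableSet {ω | X t ω = x}
  start : ∀ᵐ ω ∂μ, X 0 ω = a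
  markov : ∀ (n : ℕ) (t : Fin (n + 1) → ℝ≥0), Monotone t → ∀ (x : Fin (n + 1) → S)
    (s : ℝ≥0) (y : S),
    μ.real {ω | (∀ i, X (t i) ω = x i) ∧ X (t (Fin.last n) + s) ω = y} =
      μ.real {ω | ∀ i, X (t i) ω = x i} * p s (x (Fin.last n)) y

/-- `X` is a noncolliding Poisson random walk started from `a`. -/
def IsNoncollidingPoissonWalk {N : ℕ} {Ω : Type*} [MeasurableSpace Ω] (μ : Measure Ω)
    (X : ℝ≥0 → Ω → Weyl N) (a : Weyl N) : Prop :=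
  ∃ p : ℝ≥0 → Weyl N → Weyl N → ℝ,
    IsTransitionFunction p ∧ HasJumpRates p poissonRate ∧ IsMarkovChain μ X p a

/-- The space-time correlations of `X` at positive times are determinants of the kernel `K`:
for pairwise distinct space-time points `(τ_i, y_i)`, `τ_i > 0`, the probability that the
configuration `X (τ_i)` contains `y_i` for all `i` is `det [K(τ_α, y_α; τ_β, y_β)]`. -/
def IsDeterminantal {N : ℕ} {Ω : Type*} [MeasurableSpace Ω] (μ : Measure Ω)
    (X : ℝ≥0 → Ω → Weyl N) (K : ℝ → ℤ → ℝ → ℤ → ℂ) : Prop :=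
  ∀ (k : ℕ) (τ : Fin k → ℝ≥0) (y : Fin k → ℤ), (∀ i, 0 < τ i) →
    Function.Injective (fun i => (τ i, y i)) →
    ((μ.real {ω | ∀ i, ∃ j, (X (τ i) ω).1 j = y i} : ℝ) : ℂ) =
      (Matrix.of fun α β => K (τ α) (y α) (τ β) (y β)).det

/-- A `w` contour for a `z` integral over the line `Re z = σ`: two positively oriented circles,
one on each side of the line (so that `w = z` is not encircled), which together encircle all
the points of `P`. A circle of radius `0` contributes nothing, which covers the case of a
single circle. The points where the integrands below are undefined are integers, and the
circles pass through none of them. -/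
structure WContour (σ : ℝ) (P : Set ℤ) where
  cL : ℂ
  rL : ℝ
  cR : ℂ
  rR : ℝ
  rL_nonneg : 0 ≤ rL
  rR_nonneg : 0 ≤ rR
  left_of_line : cL.re + rL < σ
  right_of_line : σ < cR.re - rR
  encircles : ∀ n ∈ P, dist (n : ℂ) cL < rL ∨ dist (n : ℂ) cR < rR
  avoids_left : ∀ n : ℤ, dist (n : ℂ) cL ≠ rL
  avoids_right : ∀ n : ℤ, dist (n : ℂ) cR ≠ rR

/-- The contour integral `∮ f(w) dw` over the two circles. -/
def WContour.integral {σ : ℝ} {P : Set ℤ} (C : WContour σ P) (f : ℂ → ℂ) : ℂ :=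
  circleIntegral f C.cL C.rL + circleIntegral f C.cR C.rR

/-- The integral `∫ f(z) dz` over the line `Re z = σ` traversed upwards. -/
def lineIntegral (σ : ℝ) (f : ℂ → ℂ) : ℂ :=
  Complex.I * ∫ y : ℝ, f ((σ : ℂ) + (y : ℂ) * Complex.I)

/-- The `w` poles `{…, x₁ - 1, x₁} ∩ {a₁, …, a_N}` in the Poisson case. -/
def poissonPoles {N : ℕ} (a : Weyl N) (x₁ : ℤ) : Set ℤ :=
  Set.Iic x₁ ∩ Set.range a.1

/-- The contours admitted in the Poisson kernel. -/
abbrev PoissonContour {N : ℕ} (a : Weyl N) (x₁ x₂ : ℤ) : Type :=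
  WContour ((x₂ : ℝ) - 1 / 2) (poissonPoles a x₁)

/-- The inner (`w`) integral in the Poisson kernel, as a function of `z`. -/
def poissonInner {N : ℕ} (a : Weyl N) {x₁ x₂ : ℤ} (C : PoissonContour a x₁ x₂)
    (τ₁ τ₂ : ℝ) (z : ℂ) : ℂ :=
  C.integral fun w =>
    1 / (w - z) * (Complex.Gamma (x₂ - z) / Complex.Gamma (x₁ - w + 1)) *
      (τ₁ : ℂ) ^ ((x₁ : ℂ) - w) * (τ₂ : ℂ) ^ (z - (x₂ : ℂ)) *
      ∏ r, (z - (a.1 r : ℂ)) / (w - (a.1 r : ℂ))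

/-- The kernel `K^Poisson_a(τ₁, x₁; τ₂, x₂)`. -/
def poissonKernel {N : ℕ} (a : Weyl N) (C : ∀ x₁ x₂ : ℤ, PoissonContour a x₁ x₂)
    (τ₁ : ℝ) (x₁ : ℤ) (τ₂ : ℝ) (x₂ : ℤ) : ℂ :=
  -(if x₂ ≤ x₁ ∧ τ₂ < τ₁ then
      ((τ₁ : ℂ) - τ₂) ^ (x₁ - x₂).toNat / ((x₁ - x₂).toNat ! : ℂ) else 0)
  - 1 / (2 * Real.pi * Complex.I) ^ 2 *
      lineIntegral ((x₂ : ℝ) - 1 / 2) (poissonInner a (C x₁ x₂) τ₁ τ₂)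

/-- The `w` poles `{x₁ - t₁, …, x₁} ∩ {a₁, …, a_N}` in the Bernoulli case. -/
def bernoulliPoles {N : ℕ} (a : Weyl N) (t₁ : ℕ) (x₁ : ℤ) : Set ℤ :=
  Set.Icc (x₁ - t₁) x₁ ∩ Set.range a.1

/-- The contours admitted in the Bernoulli kernel. -/
abbrev BernoulliContour {N : ℕ} (a : Weyl N) (t₁ : ℕ) (x₁ : ℤ) (t₂ : ℕ) (x₂ : ℤ) : Type :=
  WContour ((x₂ : ℝ) - (t₂ : ℝ) + 1 / 2) (bernoulliPoles a t₁ x₁)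

/-- The inner (`w`) integral in the Bernoulli kernel, as a function of `z`. -/
def bernoulliInner {N : ℕ} (a : Weyl N) (β : ℝ) {t₁ : ℕ} {x₁ : ℤ} {t₂ : ℕ} {x₂ : ℤ}
    (C : BernoulliContour a t₁ x₁ t₂ x₂) (z : ℂ) : ℂ :=
  C.integral fun w =>
    (ascPochhammer ℂ (t₂ - 1)).eval (z - x₂ + 1) / (ascPochhammer ℂ (t₁ + 1)).eval (w - x₁) *
      (1 / (w - z)) * (Complex.sin (Real.pi * w) / Complex.sin (Real.pi * z)) *
      (((1 - β) / β : ℝ) : ℂ) ^ (w - z) *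
      ∏ r, (z - (a.1 r : ℂ)) / (w - (a.1 r : ℂ))

/-- The kernel `K^Bernoulli_{a;β}(t₁, x₁; t₂, x₂)` of the noncolliding Bernoulli random walk
(meaningful for `t₁, t₂ ≥ 1` and `0 < β < 1`). -/
def bernoulliKernel {N : ℕ} (a : Weyl N)
    (C : ∀ (t₁ : ℕ) (x₁ : ℤ) (t₂ : ℕ) (x₂ : ℤ), BernoulliContour a t₁ x₁ t₂ x₂) (β : ℝ)
    (t₁ : ℕ) (x₁ : ℤ) (t₂ : ℕ) (x₂ : ℤ) : ℂ :=
  (if x₂ ≤ x₁ ∧ t₂ < t₁ then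
      (-1) ^ ((x₁ - x₂).toNat + 1) * ((t₁ - t₂).choose (x₁ - x₂).toNat : ℂ) else 0)
  + (t₁ ! : ℂ) / ((t₂ - 1)! : ℂ) * (1 / (2 * Real.pi * Complex.I) ^ 2) *
      lineIntegral ((x₂ : ℝ) - (t₂ : ℝ) + 1 / 2) (bernoulliInner a β (C t₁ x₁ t₂ x₂))

/-- Contours exist for every line between two consecutive integers and every finite `P`. -/
theorem nonempty_wContour (m : ℤ) {P : Set ℤ} (hP : P.Finite) {σ : ℝ}
    (hσ : σ = (m : ℝ) - 1 / 2) : Nonempty (WContour σ P) := by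
  obtain ⟨u, hu⟩ := hP.bddAbove
  obtain ⟨l, hl⟩ := hP.bddBelow
  set R : ℤ := |u - m| + |l - m| + 1 with hR
  have hR0 : 0 ≤ R := by positivity
  have key : ∀ (n : ℤ) (c : ℝ), dist (n : ℂ) (c : ℂ) = |(n : ℝ) - c| := by
    intro n c
    rw [Complex.dist_eq, ← Complex.ofReal_intCast, ← Complex.ofReal_sub, Complex.norm_real,
      Real.norm_eq_abs]
  have hR0' : (0 : ℝ) ≤ R := by exact_mod_cast hR0
  refine ⟨⟨((m - 3 / 4 - R : ℝ) : ℂ), R, ((m - 1 / 4 + R : ℝ) : ℂ), R, hR0', hR0',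
    ?_, ?_, ?_, ?_, ?_⟩⟩
  · rw [hσ, Complex.ofReal_re]; linarith
  · rw [hσ, Complex.ofReal_re]; linarith
  · intro n hn
    have h1 : n ≤ m + R - 1 := by
      have := hu hn; have := le_abs_self (u - m); have := abs_nonneg (l - m); omega
    have h2 : m - R + 1 ≤ n := by
      have := hl hn; have := neg_abs_le (l - m); have := abs_nonneg (u - m); omega
    have h1' : (n : ℝ) ≤ m + R - 1 := by exact_mod_cast h1
    have h2' : (m : ℝ) - R + 1 ≤ n := by exact_mod_cast h2
    rw [key, key]
    rcases lt_or_ge n m with h | h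
    · have h' : (n : ℝ) + 1 ≤ m := by exact_mod_cast h
      left; rw [abs_lt]; constructor <;> linarith
    · have h' : (m : ℝ) ≤ n := by exact_mod_cast h
      right; rw [abs_lt]; constructor <;> linarith
  · intro n h
    rw [key] at h
    rcases (abs_eq hR0').1 h with h | h
    · have : (4 * n : ℝ) = 4 * m - 3 := by linarith
      have : 4 * n = 4 * m - 3 := by exact_mod_cast this
      omega
    · have : (4 * n : ℝ) = 4 * m - 3 - 8 * R := by linarith
      have : 4 * n = 4 * m - 3 - 8 * R := by exact_mod_cast this
      omega
  · intro n h
    rw [key] at h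
    rcases (abs_eq hR0').1 h with h | h
    · have : (4 * n : ℝ) = 4 * m - 1 + 8 * R := by linarith
      have : 4 * n = 4 * m - 1 + 8 * R := by exact_mod_cast this
      omega
    · have : (4 * n : ℝ) = 4 * m - 1 := by linarith
      have : 4 * n = 4 * m - 1 := by exact_mod_cast this
      omega

theorem nonempty_poissonContour {N : ℕ} (a : Weyl N) (x₁ x₂ : ℤ) :
    Nonempty (PoissonContour a x₁ x₂) :=
  nonempty_wContour x₂ ((Set.finite_range a.1).inter_of_right _) rfl

theorem nonempty_bernoulliContour {N : ℕ} (a : Weyl N) (t₁ : ℕ) (x₁ : ℤ) (t₂ : ℕ) (x₂ : ℤ) :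
    Nonempty (BernoulliContour a t₁ x₁ t₂ x₂) :=
  nonempty_wContour (x₂ - t₂ + 1) ((Set.finite_range a.1).inter_of_right _)
    (by push_cast; ring)

end NoncollidingWalk

end

/-! Everything reduces to a biorthogonal form of the kernel. In the `w` integral, partial fractions
turn (w - z)⁻¹ ∏ (z - a_r)/(w - a_r) into (w - z)⁻¹ - ∑ (w - a_r)⁻¹ ℓ_r(z), with ℓ_r the Lagrange
basis polynomials at the nodes. The other factors are entire in `w` and z lies outside the contour,
so only the nodes contribute. What remains of the `z` integral is the integral of τ^{-u} Γ(u) times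
a polynomial, evaluated by Mellin inversion on rising factorials, where Γ(u)(u)_k = Γ(u + k). With T
the unit shift and φ_t(n) = tⁿ/n!, this gives K = -1_{τ₁ > τ₂} φ_{τ₁-τ₂}(x₁ - x₂) + ∑_r φ_{τ₁}(x₁ -
a_r) (e^{-τ₂T} ℓ_r)(x₂) (`poissonKernel_eq`).

The Bernoulli kernel has the same form with Γ(u)Γ(t - u)/Γ(t) in place of Γ(u), and Mellin inversion
of (1 + x)^{-c} evaluates it. The closed forms on rising factorials converge, so no limit is taken
under a contour integral (`tendsto_betaBarnes`, `tendsto_bernoulliKernel`).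

For the correlations, the generator is bounded on bounded functions because the Vandermonde
determinant is harmonic. The backward equation then has a unique bounded solution, which is the
Karlin–McGregor determinant conjugated by the Vandermonde determinant
(`transition_eq_kmTransition`). In E ∏ (1 + u 1{y_α ∈ X(τ_α)}), the conditional expectation given
the position b at time s stays of the form e^{Ns} V(a)/V(b) det[f_r(b_i)]: Cauchy–Binet carries it
through a transition, and a factor 1 + u 1_y only adds a multiple of a point mass to each f_r
(`hasSum_condWeight`). At time 0 it is det(1 + uK) by Sylvester's identity (`condWeight_zero`), and
the top coefficient in u is the correlation function. -/

noncomputable section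

namespace NoncollidingWalk

/-! ### Mellin–Barnes integrals of Γ times a polynomial. -/

section

/-- On the line Re u = 1/2 one has 1 - u = conj u, so the reflection formula computes |Γ(u)|². -/
theorem norm_Gamma_half_sq (y : ℝ) :
    ‖Complex.Gamma (1 / 2 + y * Complex.I)‖ ^ 2 = Real.pi / Real.cosh (Real.pi * y) := by
  have h := Complex.Gamma_mul_Gamma_one_sub (1 / 2 + y * Complex.I)
  have h1 : 1 - (1 / 2 + y * Complex.I) = (starRingEnd ℂ) (1 / 2 + y * Complex.I) := by
    simp only [map_add, map_mul, Complex.conj_I, Complex.conj_ofReal, map_div₀, map_one,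
      Complex.conj_ofNat]
    ring
  have h2 : Complex.sin (Real.pi * (1 / 2 + y * Complex.I)) =
      ((Real.cosh (Real.pi * y) : ℝ) : ℂ) := by
    rw [show (Real.pi : ℂ) * (1 / 2 + y * Complex.I) =
      Real.pi / 2 - (-(Real.pi * y * Complex.I)) by ring, Complex.sin_pi_div_two_sub,
      Complex.cos_neg, Complex.cos_mul_I]
    push_cast; rfl
  rw [h1, Complex.Gamma_conj, Complex.mul_conj, h2, Complex.normSq_eq_norm_sq] at h
  exact_mod_cast h

/-- The reciprocal of cosh(πy) is at most 2e^{-|y|}, and (1 + |y|)^n ≤ n! e^{1+|y|}. -/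
theorem norm_Gamma_half_mul_pow_le (n : ℕ) (y : ℝ) :
    ‖Complex.Gamma (1 / 2 + y * Complex.I)‖ ^ 2 * (1 + |y|) ^ n ≤
      2 * Real.exp 1 * n ! * Real.pi := by
  rw [norm_Gamma_half_sq]
  have hc := Real.cosh_pos (Real.pi * y)
  have h1 : (1 + |y|) ^ n ≤ n ! * Real.exp (1 + |y|) := by
    have := Real.pow_div_factorial_le_exp (1 + |y|) (by positivity) n
    rwa [div_le_iff₀' (by positivity)] at this
  have h2 : Real.exp |y| ≤ 2 * Real.cosh (Real.pi * y) := by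
    have h3 : Real.cosh y ≤ Real.cosh (Real.pi * y) := by
      rw [Real.cosh_le_cosh, abs_mul, abs_of_pos Real.pi_pos]
      nlinarith [Real.pi_gt_three, abs_nonneg y]
    have h4 : Real.exp |y| ≤ 2 * Real.cosh y := by
      rw [← Real.cosh_abs, Real.cosh_eq]
      have := Real.exp_pos (-|y|)
      linarith
    linarith
  rw [div_mul_eq_mul_div, div_le_iff₀ hc]
  have h5 : (1 + |y|) ^ n ≤ n ! * (Real.exp 1 * (2 * Real.cosh (Real.pi * y))) := by
    rw [Real.exp_add] at h1
    refine h1.trans ?_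
    gcongr
  calc Real.pi * (1 + |y|) ^ n
      ≤ Real.pi * (n ! * (Real.exp 1 * (2 * Real.cosh (Real.pi * y)))) := by
        gcongr
    _ = _ := by ring

theorem exists_norm_eval_le (P : Polynomial ℂ) (c : ℂ) : ∃ (C : ℝ) (d : ℕ), 0 ≤ C ∧ ∀ y : ℝ,
    ‖P.eval (c + y * Complex.I)‖ ≤ C * (1 + |y|) ^ d := by
  induction P using Polynomial.induction_on' with
  | add p q hp hq =>
    obtain ⟨C, d, hC, h⟩ := hp
    obtain ⟨C', d', hC', h'⟩ := hq
    refine ⟨C + C', d + d', by positivity, fun y => ?_⟩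
    have h1 : 1 ≤ 1 + |y| := by linarith [abs_nonneg y]
    rw [Polynomial.eval_add, add_mul]
    refine (norm_add_le _ _).trans (add_le_add ((h y).trans ?_) ((h' y).trans ?_))
    · gcongr; exact Nat.le_add_right _ _
    · gcongr; exact Nat.le_add_left _ _
  | monomial n b =>
    refine ⟨‖b‖ * (1 + ‖c‖) ^ n, n, by positivity, fun y => ?_⟩
    rw [Polynomial.eval_monomial, norm_mul, norm_pow, mul_assoc, ← mul_pow]
    gcongr
    refine (norm_add_le _ _).trans ?_
    simp only [norm_mul, Complex.norm_real, Complex.norm_I, mul_one, Real.norm_eq_abs]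
    nlinarith [abs_nonneg y, norm_nonneg c]

theorem continuous_Gamma_half :
    Continuous fun y : ℝ => Complex.Gamma (1 / 2 + y * Complex.I) := by
  rw [continuous_iff_continuousAt]
  intro y
  have h : ContinuousAt Complex.Gamma (1 / 2 + y * Complex.I) := by
    refine (Complex.differentiableAt_Gamma _ fun m hm => ?_).continuousAt
    have := congrArg Complex.re hm
    norm_num at this
    have h0 : (0 : ℝ) ≤ m := m.cast_nonneg
    linarith
  exact h.comp (f := fun y : ℝ => (1 / 2 + y * Complex.I : ℂ)) (by fun_prop)

theorem integrable_Gamma_half_mul_eval (P : Polynomial ℂ) :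
    Integrable fun y : ℝ => Complex.Gamma (1 / 2 + y * Complex.I) *
      P.eval (1 / 2 + y * Complex.I) := by
  obtain ⟨C, d, hC, h⟩ := exists_norm_eval_le P (1 / 2)
  -- The Gamma bound concerns the square, hence 2(d + 2): d powers absorb the polynomial and two
  -- leave the integrable factor 1/(1 + y²).
  set B : ℝ := 2 * Real.exp 1 * (2 * d + 4)! * Real.pi
  have hB : 0 ≤ B := by positivity
  refine (integrable_inv_one_add_sq.const_mul (√B * C)).mono'
    ((continuous_Gamma_half.mul (by fun_prop)).aestronglyMeasurable)
    (Eventually.of_forall fun y => ?_)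
  have h1 := norm_Gamma_half_mul_pow_le (2 * d + 4) y
  have h2 : ‖Complex.Gamma (1 / 2 + y * Complex.I)‖ * (1 + |y|) ^ (d + 2) ≤ √B := by
    refine Real.le_sqrt_of_sq_le ?_
    rw [mul_pow, ← pow_mul]
    convert h1 using 3
    lia
  have h3 : 1 + y ^ 2 ≤ (1 + |y|) ^ 2 := by
    rw [← sq_abs]; nlinarith [abs_nonneg y]
  have h4 : 0 < 1 + y ^ 2 := by positivity
  rw [norm_mul, ← div_eq_mul_inv, le_div_iff₀ h4]
  calc _ ≤ ‖Complex.Gamma (1 / 2 + y * Complex.I)‖ * (C * (1 + |y|) ^ d) * (1 + |y|) ^ 2 := by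
        gcongr; exact h y
    _ = ‖Complex.Gamma (1 / 2 + y * Complex.I)‖ * (1 + |y|) ^ (d + 2) * C := by ring
    _ ≤ _ := by gcongr

theorem Gamma_mul_ascPochhammer {u : ℂ} (hu : ∀ m : ℕ, u ≠ -m) (k : ℕ) :
    Complex.Gamma u * (ascPochhammer ℂ k).eval u = Complex.Gamma (u + k) := by
  induction k with
  | zero => simp
  | succ k ih =>
    rw [ascPochhammer_succ_eval, ← mul_assoc, ih, Nat.cast_succ, ← add_assoc,
      Complex.Gamma_add_one _ (by intro h; exact hu k (eq_neg_of_add_eq_zero_left h)), mul_comm]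

theorem half_add_ne_neg_nat (y : ℝ) (m : ℕ) : (1 / 2 + y * Complex.I : ℂ) ≠ -m := by
  intro hm
  have := congrArg Complex.re hm
  norm_num at this
  have h0 : (0 : ℝ) ≤ m := m.cast_nonneg
  linarith

/-- Induction principle for polynomials along the basis of rising factorials. -/
theorem ascPochhammer_induction {R : Type*} [CommRing R] [IsDomain R]
    {p : Polynomial R → Prop} (h_zero : p 0)
    (h_add : ∀ P Q, p P → p Q → p (P + Q)) (h_smul : ∀ (c : R) P, p P → p (Polynomial.C c * P))
    (h_asc : ∀ k, p (ascPochhammer R k)) (P : Polynomial R) : p P := by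
  suffices ∀ (n : ℕ) (P : Polynomial R), P.degree < n → p P by
    refine this (P.natDegree + 1) P (lt_of_le_of_lt P.degree_le_natDegree ?_)
    exact_mod_cast Nat.lt_succ_self _
  intro n
  induction n with
  | zero =>
    intro P hP
    have : P = 0 := by
      rw [← Polynomial.degree_eq_bot, ← Nat.WithBot.lt_zero_iff]; exact_mod_cast hP
    rwa [this]
  | succ n ih =>
    intro P hP
    have hm : (ascPochhammer R n).Monic := monic_ascPochhammer R n
    have h : P = (P - Polynomial.C (P.coeff n) * ascPochhammer R n) +
      Polynomial.C (P.coeff n) * ascPochhammer R n := by ring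
    rw [h]
    refine h_add _ _ (ih _ ?_) (h_smul _ _ (h_asc n))
    rw [Polynomial.degree_lt_iff_coeff_zero]
    intro m hmn
    rcases hmn.eq_or_lt with rfl | hlt
    · have : (ascPochhammer R n).coeff n = 1 := by
        have := hm.coeff_natDegree
        rwa [ascPochhammer_natDegree] at this
      simp [this]
    · rw [Polynomial.coeff_sub, Polynomial.coeff_C_mul, Polynomial.coeff_eq_zero_of_degree_lt
        (lt_of_lt_of_le hP (by exact_mod_cast hlt)),
        Polynomial.coeff_eq_zero_of_natDegree_lt (p := ascPochhammer R n)
          (by rwa [ascPochhammer_natDegree])]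
      simp

theorem mellin_exp_neg {s : ℂ} (hs : 0 < s.re) :
    mellin (fun x : ℝ => ((Real.exp (-x) : ℝ) : ℂ)) s = Complex.Gamma s := by
  rw [Complex.Gamma_eq_integral hs, Complex.GammaIntegral_eq_mellin]

theorem norm_cpow_neg_vertical {τ : ℝ} (hτ : 0 < τ) (σ y : ℝ) :
    ‖(τ : ℂ) ^ (-(σ + y * Complex.I))‖ = τ ^ (-σ) := by
  rw [Complex.norm_cpow_eq_rpow_re_of_pos hτ]; simp

theorem integrable_bdd_cpow_mul {τ : ℝ} (hτ : 0 < τ) (σ : ℝ) {f : ℝ → ℂ} (hf : Integrable f) :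
    Integrable fun y : ℝ => (τ : ℂ) ^ (-(σ + y * Complex.I)) * f y := by
  refine hf.bdd_mul (c := τ ^ (-σ)) ?_ (Eventually.of_forall fun y =>
    (norm_cpow_neg_vertical hτ σ y).le)
  refine Continuous.aestronglyMeasurable ?_
  have : (τ : ℂ) ≠ 0 := by exact_mod_cast hτ.ne'
  exact Continuous.const_cpow (by fun_prop) (Or.inl this)

theorem integrable_cpow_mul_Gamma_half_mul_eval {τ : ℝ} (hτ : 0 < τ) (P : Polynomial ℂ) :
    Integrable fun y : ℝ => (τ : ℂ) ^ (-(1 / 2 + y * Complex.I)) *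
      (Complex.Gamma (1 / 2 + y * Complex.I) * P.eval (1 / 2 + y * Complex.I)) := by
  have := integrable_bdd_cpow_mul hτ (1 / 2) (integrable_Gamma_half_mul_eval P)
  simpa using this

/-- The Mellin–Barnes integral `1/(2π) ∫ τ^{-u} Γ(u) P(u)` over `Re u = 1/2`. -/
def mellinBarnes (τ : ℝ) (P : Polynomial ℂ) : ℂ :=
  (1 / (2 * Real.pi) : ℂ) * ∫ y : ℝ, (τ : ℂ) ^ (-(1 / 2 + y * Complex.I)) *
      (Complex.Gamma (1 / 2 + y * Complex.I) * P.eval (1 / 2 + y * Complex.I))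

theorem mellinBarnes_add {τ : ℝ} (hτ : 0 < τ) (P Q : Polynomial ℂ) :
    mellinBarnes τ (P + Q) = mellinBarnes τ P + mellinBarnes τ Q := by
  unfold mellinBarnes
  rw [← mul_add, ← integral_add (integrable_cpow_mul_Gamma_half_mul_eval hτ P)
    (integrable_cpow_mul_Gamma_half_mul_eval hτ Q)]
  simp only [Polynomial.eval_add, mul_add]

theorem mellinBarnes_C_mul (τ : ℝ) (c : ℂ) (P : Polynomial ℂ) :
    mellinBarnes τ (Polynomial.C c * P) = c * mellinBarnes τ P := by
  unfold mellinBarnes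
  rw [mul_left_comm, ← integral_const_mul c]
  congr 1
  refine integral_congr_ae (Eventually.of_forall fun y => ?_)
  simp only [Polynomial.eval_mul, Polynomial.eval_C]; ring

theorem mellinBarnes_zero (τ : ℝ) : mellinBarnes τ 0 = 0 := by
  simp [mellinBarnes]

/-- Γ(u)(u)_k = Γ(u + k) is the Mellin transform of e^{-x} at u + k. Inversion on Re = k + 1/2
returns e^{-τ}, and the shift by k costs the factor τ^k. -/
theorem mellinBarnes_ascPochhammer {τ : ℝ} (hτ : 0 < τ) (k : ℕ) :
    mellinBarnes τ (ascPochhammer ℂ k) = (τ : ℂ) ^ k * Complex.exp (-τ) := by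
  set f : ℝ → ℂ := fun x => ((Real.exp (-x) : ℝ) : ℂ) with hf
  set σ : ℝ := k + 1 / 2 with hσ
  have hσ0 : 0 < σ := by positivity
  have hτ0 : (τ : ℂ) ≠ 0 := by exact_mod_cast hτ.ne'
  have hG : ∀ y : ℝ, mellin f (σ + y * Complex.I) =
      Complex.Gamma (1 / 2 + y * Complex.I) *
        (ascPochhammer ℂ k).eval (1 / 2 + y * Complex.I) := by
    intro y
    rw [hf, mellin_exp_neg (by simpa using hσ0), Gamma_mul_ascPochhammer (half_add_ne_neg_nat y)]
    congr 1
    rw [hσ]; push_cast; ring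
  have hconv : MellinConvergent f σ := by
    have := Complex.GammaIntegral_convergent (s := σ) (by simpa using hσ0)
    refine this.congr_fun (fun x _ => ?_) measurableSet_Ioi
    simp [hf, mul_comm]
  have hvert : Complex.VerticalIntegrable (mellin f) σ := by
    unfold Complex.VerticalIntegrable
    simp_rw [hG]
    exact integrable_Gamma_half_mul_eval _
  have key := mellinInv_mellin_eq σ f hτ hconv hvert
    (Continuous.continuousAt (by rw [hf]; fun_prop))
  unfold mellinInv at key
  simp_rw [hG] at key
  have h2 : ∀ y : ℝ, (τ : ℂ) ^ (-(1 / 2 + y * Complex.I)) =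
      (τ : ℂ) ^ k * (τ : ℂ) ^ (-((σ : ℂ) + y * Complex.I)) := by
    intro y
    rw [← Complex.cpow_natCast, ← Complex.cpow_add _ _ hτ0]
    congr 1
    rw [hσ]; push_cast; ring
  unfold mellinBarnes
  simp_rw [h2, mul_assoc, integral_const_mul]
  rw [mul_left_comm]
  congr 1
  rw [Complex.real_smul] at key
  push_cast at key
  simp only [smul_eq_mul] at key
  rw [key, hf]
  push_cast; rfl

theorem summable_nat_pow_mul_pow_div_factorial (i : ℕ) (t : ℝ) :
    Summable fun n : ℕ => t ^ n / n ! * (n : ℝ) ^ i := by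
  refine Summable.of_norm_bounded (g := fun n : ℕ => i ! * ((Real.exp 1 * |t|) ^ n / n !))
    ((Real.summable_pow_div_factorial _).mul_left _) fun n => ?_
  have h := Real.pow_div_factorial_le_exp (n : ℝ) n.cast_nonneg i
  rw [div_le_iff₀' (by positivity)] at h
  rw [norm_mul, norm_div, norm_pow, Real.norm_eq_abs, Real.norm_natCast,
    Real.norm_of_nonneg (by positivity), mul_pow, ← Real.exp_nat_mul, mul_one]
  calc |t| ^ n / n ! * (n : ℝ) ^ i ≤ |t| ^ n / n ! * (i ! * Real.exp n) := by gcongr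
    _ = _ := by ring

theorem summable_pow_div_factorial_mul_eval (τ : ℝ) (P : Polynomial ℂ) :
    Summable fun n : ℕ => ((-τ) ^ n / n ! : ℂ) * P.eval (-n : ℂ) := by
  induction P using Polynomial.induction_on' with
  | add p q hp hq => simpa only [Polynomial.eval_add, mul_add] using hp.add hq
  | monomial i b =>
    have := (Complex.ofRealCLM.summable
      (summable_nat_pow_mul_pow_div_factorial i (-τ))).mul_left (b * (-1) ^ i)
    refine this.congr fun n => ?_
    simp only [Complex.ofRealCLM_apply, Polynomial.eval_monomial]
    push_cast
    rw [neg_pow (n : ℂ)]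
    ring

theorem ascPochhammer_eval_neg_add (k m : ℕ) :
    (ascPochhammer ℂ k).eval (-((m + k : ℕ) : ℂ)) = (-1) ^ k * ((m + k)! / m ! : ℂ) := by
  rw [ascPochhammer_eval_neg_eq_descPochhammer, descPochhammer_eval_eq_descFactorial]
  have hm : (m ! : ℂ) ≠ 0 := by exact_mod_cast m.factorial_ne_zero
  have := Nat.factorial_mul_descFactorial (n := m + k) (k := k) (by lia)
  rw [Nat.add_sub_cancel] at this
  rw [← this]
  push_cast
  field_simp

/-- The series is the sum of the residues of Γ at 0, -1, -2, …, but no contour is moved: both sides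
are linear in P, so rising factorials suffice. For these the terms n < k vanish and the tail is τ^k
times the series of e^{-τ}. -/
theorem mellinBarnes_eq_tsum {τ : ℝ} (hτ : 0 < τ) (P : Polynomial ℂ) :
    mellinBarnes τ P = ∑' n : ℕ, ((-τ) ^ n / n ! : ℂ) * P.eval (-n : ℂ) := by
  induction P using ascPochhammer_induction with
  | h_zero => simp [mellinBarnes_zero]
  | h_add P Q hP hQ =>
    rw [mellinBarnes_add hτ, hP, hQ, ← (summable_pow_div_factorial_mul_eval τ P).tsum_add
      (summable_pow_div_factorial_mul_eval τ Q)]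
    simp only [Polynomial.eval_add, mul_add]
  | h_smul c P hP =>
    rw [mellinBarnes_C_mul, hP, ← tsum_mul_left]
    congr 1; ext n; simp only [Polynomial.eval_mul, Polynomial.eval_C]; ring
  | h_asc k =>
    rw [mellinBarnes_ascPochhammer hτ,
      ← (summable_pow_div_factorial_mul_eval τ _).sum_add_tsum_nat_add k,
      Finset.sum_eq_zero, zero_add, Complex.exp_eq_exp_ℂ, NormedSpace.exp_eq_tsum_div,
      ← tsum_mul_left]
    · congr 1; ext m
      rw [ascPochhammer_eval_neg_add]
      have h1 : ((m + k)! : ℂ) ≠ 0 := by exact_mod_cast (m + k).factorial_ne_zero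
      have h2 : ((-1 : ℂ) ^ k) * (-1) ^ k = 1 := by rw [← mul_pow]; simp
      rw [neg_pow (τ : ℂ) (m + k), neg_pow (τ : ℂ) m, pow_add, pow_add]
      field_simp
      linear_combination (-(τ : ℂ) ^ k * τ ^ m / m !) * h2
    · intro n hn
      rw [ascPochhammer_eval_neg_coe_nat_of_lt (Finset.mem_range.1 hn), mul_zero]

end

/-! ### Mellin–Barnes integrals of beta type and their Poisson limit. -/

section

theorem image_div_one_add_Ioi : (fun x : ℝ => x / (1 + x)) '' Set.Ioi 0 = Set.Ioo 0 1 := by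
  ext v
  simp only [Set.mem_image, Set.mem_Ioi, Set.mem_Ioo]
  constructor
  · rintro ⟨x, hx, rfl⟩
    exact ⟨by positivity, by rw [div_lt_one (by positivity)]; linarith⟩
  · rintro ⟨h0, h1⟩
    have : 0 < 1 - v := by linarith
    refine ⟨v / (1 - v), by positivity, ?_⟩
    field_simp
    ring

theorem hasDerivWithinAt_div_one_add (x : ℝ) (hx : x ∈ Set.Ioi (0 : ℝ)) :
    HasDerivWithinAt (fun x : ℝ => x / (1 + x)) (1 / (1 + x) ^ 2) (Set.Ioi 0) x := by
  have hx' : 0 < x := hx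
  have h1 : 1 + x ≠ 0 := by positivity
  have := ((hasDerivAt_id' x).fun_div ((hasDerivAt_id' x).const_add 1) h1).hasDerivWithinAt
    (s := Set.Ioi 0)
  simpa using this

theorem injOn_div_one_add : Set.InjOn (fun x : ℝ => x / (1 + x)) (Set.Ioi 0) := by
  intro x hx y hy h
  have hx' : 0 < x := hx
  have hy' : 0 < y := hy
  simp only at h
  rw [div_eq_div_iff (by positivity) (by positivity)] at h
  linarith

/-- The substitution v = x/(1 + x), with Jacobian (1 + x)⁻², turns Euler's beta integral into the
Mellin transform of (1 + x)^{-c}. -/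
theorem beta_integrand_comp {x : ℝ} (hx : 0 < x) (c : ℕ) (s : ℂ) :
    |1 / (1 + x) ^ 2| • (((x / (1 + x) : ℝ) : ℂ) ^ (s - 1) *
      (1 - ((x / (1 + x) : ℝ) : ℂ)) ^ ((c : ℂ) - s - 1)) =
    (x : ℂ) ^ (s - 1) • ((((1 + x) ^ c)⁻¹ : ℝ) : ℂ) := by
  have hy : 0 < 1 + x := by positivity
  have hy0 : (((1 + x)⁻¹ : ℝ) : ℂ) ≠ 0 := by exact_mod_cast (inv_pos.2 hy).ne'
  have h1 : (1 - ((x / (1 + x) : ℝ) : ℂ)) = (((1 + x)⁻¹ : ℝ) : ℂ) := by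
    rw [← Complex.ofReal_one, ← Complex.ofReal_sub]
    congr 1; field_simp; ring
  have h2 : (((1 + x) ^ c)⁻¹ : ℝ) = ((1 + x)⁻¹) ^ c := by rw [inv_pow]
  have h3 : |1 / (1 + x) ^ 2| = ((1 + x)⁻¹) ^ 2 := by
    rw [abs_of_pos (by positivity)]; field_simp
  rw [h1, h2, h3, div_eq_mul_inv, Complex.ofReal_mul,
    Complex.mul_cpow_ofReal_nonneg hx.le (inv_pos.2 hy).le, Complex.real_smul,
    Complex.ofReal_pow, Complex.ofReal_pow, smul_eq_mul, mul_assoc, ← Complex.cpow_add _ _ hy0,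
    mul_left_comm, ← Complex.cpow_natCast _ 2, ← Complex.cpow_add _ _ hy0,
    ← Complex.cpow_natCast _ c]
  congr 2
  push_cast; ring

theorem mellinConvergent_one_add_pow (c : ℕ) {s : ℂ} (hs : 0 < s.re) (hc : s.re < c) :
    MellinConvergent (fun x : ℝ => ((((1 + x) ^ c)⁻¹ : ℝ) : ℂ)) s := by
  have h := Complex.betaIntegral_convergent (u := s) (v := c - s) hs (by simpa using hc)
  rw [intervalIntegrable_iff_integrableOn_Ioo_of_le zero_le_one, ← image_div_one_add_Ioi,
    integrableOn_image_iff_integrableOn_abs_deriv_smul measurableSet_Ioi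
      hasDerivWithinAt_div_one_add injOn_div_one_add] at h
  refine h.congr_fun (fun x hx => ?_) measurableSet_Ioi
  exact beta_integrand_comp hx c s

theorem mellin_one_add_pow (c : ℕ) {s : ℂ} (hs : 0 < s.re) (hc : s.re < c) :
    mellin (fun x : ℝ => ((((1 + x) ^ c)⁻¹ : ℝ) : ℂ)) s =
      Complex.Gamma s * Complex.Gamma (c - s) / Complex.Gamma c := by
  have hv : 0 < ((c : ℂ) - s).re := by simpa using hc
  have h := Complex.Gamma_mul_Gamma_eq_betaIntegral hs hv
  have hc0 : Complex.Gamma (c : ℂ) ≠ 0 := by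
    refine Complex.Gamma_ne_zero_of_re_pos ?_
    simpa using hs.trans hc
  rw [h, add_sub_cancel, mul_div_cancel_left₀ _ hc0, Complex.betaIntegral,
    intervalIntegral.integral_of_le zero_le_one, integral_Ioc_eq_integral_Ioo,
    ← image_div_one_add_Ioi, integral_image_eq_integral_abs_deriv_smul measurableSet_Ioi
      hasDerivWithinAt_div_one_add injOn_div_one_add]
  refine setIntegral_congr_fun measurableSet_Ioi fun x hx => ?_
  exact (beta_integrand_comp hx c s).symm

/-- On Re u = t - 1/2 the point t - u lies on Re = 1/2, so Γ(t - u) is bounded. Also Γ(u) = Γ(u -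
n)(u - n)_n with n = t - 1, which reduces to the estimate for a single Γ on Re = 1/2. -/
theorem integrable_Gamma_mul_Gamma_mul_eval {t : ℕ} (ht : 1 ≤ t) (P : Polynomial ℂ) :
    Integrable fun y : ℝ => Complex.Gamma (((t - 1 / 2 : ℝ) : ℂ) + y * Complex.I) *
      Complex.Gamma (t - (((t - 1 / 2 : ℝ) : ℂ) + y * Complex.I)) *
      P.eval (((t - 1 / 2 : ℝ) : ℂ) + y * Complex.I) := by
  obtain ⟨n, rfl⟩ : ∃ n, t = n + 1 := ⟨t - 1, by lia⟩
  have h := (integrable_Gamma_half_mul_eval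
    (ascPochhammer ℂ n * P.comp (Polynomial.X + Polynomial.C (n : ℂ)))).bdd_mul
    (f := fun y : ℝ => Complex.Gamma (1 / 2 + ((-y : ℝ) : ℂ) * Complex.I))
    (c := √(2 * Real.exp 1 * Real.pi))
    ((continuous_Gamma_half.comp continuous_neg).aestronglyMeasurable)
    (Eventually.of_forall fun y => ?_)
  · refine h.congr (Eventually.of_forall fun y => ?_)
    simp only [Polynomial.eval_mul, Polynomial.eval_comp, Polynomial.eval_add, Polynomial.eval_X,
      Polynomial.eval_C]
    have h1 : (((n + 1 : ℕ) - 1 / 2 : ℝ) : ℂ) + y * Complex.I = 1 / 2 + y * Complex.I + n := by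
      push_cast; ring
    have h2 : ((n + 1 : ℕ) : ℂ) - (1 / 2 + y * Complex.I + n) =
      1 / 2 + ((-y : ℝ) : ℂ) * Complex.I := by push_cast; ring
    rw [h1, h2, ← Gamma_mul_ascPochhammer (half_add_ne_neg_nat y)]
    ring
  · refine Real.le_sqrt_of_sq_le ?_
    simpa using norm_Gamma_half_mul_pow_le 0 (-y)

/-- The Mellin–Barnes integral `1/(2π) ∫ x^{-u} Γ(u) Γ(t - u) / Γ(t) P(u)` over
`Re u = t - 1/2`. -/
def betaBarnes (t : ℕ) (x : ℝ) (P : Polynomial ℂ) : ℂ :=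
  (1 / (2 * Real.pi) : ℂ) * ∫ y : ℝ, (x : ℂ) ^ (-(((t - 1 / 2 : ℝ) : ℂ) + y * Complex.I)) *
    (Complex.Gamma (((t - 1 / 2 : ℝ) : ℂ) + y * Complex.I) *
      Complex.Gamma (t - (((t - 1 / 2 : ℝ) : ℂ) + y * Complex.I)) / Complex.Gamma t *
      P.eval (((t - 1 / 2 : ℝ) : ℂ) + y * Complex.I))

theorem integrable_betaBarnes {t : ℕ} (ht : 1 ≤ t) {x : ℝ} (hx : 0 < x) (P : Polynomial ℂ) :
    Integrable fun y : ℝ => (x : ℂ) ^ (-(((t - 1 / 2 : ℝ) : ℂ) + y * Complex.I)) *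
    (Complex.Gamma (((t - 1 / 2 : ℝ) : ℂ) + y * Complex.I) *
      Complex.Gamma (t - (((t - 1 / 2 : ℝ) : ℂ) + y * Complex.I)) / Complex.Gamma t *
      P.eval (((t - 1 / 2 : ℝ) : ℂ) + y * Complex.I)) := by
  refine integrable_bdd_cpow_mul hx _ ?_
  refine ((integrable_Gamma_mul_Gamma_mul_eval ht P).div_const (Complex.Gamma t)).congr
    (Eventually.of_forall fun y => ?_)
  simp only; ring

theorem betaBarnes_add {t : ℕ} (ht : 1 ≤ t) {x : ℝ} (hx : 0 < x) (P Q : Polynomial ℂ) :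
    betaBarnes t x (P + Q) = betaBarnes t x P + betaBarnes t x Q := by
  unfold betaBarnes
  rw [← mul_add, ← integral_add (integrable_betaBarnes ht hx P) (integrable_betaBarnes ht hx Q)]
  simp only [Polynomial.eval_add, mul_add]

theorem betaBarnes_C_mul (t : ℕ) (x : ℝ) (c : ℂ) (P : Polynomial ℂ) :
    betaBarnes t x (Polynomial.C c * P) = c * betaBarnes t x P := by
  unfold betaBarnes
  rw [mul_left_comm, ← integral_const_mul c]
  congr 1
  refine integral_congr_ae (Eventually.of_forall fun y => ?_)
  simp only [Polynomial.eval_mul, Polynomial.eval_C]; ring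

/-- Since Γ(u)(u)_k = Γ(u + k) and t - u = (t + k) - (u + k), the integrand is Γ(t + k)/Γ(t) = (t)_k
times the Mellin transform of (1 + x)^{-(t+k)} at u + k, which is then inverted. -/
theorem betaBarnes_ascPochhammer {t : ℕ} (ht : 1 ≤ t) {x : ℝ} (hx : 0 < x) (k : ℕ) :
    betaBarnes t x (ascPochhammer ℂ k) =
      (((ascPochhammer ℝ k).eval (t : ℝ) * x ^ k * ((1 + x) ^ (t + k))⁻¹ : ℝ) : ℂ) := by
  set f : ℝ → ℂ := fun x => ((((1 + x) ^ (t + k))⁻¹ : ℝ) : ℂ) with hf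
  set σ : ℝ := k + (t - 1 / 2) with hσ
  have ht' : (1 : ℝ) ≤ t := by exact_mod_cast ht
  have hk' : (0 : ℝ) ≤ k := k.cast_nonneg
  have hσ0 : 0 < σ := by rw [hσ]; linarith
  have hσ1 : σ < (t + k : ℕ) := by rw [hσ]; push_cast; linarith
  have hx0 : (x : ℂ) ≠ 0 := by exact_mod_cast hx.ne'
  have hΓt : Complex.Gamma (t : ℂ) * (ascPochhammer ℂ k).eval (t : ℂ) =
      Complex.Gamma ((t + k : ℕ) : ℂ) := by
    rw [Gamma_mul_ascPochhammer]
    · push_cast; rfl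
    · intro m hm
      have := congrArg Complex.re hm
      simp only [Complex.natCast_re, Complex.neg_re] at this
      have h0 : (0 : ℝ) ≤ m := m.cast_nonneg
      linarith
  have hΓ0 : Complex.Gamma (t : ℂ) ≠ 0 := Complex.Gamma_ne_zero_of_re_pos (by simp; lia)
  have hΓ1 : Complex.Gamma ((t + k : ℕ) : ℂ) ≠ 0 :=
    Complex.Gamma_ne_zero_of_re_pos (by rw [Complex.natCast_re]; exact hσ0.trans hσ1)
  have hG : ∀ y : ℝ, mellin f (σ + y * Complex.I) = (Complex.Gamma ((t + k : ℕ) : ℂ))⁻¹ *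
      (Complex.Gamma (((t - 1 / 2 : ℝ) : ℂ) + y * Complex.I) *
      Complex.Gamma (t - (((t - 1 / 2 : ℝ) : ℂ) + y * Complex.I)) *
      (ascPochhammer ℂ k).eval (((t - 1 / 2 : ℝ) : ℂ) + y * Complex.I)) := by
    intro y
    rw [hf, mellin_one_add_pow (t + k) (by simpa using hσ0) (by simpa using hσ1),
      mul_right_comm, Gamma_mul_ascPochhammer, div_eq_inv_mul]
    · congr 3
      · rw [hσ]; push_cast; ring
      · rw [hσ]; push_cast; ring
    · intro m hm
      have := congrArg Complex.re hm
      simp only [Complex.add_re, Complex.ofReal_re, Complex.re_ofReal_mul, Complex.I_re, mul_zero,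
        add_zero, Complex.neg_re, Complex.natCast_re] at this
      have h0 : (0 : ℝ) ≤ m := m.cast_nonneg
      linarith
  have hconv : MellinConvergent f σ :=
    mellinConvergent_one_add_pow (t + k) (by simpa using hσ0) (by simpa using hσ1)
  have hvert : Complex.VerticalIntegrable (mellin f) σ := by
    unfold Complex.VerticalIntegrable
    simp_rw [hG]
    exact (integrable_Gamma_mul_Gamma_mul_eval ht _).const_mul _
  have key := mellinInv_mellin_eq σ f hx hconv hvert (by
    rw [hf]
    refine Complex.continuous_ofReal.continuousAt.comp (ContinuousAt.inv₀ (by fun_prop) ?_)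
    positivity)
  unfold mellinInv at key
  simp_rw [hG] at key
  have h2 : ∀ y : ℝ, (x : ℂ) ^ (-(((t - 1 / 2 : ℝ) : ℂ) + y * Complex.I)) =
      (x : ℂ) ^ k * (x : ℂ) ^ (-((σ : ℂ) + y * Complex.I)) := by
    intro y
    rw [← Complex.cpow_natCast, ← Complex.cpow_add _ _ hx0]
    congr 1
    rw [hσ]; push_cast; ring
  have h4 : (((ascPochhammer ℝ k).eval (t : ℝ) : ℝ) : ℂ) = (ascPochhammer ℂ k).eval (t : ℂ) := by
    rw [← ascPochhammer_map (Complex.ofRealHom), ← Complex.ofReal_natCast]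
    exact (Polynomial.eval_map_apply (f := Complex.ofRealHom) (p := ascPochhammer ℝ k) (t : ℝ)).symm
  have h3 : (((ascPochhammer ℝ k).eval (t : ℝ) * x ^ k * ((1 + x) ^ (t + k))⁻¹ : ℝ) : ℂ) =
    (ascPochhammer ℂ k).eval (t : ℂ) * x ^ k * f x := by
    rw [hf]; push_cast; rw [← h4]
  rw [h3, ← key]
  unfold betaBarnes
  rw [Complex.real_smul, mul_left_comm]
  congr 1
  · push_cast; rfl
  · rw [← integral_const_mul]
    refine integral_congr_ae (Eventually.of_forall fun y => ?_)
    simp only [h2, smul_eq_mul]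
    rw [← hΓt, mul_inv]
    have : (ascPochhammer ℂ k).eval (t : ℂ) ≠ 0 := fun h => hΓ1 (by rw [← hΓt, h, mul_zero])
    field_simp

theorem tendsto_floor_div_mul {τ : ℝ} (hτ : 0 < τ) :
    Tendsto (fun β : ℝ => (⌊τ / β⌋₊ : ℝ) * β) (𝓝[>] 0) (𝓝 τ) := by
  have h := (tendsto_nat_floor_mul_div_atTop hτ.le).comp (tendsto_inv_nhdsGT_zero (𝕜 := ℝ))
  refine h.congr fun β => ?_
  simp [Function.comp, div_eq_mul_inv]

theorem tendsto_ascPochhammer_mul_pow {n : ℝ → ℕ} {c : ℝ} {x : ℝ → ℝ} {l : Filter ℝ}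
    (hx : Tendsto x l (𝓝 0)) (hn : Tendsto (fun β => (n β : ℝ) * x β) l (𝓝 c)) (k : ℕ) :
    Tendsto (fun β => (ascPochhammer ℝ k).eval (n β : ℝ) * x β ^ k) l (𝓝 (c ^ k)) := by
  induction k with
  | zero => simp [tendsto_const_nhds]
  | succ k ih =>
    have h : Tendsto (fun β => (n β : ℝ) * x β + k * x β) l (𝓝 (c + k * 0)) :=
      hn.add (hx.const_mul _)
    rw [mul_zero, add_zero] at h
    rw [pow_succ]
    refine (ih.mul h).congr fun β => ?_
    rw [ascPochhammer_succ_eval]; ring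

theorem tendsto_choose_mul_pow {n : ℝ → ℕ} {c : ℝ} {x : ℝ → ℝ} {l : Filter ℝ}
    (hx : Tendsto x l (𝓝 0)) (hn : Tendsto (fun β => (n β : ℝ) * x β) l (𝓝 c)) (k : ℕ) :
    Tendsto (fun β => ((n β).choose k : ℝ) * x β ^ k) l (𝓝 (c ^ k / k !)) := by
  have : Tendsto (fun β => (descPochhammer ℝ k).eval (n β : ℝ) * x β ^ k) l (𝓝 (c ^ k)) := by
    induction k with
    | zero => simp [tendsto_const_nhds]
    | succ k ih =>
      have h : Tendsto (fun β => (n β : ℝ) * x β - k * x β) l (𝓝 (c - k * 0)) :=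
        hn.sub (hx.const_mul _)
      rw [mul_zero, sub_zero] at h
      rw [pow_succ]
      refine (ih.mul h).congr fun β => ?_
      rw [descPochhammer_succ_eval]; ring
  refine (this.div_const _).congr fun β => ?_
  rw [Nat.cast_choose_eq_descPochhammer_div]; ring

theorem tendsto_id_nhdsGT_zero : Tendsto (fun β : ℝ => β) (𝓝[>] 0) (𝓝 0) :=
  tendsto_nhdsWithin_of_tendsto_nhds tendsto_id

theorem tendsto_one_sub_nhdsGT_zero : Tendsto (fun β : ℝ => 1 - β) (𝓝[>] 0) (𝓝 1) := by
  simpa using tendsto_id_nhdsGT_zero.const_sub 1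

theorem tendsto_one_sub_pow_floor {τ : ℝ} (hτ : 0 < τ) :
    Tendsto (fun β : ℝ => (1 - β) ^ ⌊τ / β⌋₊) (𝓝[>] 0) (𝓝 (Real.exp (-τ))) := by
  have h1 : Tendsto (fun β : ℝ => Real.log (1 - β) / β) (𝓝[>] 0) (𝓝 (-1)) := by
    have h : HasDerivAt (fun β : ℝ => Real.log (1 - β)) (-1) 0 := by
      simpa using ((hasDerivAt_id (0 : ℝ)).const_sub 1).log (by simp)
    have := h.tendsto_slope_zero_right
    simpa [div_eq_inv_mul] using this
  have h2 := (tendsto_floor_div_mul hτ).mul h1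
  rw [mul_neg_one] at h2
  refine ((Real.continuous_exp.tendsto _).comp h2).congr' ?_
  filter_upwards [Ioo_mem_nhdsGT (zero_lt_one' ℝ)] with β hβ
  have hβ0 : β ≠ 0 := hβ.1.ne'
  have h3 : 0 < 1 - β := by linarith [hβ.2]
  simp only [Function.comp]
  rw [mul_assoc, mul_div_cancel₀ _ hβ0, mul_comm, Real.exp_mul, Real.exp_log h3,
    Real.rpow_natCast]

theorem eventually_one_le_floor_div {τ : ℝ} (hτ : 0 < τ) :
    ∀ᶠ β : ℝ in 𝓝[>] 0, 1 ≤ ⌊τ / β⌋₊ := by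
  filter_upwards [Ioo_mem_nhdsGT hτ] with β hβ
  rw [Nat.one_le_floor_iff, one_le_div hβ.1]
  exact hβ.2.le

/-- By linearity only rising factorials matter, and there both sides are explicit. With x = β/(1 -
β) one has 1 + x = (1 - β)⁻¹, so (t)_k x^k → τ^k and (1 + x)^{-t} → e^{-τ}. -/
theorem tendsto_betaBarnes {τ : ℝ} (hτ : 0 < τ) (P : Polynomial ℂ) :
    Tendsto (fun β : ℝ => betaBarnes ⌊τ / β⌋₊ (β / (1 - β)) P) (𝓝[>] 0)
      (𝓝 (mellinBarnes τ P)) := by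
  have hx : ∀ᶠ β : ℝ in 𝓝[>] 0, 0 < β / (1 - β) := by
    filter_upwards [Ioo_mem_nhdsGT (zero_lt_one' ℝ)] with β hβ
    exact div_pos hβ.1 (by linarith [hβ.2])
  induction P using ascPochhammer_induction with
  | h_zero => simp [betaBarnes, mellinBarnes_zero]
  | h_add P Q hP hQ =>
    rw [mellinBarnes_add hτ]
    refine (hP.add hQ).congr' ?_
    filter_upwards [hx, eventually_one_le_floor_div hτ] with β h1 h2
    rw [betaBarnes_add h2 h1]
  | h_smul c P hP =>
    rw [mellinBarnes_C_mul]
    exact (hP.const_mul c).congr fun β => (betaBarnes_C_mul _ _ _ _).symm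
  | h_asc k =>
    rw [mellinBarnes_ascPochhammer hτ]
    have h0 : Tendsto (fun β : ℝ => β / (1 - β)) (𝓝[>] 0) (𝓝 0) := by
      simpa using! tendsto_id_nhdsGT_zero.div tendsto_one_sub_nhdsGT_zero one_ne_zero
    have h1 : Tendsto (fun β : ℝ => (⌊τ / β⌋₊ : ℝ) * (β / (1 - β))) (𝓝[>] 0) (𝓝 τ) := by
      have := (tendsto_floor_div_mul hτ).div tendsto_one_sub_nhdsGT_zero one_ne_zero
      rw [div_one] at this
      exact this.congr fun β => mul_div_assoc _ _ _
    have h2 := (tendsto_ascPochhammer_mul_pow h0 h1 k).mul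
      ((tendsto_one_sub_pow_floor hτ).mul (tendsto_one_sub_nhdsGT_zero.pow k))
    have h3 : ((τ : ℂ) ^ k * Complex.exp (-τ)) =
      ((τ ^ k * (Real.exp (-τ) * 1 ^ k) : ℝ) : ℂ) := by push_cast; simp
    rw [h3]
    refine ((Complex.continuous_ofReal.tendsto _).comp h2).congr' ?_
    filter_upwards [hx, eventually_one_le_floor_div hτ, Ioo_mem_nhdsGT (zero_lt_one' ℝ)]
      with β h4 h5 h6
    rw [betaBarnes_ascPochhammer h5 h4]
    have h7 : 1 + β / (1 - β) = (1 - β)⁻¹ := by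
      have : 1 - β ≠ 0 := by linarith [h6.2]
      field_simp; ring
    simp only [Function.comp]
    rw [h7, inv_pow, inv_inv, pow_add]

end

/-! ### Residues in `w` and the biorthogonal form of the Poisson kernel. -/

section

variable {N : ℕ}

/-- The Lagrange basis polynomials at the nodes `a₁, …, a_N`. -/
def lagrange (a : Weyl N) (r : Fin N) : Polynomial ℝ :=
  Lagrange.basis Finset.univ (fun i => (a.1 i : ℝ)) r

/-- The Lagrange basis polynomials at the nodes `a₁, …, a_N`, with complex coefficients. -/
def lagrangeC (a : Weyl N) (r : Fin N) : Polynomial ℂ :=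
  Lagrange.basis Finset.univ (fun i => (a.1 i : ℂ)) r

theorem lagrange_map (a : Weyl N) (r : Fin N) :
    (lagrange a r).map Complex.ofRealHom = lagrangeC a r := by
  simp [lagrange, lagrangeC, Lagrange.basis, Lagrange.basisDivisor, Polynomial.map_prod]

theorem injective_intCast_complex (a : Weyl N) : Function.Injective fun i => (a.1 i : ℂ) :=
  Int.cast_injective.comp a.2.injective

/-- Partial fractions of `w ↦ (w - z)⁻¹ ∏ (z - a_r) / (w - a_r)`. -/
theorem prod_div_eq_sub_sum (a : Weyl N) {w z : ℂ} (hwz : w ≠ z) (hw : ∀ r, w ≠ a.1 r)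
    (hz : ∀ r, z ≠ a.1 r) :
    1 / (w - z) * ∏ r, (z - (a.1 r : ℂ)) / (w - (a.1 r : ℂ)) =
      (w - z)⁻¹ - ∑ r, (w - a.1 r)⁻¹ * (lagrangeC a r).eval z := by
  rcases Nat.eq_zero_or_pos N with rfl | hN
  · simp
  have hne : (Finset.univ : Finset (Fin N)).Nonempty := ⟨⟨0, hN⟩, Finset.mem_univ _⟩
  set v : Fin N → ℂ := fun i => (a.1 i : ℂ) with hv
  have hinj : Set.InjOn v (Finset.univ : Finset (Fin N)) :=
    (injective_intCast_complex a).injOn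
  -- Barycentric interpolation of the constant 1. It is used at both x = w and x = z, and needs at
  -- least one node.
  have h1 : ∀ x : ℂ, (∀ r, x ≠ v r) → 1 = (∏ r, (x - v r)) *
      ∑ r, Lagrange.nodalWeight Finset.univ v r * (x - v r)⁻¹ := by
    intro x hx
    have := Lagrange.eval_interpolate_not_at_node (s := Finset.univ) (v := v) 1 (x := x)
      (fun i _ => hx i)
    rw [Lagrange.interpolate_one hinj hne, Lagrange.eval_nodal] at this
    simpa using this
  have h2 : ∀ r, (lagrangeC a r).eval z = (∏ r, (z - v r)) *
      (Lagrange.nodalWeight Finset.univ v r * (z - v r)⁻¹) := by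
    intro r
    rw [lagrangeC, Lagrange.eval_basis_not_at_node (Finset.mem_univ r) (hz r), Lagrange.eval_nodal]
  have hwz' : w - z ≠ 0 := sub_ne_zero.2 hwz
  have h3 : ∑ r, (w - a.1 r)⁻¹ * (lagrangeC a r).eval z = (w - z)⁻¹ * ((∏ r, (z - v r)) *
      (∑ r, Lagrange.nodalWeight Finset.univ v r * (z - v r)⁻¹ -
        ∑ r, Lagrange.nodalWeight Finset.univ v r * (w - v r)⁻¹)) := by
    rw [← Finset.sum_sub_distrib, Finset.mul_sum, Finset.mul_sum]
    refine Finset.sum_congr rfl fun r _ => ?_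
    rw [h2]
    have h4 : w - v r ≠ 0 := sub_ne_zero.2 (hw r)
    have h5 : z - v r ≠ 0 := sub_ne_zero.2 (hz r)
    change (w - v r)⁻¹ * _ = _
    field_simp
    ring
  have hQw : (∏ r, (w - v r)) ≠ 0 := Finset.prod_ne_zero_iff.2 fun r _ => sub_ne_zero.2 (hw r)
  have h6 : ∑ r, Lagrange.nodalWeight Finset.univ v r * (w - v r)⁻¹ = (∏ r, (w - v r))⁻¹ := by
    exact eq_inv_of_mul_eq_one_right (h1 w hw).symm
  rw [h3, mul_sub, ← h1 z hz, h6, Finset.prod_div_distrib]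
  change 1 / (w - z) * ((∏ r, (z - v r)) / ∏ r, (w - v r)) = _
  field_simp
  ring

theorem circleIntegral_inv_sub_mul {g : ℂ → ℂ} (hg : Differentiable ℂ g) {c b : ℂ} {R : ℝ}
    (hR : 0 ≤ R) (hb : dist b c ≠ R) :
    (∮ w in C(c, R), (w - b)⁻¹ * g w) =
      if dist b c < R then 2 * Real.pi * Complex.I * g b else 0 := by
  split_ifs with h
  · have := Complex.circleIntegral_sub_inv_smul_of_differentiable_on_off_countable
      (s := ∅) Set.countable_empty (show b ∈ Metric.ball c R from h)
      hg.continuous.continuousOn (fun x _ => hg x)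
    simpa using this
  · have hb' : ∀ w ∈ Metric.closedBall c R, w - b ≠ 0 := by
      intro w hw h0
      rw [sub_eq_zero.1 h0] at hw
      exact hb (le_antisymm hw (not_lt.1 h))
    refine Complex.circleIntegral_eq_zero_of_differentiable_on_off_countable hR
      (s := ∅) Set.countable_empty ?_ fun w hw => ?_
    · exact ContinuousOn.mul (ContinuousOn.inv₀ (by fun_prop) hb') hg.continuous.continuousOn
    · exact DifferentiableAt.mul (DifferentiableAt.inv (by fun_prop)
        (hb' w (Metric.ball_subset_closedBall hw.1))) (hg w)

/-- The pole w = z is outside the circle, so the first partial fraction integrates to zero and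
Cauchy's formula handles the others. The product form of F is needed only off the integers, because
the circle meets none of them. -/
theorem circleIntegral_partial_fractions (a : Weyl N) {g : ℂ → ℂ} (hg : Differentiable ℂ g)
    {c z : ℂ} {R : ℝ} (hR : 0 ≤ R) (hc : ∀ n : ℤ, dist (n : ℂ) c ≠ R) (hzc : R < dist z c)
    (hz : ∀ n : ℤ, z ≠ n) {F : ℂ → ℂ}
    (hF : ∀ w : ℂ, (∀ n : ℤ, w ≠ n) → F w =
      1 / (w - z) * g w * ∏ r, (z - (a.1 r : ℂ)) / (w - (a.1 r : ℂ))) :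
    circleIntegral F c R = -∑ r, (if dist (a.1 r : ℂ) c < R then
      2 * Real.pi * Complex.I * g (a.1 r) else 0) * (lagrangeC a r).eval z := by
  have hw : ∀ w ∈ Metric.sphere c R, ∀ n : ℤ, w ≠ n := by
    rintro w hw n rfl
    exact hc n hw
  have hwz : ∀ w ∈ Metric.sphere c R, w ≠ z := by
    rintro w hw rfl
    rw [Metric.mem_sphere] at hw
    exact hzc.ne hw.symm
  have h1 : circleIntegral F c R = ∮ w in C(c, R), ((w - z)⁻¹ * g w -
      ∑ r, (w - a.1 r)⁻¹ * g w * (lagrangeC a r).eval z) := by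
    refine circleIntegral.integral_congr hR fun w hws => ?_
    rw [hF w (hw w hws), mul_right_comm,
      prod_div_eq_sub_sum a (hwz w hws) (fun r => hw w hws _) (fun r => hz _), sub_mul,
      Finset.sum_mul]
    congr 1
    exact Finset.sum_congr rfl fun r _ => by ring
  have hcont : ∀ b : ℂ, (∀ w ∈ Metric.sphere c R, w ≠ b) →
      ContinuousOn (fun w => (w - b)⁻¹ * g w) (Metric.sphere c R) := fun b hb =>
    ContinuousOn.mul (ContinuousOn.inv₀ (by fun_prop) fun w hw => sub_ne_zero.2 (hb w hw))
      hg.continuous.continuousOn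
  have hcirc : ∀ r ∈ Finset.univ, CircleIntegrable
      (fun w => (w - a.1 r)⁻¹ * g w * (lagrangeC a r).eval z) c R := fun r _ =>
    ((hcont _ fun w hws => hw w hws _).mul continuousOn_const).circleIntegrable hR
  rw [h1, circleIntegral.integral_sub ((hcont z hwz).circleIntegrable hR)
    (CircleIntegrable.fun_sum _ hcirc), circleIntegral.integral_fun_sum hcirc,
    circleIntegral_inv_sub_mul hg hR hzc.ne', if_neg hzc.not_gt, zero_sub]
  congr 1
  refine Finset.sum_congr rfl fun r _ => ?_
  rw [← circleIntegral_inv_sub_mul hg hR (hc _)]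
  have := circleIntegral.integral_const_mul ((lagrangeC a r).eval z)
    (fun w => (w - a.1 r)⁻¹ * g w) c R
  rw [mul_comm, ← this]
  simp only [mul_comm]

/-- The value is independent of the contour: the circles lie on opposite sides of the line, so no
node is counted twice, and a node that is missed lies outside P, where g vanishes. -/
theorem WContour.integral_eq_sum {σ : ℝ} {P : Set ℤ} (C : WContour σ P) (a : Weyl N)
    {g : ℂ → ℂ} (hg : Differentiable ℂ g) (hg0 : ∀ r, a.1 r ∉ P → g (a.1 r) = 0) {z : ℂ}
    (hzσ : z.re = σ) (hz : ∀ n : ℤ, z ≠ n) {F : ℂ → ℂ}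
    (hF : ∀ w : ℂ, (∀ n : ℤ, w ≠ n) → F w =
      1 / (w - z) * g w * ∏ r, (z - (a.1 r : ℂ)) / (w - (a.1 r : ℂ))) :
    C.integral F = -(2 * Real.pi * Complex.I * ∑ r, g (a.1 r) * (lagrangeC a r).eval z) := by
  have hL : C.rL < dist z C.cL := by
    have h1 := Complex.re_le_norm (z - C.cL)
    rw [Complex.sub_re, hzσ, ← dist_eq_norm] at h1
    linarith [C.left_of_line]
  have hR : C.rR < dist z C.cR := by
    have h1 := Complex.re_le_norm (C.cR - z)
    rw [Complex.sub_re, hzσ, ← dist_eq_norm, dist_comm] at h1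
    linarith [C.right_of_line]
  rw [WContour.integral, circleIntegral_partial_fractions a hg C.rL_nonneg C.avoids_left hL hz hF,
    circleIntegral_partial_fractions a hg C.rR_nonneg C.avoids_right hR hz hF, ← neg_add,
    ← Finset.sum_add_distrib, Finset.mul_sum]
  congr 1
  refine Finset.sum_congr rfl fun r _ => ?_
  rw [← add_mul, ← mul_assoc]
  congr 1
  by_cases h1 : dist (a.1 r : ℂ) C.cL < C.rL
  · have h2 : ¬ dist (a.1 r : ℂ) C.cR < C.rR := by
      intro h2
      have h3 := Complex.re_le_norm ((a.1 r : ℂ) - C.cL)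
      have h4 := Complex.re_le_norm (C.cR - (a.1 r : ℂ))
      rw [Complex.sub_re, ← dist_eq_norm] at h3 h4
      rw [dist_comm] at h4
      linarith [C.left_of_line, C.right_of_line]
    simp [h1, h2]
  · by_cases h2 : dist (a.1 r : ℂ) C.cR < C.rR
    · simp [h1, h2]
    · have : a.1 r ∉ P := fun h => (C.encircles _ h).elim h1 h2
      simp [h1, h2, hg0 r this]

/-- The Poisson weight `t^n / n!`, extended by zero to negative `n`. -/
def pweight (t : ℝ) (n : ℤ) : ℝ := if 0 ≤ n then t ^ n.toNat / n.toNat ! else 0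

theorem pweight_natCast (t : ℝ) (n : ℕ) : pweight t n = t ^ n / n ! := by
  simp [pweight]

theorem pweight_of_neg (t : ℝ) {n : ℤ} (hn : n < 0) : pweight t n = 0 := by
  simp [pweight, hn]

/-- The operator `f ↦ ∑ t^n / n! f(· + n)`, the exponential of `t` times the unit shift. -/
def expShift (t : ℝ) (f : ℤ → ℝ) (x : ℤ) : ℝ := ∑' n : ℕ, t ^ n / n ! * f (x + n)

/-- The zeros of 1/Γ at the nonpositive integers produce the extension of the weight by zero. -/
theorem inv_Gamma_mul_cpow_eq_pweight {τ : ℝ} (m : ℤ) :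
    (Complex.Gamma ((m : ℂ) + 1))⁻¹ * (τ : ℂ) ^ (m : ℂ) = (pweight τ m : ℂ) := by
  rcases lt_or_ge m 0 with h | h
  · obtain ⟨n, hn⟩ : ∃ n : ℕ, m + 1 = -n := ⟨(-(m + 1)).toNat, by lia⟩
    have : (m : ℂ) + 1 = -n := by exact_mod_cast hn
    rw [this, Complex.Gamma_neg_nat_eq_zero, pweight_of_neg τ h]; simp
  · obtain ⟨n, rfl⟩ := Int.eq_ofNat_of_zero_le h
    rw [pweight_natCast, Int.cast_natCast, Complex.Gamma_nat_eq_factorial, Complex.cpow_natCast]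
    push_cast; ring

theorem ne_intCast_of_re {z : ℂ} {m : ℤ} (hz : z.re = (m : ℝ) - 1 / 2) (n : ℤ) : z ≠ n := by
  rintro rfl
  rw [Complex.intCast_re] at hz
  have : (2 * n : ℝ) = 2 * m - 1 := by linarith
  have : 2 * n = 2 * m - 1 := by exact_mod_cast this
  lia

theorem differentiable_const_cpow_affine {τ : ℝ} (hτ : 0 < τ) {f : ℂ → ℂ}
    (hf : Differentiable ℂ f) : Differentiable ℂ fun w => (τ : ℂ) ^ f w := by
  have : (τ : ℂ) ≠ 0 := by exact_mod_cast hτ.ne'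
  exact fun w => (hf w).const_cpow (Or.inl this)

/-- The factor τ₁^{x₁-w}/Γ(x₁ - w + 1) is entire in w and vanishes at the integers above x₁, which
is why only nodes up to x₁ must be encircled. -/
theorem poissonInner_eq (a : Weyl N) {x₁ x₂ : ℤ} (C : PoissonContour a x₁ x₂) {τ₁ : ℝ}
    (hτ₁ : 0 < τ₁) (τ₂ : ℝ) {z : ℂ} (hz : z.re = (x₂ : ℝ) - 1 / 2) :
    poissonInner a C τ₁ τ₂ z = -(2 * Real.pi * Complex.I * ∑ r, (pweight τ₁ (x₁ - a.1 r) : ℂ) *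
      ((τ₂ : ℂ) ^ (z - (x₂ : ℂ)) * (Complex.Gamma (x₂ - z) * (lagrangeC a r).eval z))) := by
  set g : ℂ → ℂ := fun w => Complex.Gamma (x₂ - z) * (Complex.Gamma (x₁ - w + 1))⁻¹ *
    (τ₁ : ℂ) ^ ((x₁ : ℂ) - w) * (τ₂ : ℂ) ^ (z - (x₂ : ℂ)) with hg
  have hgv : ∀ n : ℤ, g n = Complex.Gamma (x₂ - z) * (τ₂ : ℂ) ^ (z - (x₂ : ℂ)) *
      (pweight τ₁ (x₁ - n) : ℂ) := by
    intro n
    rw [← inv_Gamma_mul_cpow_eq_pweight, hg]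
    push_cast; ring
  have hgd : Differentiable ℂ g := by
    have h1 : Differentiable ℂ fun w : ℂ => (Complex.Gamma (x₁ - w + 1))⁻¹ :=
      Complex.differentiable_one_div_Gamma.comp (by fun_prop)
    have h2 : Differentiable ℂ fun w : ℂ => (τ₁ : ℂ) ^ ((x₁ : ℂ) - w) :=
      differentiable_const_cpow_affine hτ₁ (by fun_prop)
    exact ((h1.const_mul _).mul h2).mul_const _
  rw [poissonInner, C.integral_eq_sum a hgd ?_ hz (ne_intCast_of_re hz)]
  · congr 2
    refine Finset.sum_congr rfl fun r _ => ?_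
    rw [hgv]; ring
  · intro w _
    rw [hg]; ring
  · intro r hr
    rw [hgv, pweight_of_neg, Complex.ofReal_zero, mul_zero]
    by_contra h
    exact hr ⟨by simp only [Set.mem_Iic]; lia, Set.mem_range_self r⟩

/-- The variable u = x₂ - z moves the line to Re u = 1/2 and reverses its orientation, hence the -y.
-/
theorem poissonInner_vertical (a : Weyl N) {x₁ x₂ : ℤ} (C : PoissonContour a x₁ x₂) {τ₁ : ℝ}
    (hτ₁ : 0 < τ₁) (τ₂ y : ℝ) :
    poissonInner a C τ₁ τ₂ ((((x₂ : ℝ) - 1 / 2 : ℝ) : ℂ) + (y : ℂ) * Complex.I) =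
      -(2 * Real.pi * Complex.I * ∑ r, (pweight τ₁ (x₁ - a.1 r) : ℂ) *
      ((τ₂ : ℂ) ^ (-(1 / 2 + ((-y : ℝ) : ℂ) * Complex.I)) *
        (Complex.Gamma (1 / 2 + ((-y : ℝ) : ℂ) * Complex.I) *
          ((lagrangeC a r).comp (Polynomial.C (x₂ : ℂ) - Polynomial.X)).eval
            (1 / 2 + ((-y : ℝ) : ℂ) * Complex.I)))) := by
  rw [poissonInner_eq a C hτ₁ τ₂ (by simp)]
  congr 2
  refine Finset.sum_congr rfl fun r _ => ?_
  rw [Polynomial.eval_comp, Polynomial.eval_sub, Polynomial.eval_C, Polynomial.eval_X]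
  congr 3
  · push_cast; ring
  · congr 1; push_cast; ring
  · congr 1; push_cast; ring

theorem verticalIntegrable_poissonInner (a : Weyl N) {x₁ x₂ : ℤ} (C : PoissonContour a x₁ x₂)
    {τ₁ τ₂ : ℝ} (hτ₁ : 0 < τ₁) (hτ₂ : 0 < τ₂) :
    Complex.VerticalIntegrable (poissonInner a C τ₁ τ₂) ((x₂ : ℝ) - 1 / 2) := by
  unfold Complex.VerticalIntegrable
  simp_rw [poissonInner_vertical a C hτ₁ τ₂]
  refine Integrable.neg (Integrable.const_mul (integrable_finsetSum _ fun r _ => ?_) _)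
  exact ((integrable_cpow_mul_Gamma_half_mul_eval hτ₂ _).comp_neg).const_mul _

/-- At u = -n the polynomial ℓ_r(x - u) becomes ℓ_r(x + n), so the residue series is the exponential
of -τ times the shift. -/
theorem mellinBarnes_lagrange (a : Weyl N) (r : Fin N) (x : ℤ) {τ : ℝ} (hτ : 0 < τ) :
    mellinBarnes τ ((lagrangeC a r).comp (Polynomial.C (x : ℂ) - Polynomial.X)) =
      (expShift (-τ) (fun n => (lagrange a r).eval (n : ℝ)) x : ℂ) := by
  rw [mellinBarnes_eq_tsum hτ, expShift, Complex.ofReal_tsum]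
  congr 1; ext n
  rw [Polynomial.eval_comp, Polynomial.eval_sub, Polynomial.eval_C, Polynomial.eval_X,
    sub_neg_eq_add, ← lagrange_map]
  have : (x : ℂ) + n = Complex.ofRealHom (((x + n : ℤ) : ℝ)) := by
    simp
  rw [this, Polynomial.eval_map_apply]
  simp

/-- The Poisson kernel in biorthogonal form. -/
def biorthKernel (a : Weyl N) (τ₁ : ℝ) (x₁ : ℤ) (τ₂ : ℝ) (x₂ : ℤ) : ℝ :=
  -(if τ₂ < τ₁ then pweight (τ₁ - τ₂) (x₁ - x₂) else 0) +
    ∑ r, pweight τ₁ (x₁ - a.1 r) * expShift (-τ₂) (fun n => (lagrange a r).eval (n : ℝ)) x₂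

theorem transition_part_eq (τ₁ τ₂ : ℝ) (x₁ x₂ : ℤ) :
    (if x₂ ≤ x₁ ∧ τ₂ < τ₁ then
      ((τ₁ : ℂ) - τ₂) ^ (x₁ - x₂).toNat / ((x₁ - x₂).toNat ! : ℂ) else 0) =
    ((if τ₂ < τ₁ then pweight (τ₁ - τ₂) (x₁ - x₂) else 0 : ℝ) : ℂ) := by
  unfold pweight
  by_cases h1 : τ₂ < τ₁ <;> by_cases h2 : x₂ ≤ x₁ <;> simp [h1, h2]

theorem poissonKernel_eq (a : Weyl N) (C : ∀ x₁ x₂ : ℤ, PoissonContour a x₁ x₂) {τ₁ τ₂ : ℝ}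
    (hτ₁ : 0 < τ₁) (hτ₂ : 0 < τ₂) (x₁ x₂ : ℤ) :
    poissonKernel a C τ₁ x₁ τ₂ x₂ = (biorthKernel a τ₁ x₁ τ₂ x₂ : ℂ) := by
  have h1 : (∫ y : ℝ, poissonInner a (C x₁ x₂) τ₁ τ₂
      ((((x₂ : ℝ) - 1 / 2 : ℝ) : ℂ) + (y : ℂ) * Complex.I)) =
      -(2 * Real.pi * Complex.I * ∑ r, (pweight τ₁ (x₁ - a.1 r) : ℂ) * (2 * Real.pi *
        mellinBarnes τ₂ ((lagrangeC a r).comp (Polynomial.C (x₂ : ℂ) - Polynomial.X)))) := by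
    simp_rw [poissonInner_vertical a (C x₁ x₂) hτ₁ τ₂]
    rw [integral_neg, integral_const_mul, integral_finsetSum]
    · congr 2
      refine Finset.sum_congr rfl fun r _ => ?_
      rw [integral_const_mul]
      congr 1
      rw [mellinBarnes, ← mul_assoc, mul_one_div_cancel, one_mul]
      · exact integral_neg_eq_self (fun y : ℝ => (τ₂ : ℂ) ^ (-(1 / 2 + (y : ℂ) * Complex.I)) *
          (Complex.Gamma (1 / 2 + (y : ℂ) * Complex.I) *
          ((lagrangeC a r).comp (Polynomial.C (x₂ : ℂ) - Polynomial.X)).eval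
            (1 / 2 + (y : ℂ) * Complex.I))) volume
      · simp [Real.pi_ne_zero]
    · exact fun r _ =>
        ((integrable_cpow_mul_Gamma_half_mul_eval hτ₂ _).comp_neg).const_mul _
  rw [poissonKernel, lineIntegral, h1, transition_part_eq, biorthKernel]
  simp_rw [mellinBarnes_lagrange a _ x₂ hτ₂]
  push_cast
  rw [sub_eq_add_neg]
  congr 1
  -- The residues give 2πi, the line element i and the Mellin–Barnes normalisation 2π. Together with
  -- the two minus signs they cancel 1/(2πi)².
  simp_rw [mul_left_comm _ (2 * (Real.pi : ℂ)), ← Finset.mul_sum]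
  have hπ : (Real.pi : ℂ) ≠ 0 := by exact_mod_cast Real.pi_ne_zero
  field_simp

end

/-! ### The Bernoulli kernel in biorthogonal form and its limit. -/

section

variable {N : ℕ}

/-- The binomial coefficient `t` choose `m`, extended by zero to negative `m`. -/
def zchoose (t : ℕ) (m : ℤ) : ℝ := if 0 ≤ m then (t.choose m.toNat : ℝ) else 0

theorem inv_Gamma_mul_inv_Gamma_eq_zchoose (t : ℕ) (m : ℤ) :
    (Complex.Gamma ((m : ℂ) + 1))⁻¹ * (Complex.Gamma ((t : ℂ) - m + 1))⁻¹ =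
      (zchoose t m : ℂ) / (t ! : ℂ) := by
  rcases lt_or_ge m 0 with h | h
  · obtain ⟨n, hn⟩ : ∃ n : ℕ, m + 1 = -n := ⟨(-(m + 1)).toNat, by lia⟩
    have : (m : ℂ) + 1 = -n := by exact_mod_cast hn
    rw [this, Complex.Gamma_neg_nat_eq_zero]; simp [zchoose, h.not_ge]
  · obtain ⟨n, rfl⟩ := Int.eq_ofNat_of_zero_le h
    rcases lt_or_ge t n with hn | hn
    · obtain ⟨l, hl⟩ : ∃ l : ℕ, (t : ℤ) - n + 1 = -l := ⟨(-((t : ℤ) - n + 1)).toNat, by lia⟩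
      have : (t : ℂ) - ((n : ℤ) : ℂ) + 1 = -l := by exact_mod_cast hl
      rw [this, Complex.Gamma_neg_nat_eq_zero]; simp [zchoose, Nat.choose_eq_zero_of_lt hn]
    · have h2 : (t : ℂ) - ((n : ℤ) : ℂ) = ((t - n : ℕ) : ℂ) := by
        rw [Nat.cast_sub hn]; simp
      rw [h2, Int.cast_natCast, Complex.Gamma_nat_eq_factorial, Complex.Gamma_nat_eq_factorial]
      have h3 := Nat.choose_mul_factorial_mul_factorial hn
      have h4 : (n ! : ℂ) ≠ 0 := by exact_mod_cast n.factorial_ne_zero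
      have h5 : ((t - n)! : ℂ) ≠ 0 := by exact_mod_cast (t - n).factorial_ne_zero
      have h6 : (t ! : ℂ) ≠ 0 := by exact_mod_cast t.factorial_ne_zero
      simp only [zchoose, Int.natCast_nonneg, if_true, Int.toNat_natCast, Complex.ofReal_natCast]
      field_simp
      rw [← h3]; push_cast; ring

theorem zchoose_eq_zero {t : ℕ} {m : ℤ} (h : m < 0 ∨ (t : ℤ) < m) : zchoose t m = 0 := by
  unfold zchoose
  split_ifs with h0
  · rw [Nat.choose_eq_zero_of_lt (by lia), Nat.cast_zero]
  · rfl

theorem sin_add_int_mul_pi (z : ℂ) (n : ℤ) :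
    Complex.sin (z + n * Real.pi) = (-1) ^ n * Complex.sin z :=
  n.cast_negOnePow ℂ ▸ Complex.sin_antiperiodic.add_int_mul_eq n

/-- The reflection formula: the zeros of the sine cancel the poles of the rational factor, so the
quotient extends to an entire function of w, which the residue computation requires. -/
theorem sin_div_ascPochhammer {w : ℂ} (hw : ∀ n : ℤ, w ≠ n) (x : ℤ) (t : ℕ) :
    Complex.sin (Real.pi * w) / (ascPochhammer ℂ (t + 1)).eval (w - x) =
      (-1) ^ x * Real.pi * ((Complex.Gamma (x - w + 1))⁻¹ *
        (Complex.Gamma (t - (x - w) + 1))⁻¹) := by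
  have hu : ∀ m : ℕ, w - x ≠ -m := by
    intro m h
    refine hw (x - m) ?_
    push_cast
    linear_combination h
  have h1 := Gamma_mul_ascPochhammer hu (t + 1)
  have h2 := Complex.Gamma_mul_Gamma_one_sub (w - x)
  have h3 : Complex.sin (Real.pi * w) = (-1) ^ x * Complex.sin (Real.pi * (w - x)) := by
    rw [show (Real.pi : ℂ) * w = Real.pi * (w - x) + x * Real.pi by ring,
      sin_add_int_mul_pi]
  have h4 : Complex.sin (Real.pi * (w - x)) ≠ 0 := by
    rw [Complex.sin_ne_zero_iff]
    intro k hk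
    have hπ : (Real.pi : ℂ) ≠ 0 := by exact_mod_cast Real.pi_ne_zero
    refine hw (k + x) ?_
    rw [mul_comm] at hk
    have := mul_right_cancel₀ hπ hk
    push_cast; linear_combination this
  have hπ : (Real.pi : ℂ) ≠ 0 := by exact_mod_cast Real.pi_ne_zero
  have h5 : Complex.Gamma (w - x) * Complex.Gamma (1 - (w - x)) ≠ 0 := by
    rw [h2]; exact div_ne_zero hπ h4
  have h6 : Complex.Gamma (w - x + (t + 1 : ℕ)) ≠ 0 := by
    refine Complex.Gamma_ne_zero fun m h => hw (x - (t + 1) - m) ?_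
    push_cast at h ⊢
    linear_combination h
  have e1 : (x : ℂ) - w + 1 = 1 - (w - x) := by ring
  have e2 : (t : ℂ) - (x - w) + 1 = w - x + (t + 1 : ℕ) := by push_cast; ring
  have h8 : Complex.Gamma (w - x) ≠ 0 := left_ne_zero_of_mul h5
  have h9 : Complex.Gamma (1 - (w - x)) ≠ 0 := right_ne_zero_of_mul h5
  have h7 : (ascPochhammer ℂ (t + 1)).eval (w - x) ≠ 0 := by
    intro h; rw [h, mul_zero] at h1; exact h6 h1.symm
  rw [eq_div_iff h4] at h2
  rw [h3, e1, e2, ← h1]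
  field_simp
  linear_combination h2

/-- Reflection again, with Γ(1 - u)(1 - u)_{t-1} = Γ(t - u); this exposes the beta-type integrand in
z. -/
theorem ascPochhammer_div_sin {u : ℂ} (hu : ∀ n : ℤ, u ≠ n) {t : ℕ} (ht : 1 ≤ t) :
    (ascPochhammer ℂ (t - 1)).eval (1 - u) * (Real.pi / Complex.sin (Real.pi * u)) =
      Complex.Gamma u * Complex.Gamma (t - u) := by
  have hu' : ∀ m : ℕ, 1 - u ≠ -m := by
    intro m h
    refine hu (1 + m) ?_
    push_cast
    linear_combination -h
  rw [← Complex.Gamma_mul_Gamma_one_sub, mul_comm, mul_assoc, Gamma_mul_ascPochhammer hu',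
    Nat.cast_sub ht]
  congr 2
  push_cast; ring

/-- The same residue computation with u = x₂ - z, now on Re u = t₂ - 1/2. The sign (-1)^{x₁+x₂}
comes from the two sines and is what the gauge factor (-β)^{x₁-x₂} removes in the limit. -/
theorem bernoulliInner_eq (a : Weyl N) {β : ℝ} (hβ : β ∈ Set.Ioo (0 : ℝ) 1) {t₁ : ℕ} {x₁ : ℤ}
    {t₂ : ℕ} (ht₂ : 1 ≤ t₂) {x₂ : ℤ} (C : BernoulliContour a t₁ x₁ t₂ x₂) (y : ℝ) :
    bernoulliInner a β C ((((x₂ : ℝ) - (t₂ : ℝ) + 1 / 2 : ℝ) : ℂ) + (y : ℂ) * Complex.I) =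
      2 * Real.pi * Complex.I * ((-1) ^ (x₁ + x₂) * (((t₂ - 1)! : ℂ) / (t₁ ! : ℂ)) *
      ∑ r, (zchoose t₁ (x₁ - a.1 r) * ((1 - β) / β) ^ (a.1 r - x₂) : ℝ) *
      (((β / (1 - β) : ℝ) : ℂ) ^ (-(((t₂ - 1 / 2 : ℝ) : ℂ) + ((-y : ℝ) : ℂ) * Complex.I)) *
        (Complex.Gamma (((t₂ - 1 / 2 : ℝ) : ℂ) + ((-y : ℝ) : ℂ) * Complex.I) *
          Complex.Gamma (t₂ - (((t₂ - 1 / 2 : ℝ) : ℂ) + ((-y : ℝ) : ℂ) * Complex.I)) /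
            Complex.Gamma t₂ *
          ((lagrangeC a r).comp (Polynomial.C (x₂ : ℂ) - Polynomial.X)).eval
            (((t₂ - 1 / 2 : ℝ) : ℂ) + ((-y : ℝ) : ℂ) * Complex.I)))) := by
  set u : ℂ := ((t₂ - 1 / 2 : ℝ) : ℂ) + ((-y : ℝ) : ℂ) * Complex.I with hu
  set z : ℂ := (((x₂ : ℝ) - (t₂ : ℝ) + 1 / 2 : ℝ) : ℂ) + (y : ℂ) * Complex.I with hz
  have hzu : z = x₂ - u := by rw [hz, hu]; push_cast; ring
  have hzre : z.re = (x₂ : ℝ) - t₂ + 1 / 2 := by simp [hz]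
  have hzn : ∀ n : ℤ, z ≠ n := ne_intCast_of_re (m := x₂ - t₂ + 1) (by rw [hzre]; push_cast; ring)
  have hun : ∀ n : ℤ, u ≠ n := by
    intro n h
    refine hzn (x₂ - n) ?_
    rw [hzu, h]; push_cast; rfl
  set ρ : ℝ := (1 - β) / β with hρ
  have hρ0 : 0 < ρ := div_pos (by linarith [hβ.2]) hβ.1
  have hρC : (ρ : ℂ) ≠ 0 := by exact_mod_cast hρ0.ne'
  have hinv : β / (1 - β) = ρ⁻¹ := by rw [hρ, inv_div]
  have hsin : Complex.sin (Real.pi * z) = -((-1) ^ x₂ * Complex.sin (Real.pi * u)) := by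
    rw [hzu, show (Real.pi : ℂ) * (x₂ - u) = -(Real.pi * u) + x₂ * Real.pi by ring,
      sin_add_int_mul_pi, Complex.sin_neg, mul_neg]
  have hΓt : Complex.Gamma (t₂ : ℂ) = ((t₂ - 1)! : ℂ) := by
    rw [← Complex.Gamma_nat_eq_factorial, Nat.cast_sub ht₂]; congr 1; push_cast; ring
  have hΓ0 : ((t₂ - 1)! : ℂ) ≠ 0 := by exact_mod_cast (t₂ - 1).factorial_ne_zero
  set A : ℂ := (ascPochhammer ℂ (t₂ - 1)).eval (z - x₂ + 1) with hA
  have hAs : A / Complex.sin (Real.pi * z) * Real.pi =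
      -((-1) ^ x₂ * (Complex.Gamma u * Complex.Gamma (t₂ - u))) := by
    rw [← ascPochhammer_div_sin hun ht₂, hsin, hA, show z - x₂ + 1 = 1 - u by rw [hzu]; ring,
      div_neg]
    rcases Int.even_or_odd x₂ with h | h
    · rw [h.neg_one_zpow]; ring
    · rw [h.neg_one_zpow]; ring
  set g : ℂ → ℂ := fun w => A / Complex.sin (Real.pi * z) * (ρ : ℂ) ^ (w - z) *
    ((-1) ^ x₁ * Real.pi * ((Complex.Gamma (x₁ - w + 1))⁻¹ *
        (Complex.Gamma (t₁ - (x₁ - w) + 1))⁻¹)) with hg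
  have hgv : ∀ n : ℤ, g n = A / Complex.sin (Real.pi * z) * Real.pi * (-1) ^ x₁ *
      (ρ : ℂ) ^ ((n : ℂ) - z) * ((zchoose t₁ (x₁ - n) : ℂ) / (t₁ ! : ℂ)) := by
    intro n
    rw [← inv_Gamma_mul_inv_Gamma_eq_zchoose, hg]
    push_cast; ring
  have hgd : Differentiable ℂ g := by
    have h1 : Differentiable ℂ fun w : ℂ => (Complex.Gamma (x₁ - w + 1))⁻¹ :=
      Complex.differentiable_one_div_Gamma.comp (by fun_prop)
    have h3 : Differentiable ℂ fun w : ℂ => (Complex.Gamma (t₁ - (x₁ - w) + 1))⁻¹ :=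
      Complex.differentiable_one_div_Gamma.comp (by fun_prop)
    have h2 : Differentiable ℂ fun w : ℂ => (ρ : ℂ) ^ (w - z) :=
      differentiable_const_cpow_affine hρ0 (by fun_prop)
    exact (h2.const_mul _).mul ((h1.mul h3).const_mul _)
  rw [bernoulliInner, C.integral_eq_sum a hgd ?_ hzre hzn]
  · rw [neg_mul_eq_mul_neg, ← Finset.sum_neg_distrib]
    congr 1
    rw [Finset.mul_sum]
    refine Finset.sum_congr rfl fun r _ => ?_
    rw [hgv, hAs, Polynomial.eval_comp, Polynomial.eval_sub, Polynomial.eval_C, Polynomial.eval_X,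
      ← hzu, hΓt, hinv]
    have h1 : (ρ : ℂ) ^ ((a.1 r : ℂ) - z) = (ρ : ℂ) ^ (a.1 r - x₂) * ((ρ⁻¹ : ℝ) : ℂ) ^ (-u) := by
      rw [Complex.ofReal_inv, Complex.inv_cpow, ← Complex.cpow_neg, neg_neg,
        ← Complex.cpow_intCast, ← Complex.cpow_add _ _ hρC, hzu]
      · congr 1; push_cast; ring
      · rw [Complex.arg_ofReal_of_nonneg hρ0.le]; exact Real.pi_pos.ne
    rw [h1, zpow_add₀ (by norm_num : (-1 : ℂ) ≠ 0)]
    push_cast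
    field_simp
  · intro w hw
    have := sin_div_ascPochhammer hw x₁ t₁
    rw [hg]
    simp only
    rw [← this]
    ring
  · intro r hr
    rw [hgv, zchoose_eq_zero, Complex.ofReal_zero, zero_div, mul_zero]
    by_contra h
    push Not at h
    exact hr ⟨⟨by lia, by lia⟩, Set.mem_range_self r⟩

theorem bernoulliKernel_eq (a : Weyl N)
    (B : ∀ (t₁ : ℕ) (x₁ : ℤ) (t₂ : ℕ) (x₂ : ℤ), BernoulliContour a t₁ x₁ t₂ x₂)
    {β : ℝ} (hβ : β ∈ Set.Ioo (0 : ℝ) 1) (t₁ : ℕ) (x₁ : ℤ)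
    {t₂ : ℕ} (ht₂ : 1 ≤ t₂) (x₂ : ℤ) :
    bernoulliKernel a B β t₁ x₁ t₂ x₂ =
      (if x₂ ≤ x₁ ∧ t₂ < t₁ then
        (-1) ^ ((x₁ - x₂).toNat + 1) * ((t₁ - t₂).choose (x₁ - x₂).toNat : ℂ) else 0) +
      (-1) ^ (x₁ + x₂) *
      ∑ r, (zchoose t₁ (x₁ - a.1 r) * ((1 - β) / β) ^ (a.1 r - x₂) : ℝ) *
        betaBarnes t₂ (β / (1 - β))
          ((lagrangeC a r).comp (Polynomial.C (x₂ : ℂ) - Polynomial.X)) := by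
  have hx : 0 < β / (1 - β) := div_pos hβ.1 (by linarith [hβ.2])
  rw [bernoulliKernel, lineIntegral]
  congr 1
  simp_rw [bernoulliInner_eq a hβ ht₂ (B t₁ x₁ t₂ x₂)]
  rw [integral_const_mul, integral_const_mul, integral_finsetSum]
  · simp_rw [integral_const_mul]
    have h1 : ∀ r, (∫ y : ℝ, (((β / (1 - β) : ℝ) : ℂ) ^ (-(((t₂ - 1 / 2 : ℝ) : ℂ) +
        ((-y : ℝ) : ℂ) * Complex.I)) *
        (Complex.Gamma (((t₂ - 1 / 2 : ℝ) : ℂ) + ((-y : ℝ) : ℂ) * Complex.I) *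
          Complex.Gamma (t₂ - (((t₂ - 1 / 2 : ℝ) : ℂ) + ((-y : ℝ) : ℂ) * Complex.I)) /
            Complex.Gamma t₂ *
          ((lagrangeC a r).comp (Polynomial.C (x₂ : ℂ) - Polynomial.X)).eval
            (((t₂ - 1 / 2 : ℝ) : ℂ) + ((-y : ℝ) : ℂ) * Complex.I)))) = 2 * Real.pi *
        betaBarnes t₂ (β / (1 - β))
          ((lagrangeC a r).comp (Polynomial.C (x₂ : ℂ) - Polynomial.X)) := by
      intro r
      rw [betaBarnes, ← mul_assoc, mul_one_div_cancel (by simp [Real.pi_ne_zero]), one_mul]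
      exact integral_neg_eq_self (fun y : ℝ => ((β / (1 - β) : ℝ) : ℂ) ^
        (-(((t₂ - 1 / 2 : ℝ) : ℂ) + (y : ℂ) * Complex.I)) *
        (Complex.Gamma (((t₂ - 1 / 2 : ℝ) : ℂ) + (y : ℂ) * Complex.I) *
          Complex.Gamma (t₂ - (((t₂ - 1 / 2 : ℝ) : ℂ) + (y : ℂ) * Complex.I)) /
            Complex.Gamma t₂ *
          ((lagrangeC a r).comp (Polynomial.C (x₂ : ℂ) - Polynomial.X)).eval
            (((t₂ - 1 / 2 : ℝ) : ℂ) + (y : ℂ) * Complex.I))) volume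
    simp_rw [h1, mul_left_comm _ (2 * (Real.pi : ℂ)), ← Finset.mul_sum]
    have hπ : (Real.pi : ℂ) ≠ 0 := by exact_mod_cast Real.pi_ne_zero
    have hΓ0 : ((t₂ - 1)! : ℂ) ≠ 0 := by exact_mod_cast (t₂ - 1).factorial_ne_zero
    have hΓ1 : (t₁ ! : ℂ) ≠ 0 := by exact_mod_cast t₁.factorial_ne_zero
    field_simp
  · exact fun r _ => ((integrable_betaBarnes ht₂ hx _).comp_neg).const_mul _

theorem tendsto_zchoose_mul {τ : ℝ} (hτ : 0 < τ) (m : ℤ) :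
    Tendsto (fun β : ℝ => zchoose ⌊τ / β⌋₊ m * β ^ m) (𝓝[>] 0) (𝓝 (pweight τ m)) := by
  rcases lt_or_ge m 0 with h | h
  · simp [zchoose, pweight, h.not_ge]
  · obtain ⟨n, rfl⟩ := Int.eq_ofNat_of_zero_le h
    have := tendsto_choose_mul_pow tendsto_id_nhdsGT_zero (tendsto_floor_div_mul hτ) n
    simpa [zchoose, pweight] using this

/-- For τ₁ ≤ τ₂ monotonicity of the floor makes the term exactly zero. For τ₂ < τ₁ the floors
eventually separate, and the rescaled binomial coefficient tends to a Poisson weight. -/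
theorem tendsto_transition_part (x₁ x₂ : ℤ) {τ₁ τ₂ : ℝ} (hτ₁ : 0 < τ₁) (hτ₂ : 0 < τ₂) :
    Tendsto (fun β : ℝ => (-(β : ℂ)) ^ (x₁ - x₂) *
      (if x₂ ≤ x₁ ∧ ⌊τ₂ / β⌋₊ < ⌊τ₁ / β⌋₊ then (-1) ^ ((x₁ - x₂).toNat + 1) *
        ((⌊τ₁ / β⌋₊ - ⌊τ₂ / β⌋₊).choose (x₁ - x₂).toNat : ℂ) else 0)) (𝓝[>] 0)
      (𝓝 ((-(if τ₂ < τ₁ then pweight (τ₁ - τ₂) (x₁ - x₂) else 0) : ℝ) : ℂ)) := by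
  by_cases hτ : τ₂ < τ₁
  swap
  · rw [if_neg hτ]
    refine tendsto_const_nhds.congr' ?_
    filter_upwards [self_mem_nhdsWithin] with β hβ
    have hβ' : 0 < β := hβ
    rw [if_neg]
    · simp
    · rintro ⟨_, h⟩
      exact absurd (Nat.floor_mono (div_le_div_of_nonneg_right (not_lt.1 hτ) hβ'.le)) (not_le.2 h)
  rcases lt_or_ge x₁ x₂ with hx | hx
  · rw [pweight_of_neg _ (by lia)]
    simp [hx.not_ge]
  obtain ⟨n, hn⟩ := Int.eq_ofNat_of_zero_le (sub_nonneg.2 hx)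
  rw [if_pos hτ, hn, pweight_natCast]
  have hd : Tendsto (fun β : ℝ => ((⌊τ₁ / β⌋₊ - ⌊τ₂ / β⌋₊ : ℕ) : ℝ) * β) (𝓝[>] 0)
      (𝓝 (τ₁ - τ₂)) := by
    refine ((tendsto_floor_div_mul hτ₁).sub (tendsto_floor_div_mul hτ₂)).congr' ?_
    filter_upwards [self_mem_nhdsWithin] with β hβ
    have hβ' : 0 < β := hβ
    rw [Nat.cast_sub (Nat.floor_mono (div_le_div_of_nonneg_right hτ.le hβ'.le)), sub_mul]
  have hlt : ∀ᶠ β : ℝ in 𝓝[>] 0, ⌊τ₂ / β⌋₊ < ⌊τ₁ / β⌋₊ := by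
    filter_upwards [hd.eventually (lt_mem_nhds (sub_pos.2 hτ))] with β h
    by_contra h0
    rw [Nat.sub_eq_zero_of_le (not_lt.1 h0)] at h
    simp at h
  have key := (tendsto_choose_mul_pow tendsto_id_nhdsGT_zero hd n).neg
  refine ((Complex.continuous_ofReal.tendsto _).comp key).congr' ?_
  filter_upwards [hlt] with β h
  rw [if_pos ⟨hx, h⟩]
  simp only [Function.comp, zpow_natCast, Int.toNat_natCast]
  push_cast
  rw [neg_pow (β : ℂ), pow_succ]
  have h2 : ((-1 : ℂ) ^ n) * (-1) ^ n = 1 := by rw [← mul_pow]; simp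
  linear_combination (((⌊τ₁ / β⌋₊ - ⌊τ₂ / β⌋₊).choose n : ℂ) * (β : ℂ) ^ n) * h2

/-- A finite sum of products is passed to the limit factor by factor. The powers combine as
β^{x₁-x₂} ((1-β)/β)^{a_r-x₂} = β^{x₁-a_r} (1-β)^{a_r-x₂}, and β^{x₁-a_r} is the right scale for the
binomial coefficient. -/
theorem tendsto_bernoulliKernel (a : Weyl N) (C : ∀ x₁ x₂ : ℤ, PoissonContour a x₁ x₂)
    (B : ∀ (t₁ : ℕ) (x₁ : ℤ) (t₂ : ℕ) (x₂ : ℤ), BernoulliContour a t₁ x₁ t₂ x₂)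
    (x₁ x₂ : ℤ) {τ₁ τ₂ : ℝ} (hτ₁ : 0 < τ₁) (hτ₂ : 0 < τ₂) :
    Tendsto (fun β : ℝ => (-(β : ℂ)) ^ (x₁ - x₂) *
      bernoulliKernel a B β ⌊τ₁ / β⌋₊ x₁ ⌊τ₂ / β⌋₊ x₂)
      (𝓝[>] 0) (𝓝 (poissonKernel a C τ₁ x₁ τ₂ x₂)) := by
  have h1 : ∀ r, Tendsto (fun β : ℝ => zchoose ⌊τ₁ / β⌋₊ (x₁ - a.1 r) * β ^ (x₁ - a.1 r) *
      (1 - β) ^ (a.1 r - x₂)) (𝓝[>] 0) (𝓝 (pweight τ₁ (x₁ - a.1 r))) := by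
    intro r
    have := (tendsto_zchoose_mul hτ₁ (x₁ - a.1 r)).mul
      (tendsto_one_sub_nhdsGT_zero.zpow₀ (a.1 r - x₂) (Or.inl one_ne_zero))
    simpa using this
  have h2 := tendsto_finsetSum Finset.univ fun r _ =>
    ((Complex.continuous_ofReal.tendsto _).comp (h1 r)).mul (tendsto_betaBarnes hτ₂
      ((lagrangeC a r).comp (Polynomial.C (x₂ : ℂ) - Polynomial.X)))
  have h3 := (tendsto_transition_part x₁ x₂ hτ₁ hτ₂).add h2
  have h4 : poissonKernel a C τ₁ x₁ τ₂ x₂ =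
      ((-(if τ₂ < τ₁ then pweight (τ₁ - τ₂) (x₁ - x₂) else 0) : ℝ) : ℂ) +
      ∑ r, (pweight τ₁ (x₁ - a.1 r) : ℂ) *
        mellinBarnes τ₂ ((lagrangeC a r).comp (Polynomial.C (x₂ : ℂ) - Polynomial.X)) := by
    rw [poissonKernel_eq a C hτ₁ hτ₂, biorthKernel]
    simp_rw [mellinBarnes_lagrange a _ x₂ hτ₂]
    push_cast
    rfl
  rw [h4]
  refine h3.congr' ?_
  filter_upwards [eventually_one_le_floor_div hτ₂, Ioo_mem_nhdsGT (zero_lt_one' ℝ)]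
    with β h5 h6
  rw [bernoulliKernel_eq a B h6 _ _ h5, mul_add]
  congr 1
  rw [Finset.mul_sum, Finset.mul_sum]
  refine Finset.sum_congr rfl fun r _ => ?_
  simp only [Function.comp]
  rw [← mul_assoc, ← mul_assoc]
  congr 1
  have hβ0 : (β : ℂ) ≠ 0 := by exact_mod_cast h6.1.ne'
  have hβ1 : β ≠ 0 := h6.1.ne'
  have h7 : (-(β : ℂ)) ^ (x₁ - x₂) = (-1) ^ (x₁ + x₂) * (β : ℂ) ^ (x₁ - x₂) := by
    rw [neg_eq_neg_one_mul, mul_zpow]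
    congr 1
    rw [show x₁ + x₂ = x₁ - x₂ + (x₂ + x₂) by ring,
      zpow_add₀ (by norm_num : (-1 : ℂ) ≠ 0) _ (x₂ + x₂),
      Even.neg_one_zpow ⟨x₂, rfl⟩, mul_one]
  have h8 : ((-1 : ℂ) ^ (x₁ + x₂)) * (-1) ^ (x₁ + x₂) = 1 := by
    rw [← mul_zpow]; simp
  have h9 : β ^ (x₁ - a.1 r) * (1 - β) ^ (a.1 r - x₂) =
      β ^ (x₁ - x₂) * ((1 - β) / β) ^ (a.1 r - x₂) := by
    rw [div_zpow, show x₁ - x₂ = (x₁ - a.1 r) + (a.1 r - x₂) by ring, zpow_add₀ hβ1]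
    have : β ^ (a.1 r - x₂) ≠ 0 := zpow_ne_zero _ hβ1
    field_simp
  rw [h7, mul_assoc (zchoose _ _), h9]
  push_cast
  linear_combination (-((zchoose ⌊τ₁ / β⌋₊ (x₁ - a.1 r) : ℂ) * (β : ℂ) ^ (x₁ - x₂) *
    ((1 - (β : ℂ)) / β) ^ (a.1 r - x₂))) * h8

end

/-! ### Cauchy–Binet, the exponential of the shift and Vandermonde determinants. -/

section

variable {N : ℕ}

theorem hasSum_mul_real {ι κ : Type*} {f : ι → ℝ} {g : κ → ℝ} {a b : ℝ} (hf : HasSum f a)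
    (hg : HasSum g b) : HasSum (fun p : ι × κ => f p.1 * g p.2) (a * b) := by
  have h1 : Summable fun i => ‖f i‖ := hf.summable.norm
  have h2 : Summable fun i => ‖g i‖ := hg.summable.norm
  exact hf.mul hg (summable_mul_of_summable_norm h1 h2)

theorem hasSum_pi_prod {n : ℕ} {ι : Type*} {f : Fin n → ι → ℝ} (hf : ∀ i, Summable (f i)) :
    HasSum (fun x : Fin n → ι => ∏ i, f i (x i)) (∏ i, ∑' x, f i x) := by
  induction n with
  | zero => simp
  | succ n ih =>
    have h1 := ih (f := fun i => f i.succ) fun i => hf i.succ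
    have h2 := hasSum_mul_real (hf 0).hasSum h1
    rw [Fin.prod_univ_succ, ← (Fin.consEquiv fun _ : Fin (n + 1) => ι).hasSum_iff]
    convert! h2 using 1
    ext x
    simp [Fin.consEquiv, Fin.prod_univ_succ]

theorem injective_comp_perm :
    Function.Injective fun p : Weyl N × Equiv.Perm (Fin N) => p.1.1 ∘ p.2 := by
  rintro ⟨b, σ⟩ ⟨c, π⟩ h
  simp only at h
  have h1 : b.1 = c.1 := by
    refine (StrictMono.range_inj b.2 c.2).1 ?_
    rw [← σ.surjective.range_comp b.1, h, π.surjective.range_comp]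
  have h2 : b = c := Subtype.ext h1
  subst h2
  refine Prod.ext rfl (Equiv.ext fun i => b.2.injective (congrFun h i))

theorem exists_comp_perm {x : Fin N → ℤ} (hx : Function.Injective x) :
    x ∈ Set.range fun p : Weyl N × Equiv.Perm (Fin N) => p.1.1 ∘ p.2 := by
  refine ⟨⟨⟨x ∘ Tuple.sort x, ?_⟩, (Tuple.sort x)⁻¹⟩, ?_⟩
  · exact (Tuple.monotone_sort x).strictMono_of_injective
      (hx.comp (Tuple.sort x).injective)
  · ext i; simp

/-- The Cauchy–Binet formula for sums over the Weyl chamber. -/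
theorem hasSum_det_mul_det {A : Fin N → ℤ → ℝ} {B : ℤ → Fin N → ℝ}
    (h : ∀ i s, Summable fun x => A i x * B x s) :
    HasSum (fun b : Weyl N => (Matrix.of fun i j => A i (b.1 j)).det *
      (Matrix.of fun j s => B (b.1 j) s).det) (Matrix.of fun i s => ∑' x, A i x * B x s).det := by
  -- First sum over all integer vectors, where the sum factorises. Vectors with repeated entries
  -- have a vanishing determinant, and grouping the others by their sorted version rebuilds the
  -- determinant of A.
  have h1 : HasSum (fun x : Fin N → ℤ => (∏ i, A i (x i)) * (Matrix.of fun i s => B (x i) s).det)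
      (Matrix.of fun i s => ∑' x, A i x * B x s).det := by
    rw [← Matrix.det_transpose, Matrix.det_apply']
    have : ∀ x : Fin N → ℤ, (∏ i, A i (x i)) * (Matrix.of fun i s => B (x i) s).det =
        ∑ σ : Equiv.Perm (Fin N), ((Equiv.Perm.sign σ : ℤ) : ℝ) *
          ∏ i, (A i (x i) * B (x i) (σ i)) := by
      intro x
      rw [← Matrix.det_transpose, Matrix.det_apply', Finset.mul_sum]
      refine Finset.sum_congr rfl fun σ _ => ?_
      rw [Finset.prod_mul_distrib]
      simp only [Matrix.transpose_apply, Matrix.of_apply]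
      ring
    simp_rw [this]
    refine hasSum_sum fun σ _ => ?_
    refine (hasSum_pi_prod (f := fun i x => A i x * B x (σ i)) fun i => h i (σ i)).mul_left _
  rw [← injective_comp_perm.hasSum_iff] at h1
  · refine h1.prod_fiberwise fun b => ?_
    have h2 : (Matrix.of fun i j => A i (b.1 j)).det * (Matrix.of fun j s => B (b.1 j) s).det =
        ∑ σ : Equiv.Perm (Fin N), (∏ i, A i ((b.1 ∘ σ) i)) *
          (Matrix.of fun i s => B ((b.1 ∘ σ) i) s).det := by
      rw [← Matrix.det_transpose, Matrix.det_apply', Finset.sum_mul]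
      refine Finset.sum_congr rfl fun σ _ => ?_
      have h3 := Matrix.det_permute σ (Matrix.of fun j s => B (b.1 j) s)
      have h4 : (Matrix.of fun i s => B ((b.1 ∘ σ) i) s) =
        (Matrix.of fun j s => B (b.1 j) s).submatrix σ id := rfl
      rw [h4, h3]
      simp only [Matrix.transpose_apply, Matrix.of_apply, Function.comp]
      ring
    rw [h2]
    exact hasSum_fintype _
  · intro x hx
    have hx' : ¬ Function.Injective x := fun h => hx (exists_comp_perm h)
    rw [Function.not_injective_iff] at hx'
    obtain ⟨i, j, hij, hne⟩ := hx'
    rw [Matrix.det_zero_of_row_eq hne, mul_zero]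
    ext s; simp [hij]

/-- The functions on which all the operators `expShift t` converge absolutely. -/
def ExpSummable (f : ℤ → ℝ) : Prop :=
  ∀ (t : ℝ) (x : ℤ), Summable fun n : ℕ => t ^ n / n ! * f (x + n)

theorem ExpSummable.add {f g : ℤ → ℝ} (hf : ExpSummable f) (hg : ExpSummable g) :
    ExpSummable fun x => f x + g x := fun t x => by
  simpa only [mul_add] using (hf t x).add (hg t x)

theorem ExpSummable.const_mul {f : ℤ → ℝ} (hf : ExpSummable f) (c : ℝ) :
    ExpSummable fun x => c * f x := fun t x => by
  simpa only [mul_left_comm] using (hf t x).mul_left c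

theorem ExpSummable.sum {ι : Type*} {s : Finset ι} {f : ι → ℤ → ℝ}
    (hf : ∀ i ∈ s, ExpSummable (f i)) : ExpSummable fun x => ∑ i ∈ s, f i x := fun t x => by
  simp only [Finset.mul_sum]
  exact summable_sum fun i hi => hf i hi t x

theorem expShift_add {f g : ℤ → ℝ} (hf : ExpSummable f) (hg : ExpSummable g) (t : ℝ) (x : ℤ) :
    expShift t (fun x => f x + g x) x = expShift t f x + expShift t g x := by
  simp only [expShift, mul_add]
  exact (hf t x).tsum_add (hg t x)

theorem expShift_const_mul (f : ℤ → ℝ) (c t : ℝ) (x : ℤ) :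
    expShift t (fun x => c * f x) x = c * expShift t f x := by
  simp only [expShift, ← tsum_mul_left]
  congr 1; ext n; ring

theorem expShift_sum {ι : Type*} {s : Finset ι} {f : ι → ℤ → ℝ}
    (hf : ∀ i ∈ s, ExpSummable (f i)) (t : ℝ) (x : ℤ) :
    expShift t (fun x => ∑ i ∈ s, f i x) x = ∑ i ∈ s, expShift t (f i) x := by
  simp only [expShift, Finset.mul_sum]
  exact Summable.tsum_finsetSum fun i hi => hf i hi t x

theorem sum_antidiagonal_pow_div_factorial (s t : ℝ) (k : ℕ) :
    ∑ p ∈ Finset.HasAntidiagonal.antidiagonal k, s ^ p.1 / p.1 ! * (t ^ p.2 / p.2 !) =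
      (s + t) ^ k / k ! := by
  rw [(Commute.all s t).add_pow', Finset.sum_div]
  refine Finset.sum_congr rfl fun p hp => ?_
  rw [Finset.HasAntidiagonal.mem_antidiagonal] at hp
  have h := Nat.add_choose_mul_factorial_mul_factorial p.2 p.1
  rw [add_comm, hp] at h
  have h1 : (p.1 ! : ℝ) ≠ 0 := by exact_mod_cast p.1.factorial_ne_zero
  have h2 : (p.2 ! : ℝ) ≠ 0 := by exact_mod_cast p.2.factorial_ne_zero
  have h3 : (k ! : ℝ) ≠ 0 := by exact_mod_cast k.factorial_ne_zero
  rw [nsmul_eq_mul]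
  field_simp
  rw [← h]; push_cast; ring

/-- Summing absolute values along antidiagonals gives, by the binomial theorem, the series of |f|
with parameter |s| + |t|. -/
theorem ExpSummable.summable_prod {f : ℤ → ℝ} (hf : ExpSummable f) (s t : ℝ) (x : ℤ) :
    Summable fun p : ℕ × ℕ => s ^ p.1 / p.1 ! * (t ^ p.2 / p.2 !) * f (x + (p.1 + p.2 : ℕ)) := by
  rw [← summable_norm_iff, ← Finset.HasAntidiagonal.sigmaAntidiagonalEquivProd.summable_iff]
  refine (summable_sigma_of_nonneg fun _ => norm_nonneg _).2 ?_
  refine ⟨fun k => (hasSum_fintype _).summable, ?_⟩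
  refine (hf (|s| + |t|) x).norm.congr fun k => ?_
  rw [tsum_fintype, ← sum_antidiagonal_pow_div_factorial, norm_mul, Real.norm_of_nonneg
    (Finset.sum_nonneg fun _ _ => by positivity), Finset.sum_mul, ← Finset.sum_coe_sort]
  refine Finset.sum_congr rfl fun p _ => ?_
  have hp := Finset.HasAntidiagonal.mem_antidiagonal.1 p.2
  simp [Finset.HasAntidiagonal.sigmaAntidiagonalEquivProd, ← hp]

/-- The group law of the exponential, valid for all real s and t: one double series is summed by
rows and by antidiagonals. Negative parameters matter, since the Lagrange polynomials are evolved
backward. -/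
theorem ExpSummable.hasSum_expShift {f : ℤ → ℝ} (hf : ExpSummable f) (s t : ℝ) (x : ℤ) :
    HasSum (fun n : ℕ => s ^ n / n ! * expShift t f (x + n)) (expShift (s + t) f x) := by
  have h := (hf.summable_prod s t x).hasSum
  set S := ∑' p : ℕ × ℕ, s ^ p.1 / p.1 ! * (t ^ p.2 / p.2 !) * f (x + (p.1 + p.2 : ℕ))
  have h1 : HasSum (fun n : ℕ => s ^ n / n ! * expShift t f (x + n)) S := by
    refine h.prod_fiberwise fun n => ?_
    refine ((hf t (x + n)).hasSum.mul_left (s ^ n / n !)).congr_fun fun m => ?_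
    simp only; push_cast; rw [mul_assoc, add_assoc]
  have h2 : HasSum (fun k : ℕ => (s + t) ^ k / k ! * f (x + k)) S := by
    rw [← Finset.HasAntidiagonal.sigmaAntidiagonalEquivProd.hasSum_iff] at h
    refine h.sigma fun k => ?_
    have h3 := hasSum_fintype fun p : Finset.HasAntidiagonal.antidiagonal k =>
      s ^ p.1.1 / p.1.1 ! * (t ^ p.1.2 / p.1.2 !) * f (x + (p.1.1 + p.1.2 : ℕ))
    convert! h3 using 1
    rw [Finset.sum_coe_sort (Finset.HasAntidiagonal.antidiagonal k) fun p =>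
      s ^ p.1 / p.1 ! * (t ^ p.2 / p.2 !) * f (x + (p.1 + p.2 : ℕ)),
      ← sum_antidiagonal_pow_div_factorial, Finset.sum_mul]
    refine Finset.sum_congr rfl fun p hp => ?_
    rw [Finset.HasAntidiagonal.mem_antidiagonal.1 hp]
  rwa [expShift, h2.tsum_eq]

theorem ExpSummable.expShift {f : ℤ → ℝ} (hf : ExpSummable f) (t : ℝ) :
    ExpSummable (expShift t f) := fun s x => (hf.hasSum_expShift s t x).summable

theorem expShift_expShift {f : ℤ → ℝ} (hf : ExpSummable f) (s t : ℝ) (x : ℤ) :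
    expShift s (expShift t f) x = expShift (s + t) f x :=
  (hf.hasSum_expShift s t x).tsum_eq

theorem ExpSummable.hasSum_pweight {f : ℤ → ℝ} (hf : ExpSummable f) (t : ℝ) (x : ℤ) :
    HasSum (fun y : ℤ => pweight t (y - x) * f y) (NoncollidingWalk.expShift t f x) := by
  have hinj : Function.Injective fun n : ℕ => x + (n : ℤ) := fun m n h => by
    simpa using h
  rw [← hinj.hasSum_iff]
  · refine (hf t x).hasSum.congr_fun fun n => ?_
    simp [pweight_natCast]
  · intro y hy
    rw [pweight_of_neg, zero_mul]
    by_contra h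
    exact hy ⟨(y - x).toNat, by simp only; lia⟩

/-- The indicator function of the point `y`. -/
def pointMass (y : ℤ) (x : ℤ) : ℝ := if x = y then 1 else 0

theorem expSummable_pointMass (y : ℤ) : ExpSummable (pointMass y) := fun t x => by
  refine summable_of_hasFiniteSupport (Set.Finite.subset (Set.finite_singleton (y - x).toNat) ?_)
  intro n hn
  by_contra h
  refine hn ?_
  simp only [Set.mem_singleton_iff] at h
  simp only [pointMass]
  rw [if_neg (by lia), mul_zero]

theorem expShift_pointMass (t : ℝ) (y x : ℤ) :
    expShift t (pointMass y) x = pweight t (y - x) := by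
  rw [← ((expSummable_pointMass y).hasSum_pweight t x).tsum_eq, tsum_eq_single y]
  · simp [pointMass]
  · intro z hz
    simp [pointMass, hz]

theorem expSummable_pow (m : ℕ) : ExpSummable fun x => (x : ℝ) ^ m := fun t x => by
  have : (fun n : ℕ => t ^ n / n ! * ((x + n : ℤ) : ℝ) ^ m) = fun n : ℕ =>
      ∑ j ∈ Finset.range (m + 1), ((x : ℝ) ^ j * (m.choose j)) *
        (t ^ n / n ! * (n : ℝ) ^ (m - j)) := by
    ext n
    push_cast
    rw [add_pow, Finset.mul_sum]
    exact Finset.sum_congr rfl fun j _ => by ring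
  rw [this]
  exact summable_sum fun j _ => (summable_nat_pow_mul_pow_div_factorial _ _).mul_left _

/-- The moments `∑ n^i t^n / n!`. -/
def pmoment (t : ℝ) (i : ℕ) : ℝ := ∑' n : ℕ, t ^ n / n ! * (n : ℝ) ^ i

theorem pmoment_zero (t : ℝ) : pmoment t 0 = Real.exp t := by
  simp [pmoment, Real.exp_eq_exp_ℝ, NormedSpace.exp_eq_tsum_div]

/-- The operator is triangular on monomials. The sum is padded to all j < N by vanishing binomial
coefficients so that it reads as a matrix product. -/
theorem expShift_pow (t : ℝ) {m : ℕ} (hm : m < N) (x : ℤ) :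
    expShift t (fun x => (x : ℝ) ^ m) x =
      ∑ j : Fin N, (x : ℝ) ^ (j : ℕ) * (m.choose j * pmoment t (m - j)) := by
  have : (fun n : ℕ => t ^ n / n ! * ((x + n : ℤ) : ℝ) ^ m) = fun n : ℕ =>
      ∑ j ∈ Finset.range (m + 1), ((x : ℝ) ^ j * (m.choose j)) *
        (t ^ n / n ! * (n : ℝ) ^ (m - j)) := by
    ext n
    push_cast
    rw [add_pow, Finset.mul_sum]
    exact Finset.sum_congr rfl fun j _ => by ring
  rw [expShift, this, Summable.tsum_finsetSum fun j _ =>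
    (summable_nat_pow_mul_pow_div_factorial _ _).mul_left _]
  rw [Fin.sum_univ_eq_sum_range (fun j => (x : ℝ) ^ j * (m.choose j * pmoment t (m - j))) N]
  refine Finset.sum_subset_zero_on_sdiff (Finset.range_subset_range.2 hm) ?_ ?_
  · intro j hj
    simp only [Finset.mem_sdiff, Finset.mem_range] at hj
    rw [Nat.choose_eq_zero_of_lt (by lia)]; simp
  · intro j _
    rw [tsum_mul_left, mul_assoc]; rfl

theorem det_vandermonde_eq (x : Weyl N) :
    (Matrix.vandermonde fun i => (x.1 i : ℝ)).det = vandermonde x := by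
  rw [Matrix.det_vandermonde, vandermonde, Finset.prod_sigma', Finset.prod_sigma']
  refine Finset.prod_bij' (fun p _ => ⟨p.2, p.1⟩) (fun p _ => ⟨p.2, p.1⟩) ?_ ?_ ?_ ?_ ?_ <;> simp

/-- Distinct integers differ by at least 1. The lower bound makes estimates of the transition
function uniform in the starting point. -/
theorem one_le_vandermonde (x : Weyl N) : 1 ≤ vandermonde x := by
  unfold vandermonde
  refine Finset.one_le_prod fun i _ => Finset.one_le_prod fun j hj => ?_
  have : x.1 j + 1 ≤ x.1 i := x.2 (Finset.mem_Iio.1 hj)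
  have : (x.1 j : ℝ) + 1 ≤ x.1 i := by exact_mod_cast this
  linarith

theorem vandermonde_pos (x : Weyl N) : 0 < vandermonde x :=
  zero_lt_one.trans_le (one_le_vandermonde x)

theorem lagrange_eval_eq_sum (a : Weyl N) (r : Fin N) (x : ℝ) :
    (lagrange a r).eval x = ∑ m : Fin N, x ^ (m : ℕ) * (lagrange a r).coeff m := by
  have hinj : Set.InjOn (fun i => (a.1 i : ℝ)) (Finset.univ : Finset (Fin N)) :=
    (Int.cast_injective.comp a.2.injective).injOn
  have hd : (lagrange a r).natDegree < N := by
    rw [lagrange, Lagrange.natDegree_basis hinj (Finset.mem_univ r), Finset.card_univ,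
      Fintype.card_fin]
    have := r.pos
    lia
  rw [Polynomial.eval_eq_sum_range' hd,
    Fin.sum_univ_eq_sum_range (fun m => x ^ m * (lagrange a r).coeff m) N]
  exact Finset.sum_congr rfl fun m _ => mul_comm _ _

theorem lagrange_eval_node (a : Weyl N) (r i : Fin N) :
    (lagrange a r).eval (a.1 i : ℝ) = if i = r then 1 else 0 := by
  have hinj : Set.InjOn (fun i => (a.1 i : ℝ)) (Finset.univ : Finset (Fin N)) :=
    (Int.cast_injective.comp a.2.injective).injOn
  split_ifs with h
  · subst h
    exact Lagrange.eval_basis_self hinj (Finset.mem_univ i)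
  · exact Lagrange.eval_basis_of_ne (v := fun i => (a.1 i : ℝ)) (Ne.symm h) (Finset.mem_univ i)

theorem expSummable_lagrange (a : Weyl N) (r : Fin N) :
    ExpSummable fun n => (lagrange a r).eval (n : ℝ) := by
  simp_rw [lagrange_eval_eq_sum, mul_comm _ ((lagrange a r).coeff _)]
  exact ExpSummable.sum fun m _ => (expSummable_pow m).const_mul _

/-- The matrix factors as Vandermonde(b) · U · C, where U is upper triangular with diagonal e^t and
C, the Lagrange coefficients, inverts Vandermonde(a). -/
theorem det_expShift_lagrange (a b : Weyl N) (t : ℝ) :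
    (Matrix.of fun i r => expShift t (fun n => (lagrange a r).eval (n : ℝ)) (b.1 i)).det =
      Real.exp (N * t) * (vandermonde b / vandermonde a) := by
  set U : Matrix (Fin N) (Fin N) ℝ :=
    Matrix.of fun j m => ((m : ℕ).choose j * pmoment t (m - j) : ℝ) with hU
  set Cf : Matrix (Fin N) (Fin N) ℝ := Matrix.of fun m r => (lagrange a r).coeff m with hC
  have h1 : (Matrix.of fun i r => expShift t (fun n => (lagrange a r).eval (n : ℝ)) (b.1 i)) =
      Matrix.vandermonde (fun i => (b.1 i : ℝ)) * U * Cf := by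
    ext i r
    simp_rw [Matrix.of_apply, lagrange_eval_eq_sum, mul_comm _ ((lagrange a r).coeff _)]
    rw [expShift_sum (f := fun (m : Fin N) (n : ℤ) => (lagrange a r).coeff m * (n : ℝ) ^ (m : ℕ))
      fun m _ => (expSummable_pow m).const_mul _, Matrix.mul_apply]
    refine Finset.sum_congr rfl fun m _ => ?_
    rw [expShift_const_mul, expShift_pow t m.2, Matrix.mul_apply, mul_comm]
    rfl
  have h2 : Matrix.vandermonde (fun i => (a.1 i : ℝ)) * Cf = 1 := by
    ext i r
    rw [Matrix.mul_apply, Matrix.one_apply, ← lagrange_eval_node a, lagrange_eval_eq_sum]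
    rfl
  have h3 : U.det = Real.exp (N * t) := by
    rw [Matrix.det_of_isUpperTriangular]
    · simp [hU, pmoment_zero, Real.exp_nat_mul]
    · intro j m hjm
      simp only [hU, Matrix.of_apply]
      rw [Nat.choose_eq_zero_of_lt (show (m : ℕ) < j from hjm)]; simp
  have h4 : vandermonde a * Cf.det = 1 := by
    rw [← det_vandermonde_eq, ← Matrix.det_mul, h2, Matrix.det_one]
  have h5 : Cf.det = (vandermonde a)⁻¹ := eq_inv_of_mul_eq_one_right h4
  rw [h1, Matrix.det_mul, Matrix.det_mul, det_vandermonde_eq, h3, h5]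
  ring

end

/-! ### The generator and the Karlin–McGregor solution of the backward equation. -/

section

variable {N : ℕ}

theorem hasDerivAt_pweight (t : ℝ) (n : ℤ) :
    HasDerivAt (fun t => pweight t n) (pweight t (n - 1)) t := by
  rcases lt_or_ge n 0 with h | h
  · simp only [pweight_of_neg _ h, pweight_of_neg t (show n - 1 < 0 by lia)]
    exact hasDerivAt_const _ _
  · obtain ⟨m, rfl⟩ := Int.eq_ofNat_of_zero_le h
    simp only [pweight_natCast]
    rcases m with _ | m
    · simpa [pweight] using hasDerivAt_const t (1 : ℝ)
    · have h1 : ((m + 1 : ℕ) : ℤ) - 1 = (m : ℕ) := by push_cast; ring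
      rw [h1, pweight_natCast]
      refine ((hasDerivAt_pow (m + 1) t).div_const ((m + 1)! : ℝ)).congr_deriv ?_
      have h2 : (m ! : ℝ) ≠ 0 := by exact_mod_cast m.factorial_ne_zero
      rw [Nat.factorial_succ, Nat.add_sub_cancel]
      push_cast
      field_simp

theorem hasDerivAt_det {n : Type*} [Fintype n] [DecidableEq n] {M : ℝ → Matrix n n ℝ}
    {M' : Matrix n n ℝ} {t : ℝ} (h : ∀ i j, HasDerivAt (fun t => M t i j) (M' i j) t) :
    HasDerivAt (fun t => (M t).det) (∑ i, ((M t).updateRow i (M' i)).det) t := by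
  have h1 : ∀ A : Matrix n n ℝ, A.det = ∑ σ : Equiv.Perm n,
      ((Equiv.Perm.sign σ : ℤ) : ℝ) * ∏ i, A i (σ i) := fun A => by
    rw [← Matrix.det_transpose, Matrix.det_apply']; rfl
  have h2 : HasDerivAt (fun t => (M t).det) (∑ σ : Equiv.Perm n, ((Equiv.Perm.sign σ : ℤ) : ℝ) *
      ∑ i, (∏ j ∈ Finset.univ.erase i, M t j (σ j)) • M' i (σ i)) t := by
    simp_rw [h1]
    exact HasDerivAt.fun_sum fun σ _ => (HasDerivAt.fun_finsetProd fun i _ => h i (σ i)).const_mul _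
  refine h2.congr_deriv ?_
  simp_rw [h1, Finset.mul_sum]
  rw [Finset.sum_comm]
  refine Finset.sum_congr rfl fun i _ => Finset.sum_congr rfl fun σ _ => Eq.symm ?_
  rw [← Finset.mul_prod_erase _ _ (Finset.mem_univ i), Matrix.updateRow_self, smul_eq_mul,
    mul_comm (M' i (σ i))]
  congr 2
  refine Finset.prod_congr rfl fun j hj => ?_
  rw [Matrix.updateRow_ne (Finset.ne_of_mem_erase hj)]

/-- Jacobi's formula: the left side is tr(MA · adj M), and adj M · M = det M by cyclicity of the
trace. -/
theorem sum_det_updateRow_mul {n : Type*} [Fintype n] [DecidableEq n] (M A : Matrix n n ℝ) :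
    ∑ i, (M.updateRow i ((M * A) i)).det = A.trace * M.det := by
  have h1 : ∀ i, (M.updateRow i ((M * A) i)).det = ((M * A) * M.adjugate) i i := by
    intro i
    rw [← Matrix.cramer_transpose_apply, Matrix.cramer_eq_adjugate_mulVec,
      Matrix.mul_apply, ← Matrix.adjugate_transpose]
    simp only [Matrix.mulVec, dotProduct, Matrix.transpose_apply]
    exact Finset.sum_congr rfl fun j _ => mul_comm _ _
  simp_rw [h1]
  change (M * A * M.adjugate).trace = _
  rw [mul_assoc, Matrix.trace_mul_comm, mul_assoc, Matrix.adjugate_mul, Matrix.mul_smul, mul_one,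
    Matrix.trace_smul, smul_eq_mul, mul_comm]

/-- The vector `x + e_i`. -/
def bump (x : Fin N → ℤ) (i : Fin N) : Fin N → ℤ := Function.update x i (x i + 1)

/-- A unit step can reach the next particle but not overtake it, so leaving the chamber means a
collision. -/
theorem strictMono_bump_of_injective (x : Weyl N) {i : Fin N}
    (h : Function.Injective (bump x.1 i)) : StrictMono (bump x.1 i) := by
  refine Monotone.strictMono_of_injective (fun j k hjk => ?_) h
  rcases hjk.eq_or_lt with rfl | hlt
  · rfl
  have h1 : x.1 j + 1 ≤ x.1 k := x.2 hlt
  unfold bump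
  by_cases hj : j = i
  · subst hj
    rw [Function.update_self, Function.update_of_ne hlt.ne']
    exact h1
  · rw [Function.update_of_ne hj]
    by_cases hk : k = i
    · subst hk
      rw [Function.update_self]; lia
    · rw [Function.update_of_ne hk]; lia

theorem det_vandermonde_eq_zero {x : Fin N → ℤ} (hx : ¬ Function.Injective x) :
    (Matrix.vandermonde fun i => (x i : ℝ)).det = 0 := by
  obtain ⟨i, j, hij, hne⟩ := Function.not_injective_iff.1 hx
  refine Matrix.det_zero_of_row_eq hne ?_
  ext s; simp [Matrix.vandermonde_apply, hij]

/-- The Vandermonde determinant is harmonic. -/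
theorem sum_det_vandermonde_bump (x : Fin N → ℤ) :
    ∑ i, (Matrix.vandermonde fun j => (bump x i j : ℝ)).det =
      N * (Matrix.vandermonde fun i => (x i : ℝ)).det := by
  -- Pascal's matrix sends the Vandermonde row of a point to that of the point plus one; its
  -- diagonal is 1, so its trace is N.
  set A : Matrix (Fin N) (Fin N) ℝ := Matrix.of fun j m => ((m : ℕ).choose j : ℝ) with hA
  have h1 : A.trace = N := by simp [hA, Matrix.trace]
  rw [← h1, ← sum_det_updateRow_mul]
  refine Finset.sum_congr rfl fun i _ => ?_
  congr 1
  ext j m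
  by_cases hj : j = i
  · subst hj
    rw [Matrix.updateRow_self, Matrix.vandermonde_apply, bump, Function.update_self,
      Matrix.mul_apply]
    push_cast
    simp only [Matrix.vandermonde_apply, hA, Matrix.of_apply]
    rw [Fin.sum_univ_eq_sum_range (fun k => (x j : ℝ) ^ k * ((m : ℕ).choose k : ℝ)) N, add_pow]
    simp only [one_pow, mul_one]
    refine Finset.sum_subset_zero_on_sdiff (Finset.range_subset_range.2 m.2) ?_ fun _ _ => rfl
    intro k hk
    simp only [Finset.mem_sdiff, Finset.mem_range] at hk
    rw [Nat.choose_eq_zero_of_lt (by lia)]; simp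
  · rw [Matrix.updateRow_ne hj, Matrix.vandermonde_apply, Matrix.vandermonde_apply, bump,
      Function.update_of_ne hj]

open Classical in
/-- The generator of the noncolliding Poisson random walk. -/
def generator (f : Weyl N → ℝ) (x : Weyl N) : ℝ :=
  -(N : ℝ) * f x + ∑ i, if h : StrictMono (bump x.1 i) then
    vandermonde ⟨_, h⟩ / vandermonde x * f ⟨_, h⟩ else 0

open Classical in
-- Determinants vanish at collisions, so for them the free and the chamber-restricted sums agree.
theorem sum_dite_strictMono_bump (x : Weyl N) {E : (Fin N → ℤ) → ℝ}
    (hE : ∀ y, ¬ Function.Injective y → E y = 0) :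
    (∑ i, if StrictMono (bump x.1 i) then E (bump x.1 i) else 0) = ∑ i, E (bump x.1 i) := by
  refine Finset.sum_congr rfl fun i _ => ?_
  split_ifs with h
  · rfl
  · rw [hE _ fun h' => h (strictMono_bump_of_injective x h')]

open Classical in
theorem sum_vandermonde_bump (x : Weyl N) :
    (∑ i, if h : StrictMono (bump x.1 i) then vandermonde ⟨_, h⟩ / vandermonde x else 0) = N := by
  have h1 := sum_dite_strictMono_bump x fun y hy => det_vandermonde_eq_zero hy
  rw [sum_det_vandermonde_bump, det_vandermonde_eq] at h1
  rw [eq_comm, ← mul_div_cancel_right₀ (N : ℝ) (vandermonde_pos x).ne', ← h1, Finset.sum_div]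
  refine Finset.sum_congr rfl fun i _ => ?_
  split_ifs with h
  · rw [← det_vandermonde_eq ⟨_, h⟩]
  · simp

theorem generator_one (x : Weyl N) : generator (fun _ => 1) x = 0 := by
  simp only [generator, mul_one]
  rw [sum_vandermonde_bump]; ring

theorem generator_sub (f g : Weyl N → ℝ) (x : Weyl N) :
    generator (fun y => f y - g y) x = generator f x - generator g x := by
  unfold generator
  rw [add_sub_add_comm, ← Finset.sum_sub_distrib, mul_sub]
  congr 1
  refine Finset.sum_congr rfl fun i _ => ?_
  split_ifs <;> ring

/-- The jump rates out of x are positive and sum to N by harmonicity, and the diagonal contributes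
another N. -/
theorem abs_generator_le {f : Weyl N → ℝ} {B : ℝ} (hf : ∀ y, |f y| ≤ B) (x : Weyl N) :
    |generator f x| ≤ 2 * N * B := by
  classical
  have h1 : |∑ i, if h : StrictMono (bump x.1 i) then
      vandermonde ⟨_, h⟩ / vandermonde x * f ⟨_, h⟩ else 0| ≤ N * B := by
    rw [← sum_vandermonde_bump x, Finset.sum_mul]
    refine (Finset.abs_sum_le_sum_abs _ _).trans (Finset.sum_le_sum fun i _ => ?_)
    split_ifs with h
    · have : 0 < vandermonde ⟨_, h⟩ / vandermonde x :=
        div_pos (vandermonde_pos _) (vandermonde_pos x)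
      rw [abs_mul, abs_of_pos this]
      gcongr
      exact hf _
    · simp
  have h2 : |-(N : ℝ) * f x| ≤ N * B := by
    rw [abs_mul, abs_neg, Nat.abs_cast]
    gcongr
    exact hf _
  unfold generator
  refine (abs_add_le _ _).trans ?_
  linarith

theorem bump_injective (x : Fin N → ℤ) : Function.Injective (bump x) := by
  intro i j h
  by_contra hne
  have := congrFun h i
  rw [bump, bump, Function.update_self, Function.update_of_ne hne] at this
  lia

theorem bump_ne_self (x : Fin N → ℤ) (i : Fin N) : bump x i ≠ x := fun h => by
  have := congrFun h i
  rw [bump, Function.update_self] at this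
  lia

/-- Each row of rates has finite support, so entrywise convergence of the difference quotients can
be summed against any f. -/
theorem exists_sum_rate_eq_generator (x : Weyl N) : ∃ F : Finset (Weyl N), x ∈ F ∧
    ∀ f : Weyl N → ℝ, ∑ y ∈ F, poissonRate x y * f y = generator f x := by
  classical
  set G : {i // StrictMono (bump x.1 i)} ↪ Weyl N :=
    ⟨fun i => ⟨bump x.1 i.1, i.2⟩, fun i j h => Subtype.ext (bump_injective x.1
      (congrArg Subtype.val h))⟩ with hG
  have hx : x ∉ Finset.univ.map G := by
    simp only [Finset.mem_map, not_exists, not_and]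
    intro i _ h
    exact bump_ne_self x.1 i.1 (congrArg Subtype.val h)
  refine ⟨insert x (Finset.univ.map G), Finset.mem_insert_self _ _, fun f => ?_⟩
  rw [Finset.sum_insert hx, generator, Finset.sum_map]
  congr 1
  · congr 1
    rw [poissonRate, if_neg, if_pos rfl]
    rintro ⟨i, hi⟩
    exact bump_ne_self x.1 i hi.symm
  · rw [Finset.sum_dite, Finset.sum_const_zero, add_zero]
    refine Finset.sum_bij' (fun i _ => ⟨i.1, Finset.mem_filter.2 ⟨Finset.mem_univ _, i.2⟩⟩)
      (fun i _ => ⟨i.1, (Finset.mem_filter.1 i.2).2⟩) ?_ ?_ ?_ ?_ ?_ <;> try simp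
    intro i hi
    rw [poissonRate, if_pos ⟨i, rfl⟩]
    rfl

/-- The Karlin–McGregor determinant, `h`-transformed by the Vandermonde determinant. -/
def kmTransition (t : ℝ) (x z : Weyl N) : ℝ :=
  vandermonde z / vandermonde x *
    (Real.exp (-(N * t)) * (Matrix.of fun i j => pweight t (z.1 j - x.1 i)).det)

/-- Differentiating the weight lowers its argument by one, which in row i amounts to moving x_i to
x_i + 1. -/
theorem hasDerivAt_det_pweight (t : ℝ) (x z : Fin N → ℤ) :
    HasDerivAt (fun t => (Matrix.of fun i j => pweight t (z j - x i)).det)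
      (∑ i, (Matrix.of fun k j => pweight t (z j - bump x i k)).det) t := by
  have := hasDerivAt_det (M := fun t => Matrix.of fun i j => pweight t (z j - x i))
    (M' := Matrix.of fun i j => pweight t (z j - x i - 1)) (t := t)
    fun i j => hasDerivAt_pweight t _
  refine this.congr_deriv (Eq.symm (Finset.sum_congr rfl fun i _ => ?_))
  congr 1
  ext k j
  by_cases hk : k = i
  · subst hk
    rw [Matrix.updateRow_self, Matrix.of_apply, Matrix.of_apply, bump, Function.update_self]
    congr 1; ring
  · rw [Matrix.updateRow_ne hk, Matrix.of_apply, Matrix.of_apply, bump, Function.update_of_ne hk]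

theorem det_pweight_eq_zero (t : ℝ) {x : Fin N → ℤ} (z : Fin N → ℤ) (hx : ¬ Function.Injective x) :
    (Matrix.of fun i j => pweight t (z j - x i)).det = 0 := by
  obtain ⟨i, j, hij, hne⟩ := Function.not_injective_iff.1 hx
  refine Matrix.det_zero_of_row_eq hne ?_
  ext s; simp [hij]

/-- The exponential supplies the diagonal -N, the determinant supplies the free jumps, and those
leaving the chamber drop out. The Vandermonde ratios are exactly the conjugation in the rates. -/
theorem hasDerivAt_kmTransition (t : ℝ) (x z : Weyl N) :
    HasDerivAt (fun t => kmTransition t x z) (generator (fun y => kmTransition t y z) x) t := by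
  classical
  have h1 : HasDerivAt (fun t : ℝ => Real.exp (-(N * t))) (-(N : ℝ) * Real.exp (-(N * t))) t := by
    have := (((hasDerivAt_id' t).const_mul (N : ℝ)).fun_neg).exp
    exact this.congr_deriv (by ring)
  have h2 := (h1.fun_mul (hasDerivAt_det_pweight t x.1 z.1)).const_mul
    (vandermonde z / vandermonde x)
  refine h2.congr_deriv (Eq.symm ?_)
  rw [← sum_dite_strictMono_bump x
    (E := fun y => (Matrix.of fun k j => pweight t (z.1 j - y k)).det)
    fun y hy => det_pweight_eq_zero t z.1 hy]
  unfold generator kmTransition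
  rw [mul_add, Finset.mul_sum, Finset.mul_sum]
  congr 1
  · ring
  · refine Finset.sum_congr rfl fun i _ => ?_
    split_ifs with h
    · have h3 := (vandermonde_pos x).ne'
      have h4 := (vandermonde_pos (⟨_, h⟩ : Weyl N)).ne'
      field_simp
    · simp

theorem kmTransition_zero_self (x : Weyl N) : kmTransition 0 x x = 1 := by
  have : (Matrix.of fun i j => pweight 0 (x.1 j - x.1 i)) = 1 := by
    ext i j
    rw [Matrix.of_apply, Matrix.one_apply]
    split_ifs with h
    · subst h; simp [pweight]
    · rcases lt_or_ge (x.1 j - x.1 i) 0 with h1 | h1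
      · exact pweight_of_neg _ h1
      · have h2 : x.1 j - x.1 i ≠ 0 := fun h0 => h (x.2.injective (sub_eq_zero.1 h0)).symm
        rw [pweight, if_pos h1, zero_pow (by lia), zero_div]
  rw [kmTransition, this, Matrix.det_one, div_self (vandermonde_pos x).ne']
  simp

theorem kmTransition_zero_of_ne {x z : Weyl N} (h : x ≠ z) : kmTransition 0 x z = 0 := by
  have : ∃ j, z.1 j ∉ Set.range x.1 := by
    by_contra hc
    push Not at hc
    refine h (Subtype.ext ((StrictMono.range_inj x.2 z.2).1 ?_))
    have hsub : Set.range z.1 ⊆ Set.range x.1 := by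
      rintro _ ⟨j, rfl⟩; exact hc j
    refine (Set.eq_of_subset_of_ncard_le hsub ?_ (Set.finite_range _)).symm
    rw [← Set.image_univ, ← Set.image_univ, Set.ncard_image_of_injective _ x.2.injective,
      Set.ncard_image_of_injective _ z.2.injective]
  obtain ⟨j, hj⟩ := this
  rw [kmTransition, Matrix.det_eq_zero_of_column_eq_zero j, mul_zero, mul_zero]
  intro i
  rw [Matrix.of_apply]
  rcases lt_or_ge (z.1 j - x.1 i) 0 with h1 | h1
  · exact pweight_of_neg _ h1
  · have h2 : z.1 j - x.1 i ≠ 0 := fun h0 => hj ⟨i, (sub_eq_zero.1 h0).symm⟩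
    rw [pweight, if_pos h1, zero_pow (by lia), zero_div]

theorem abs_pweight_le {t : ℝ} (ht : 0 ≤ t) (n : ℤ) : |pweight t n| ≤ Real.exp t := by
  unfold pweight
  split_ifs
  · rw [abs_of_nonneg (by positivity)]
    exact Real.pow_div_factorial_le_exp t ht _
  · simpa using (Real.exp_pos t).le

/-- The entries are at most e^t, so the determinant is at most N! e^{Nt}, and the prefactor e^{-Nt}
cancels the growth. Uniformity in x starts the uniqueness iteration. -/
theorem abs_kmTransition_le {t : ℝ} (ht : 0 ≤ t) (x z : Weyl N) :
    |kmTransition t x z| ≤ vandermonde z * N ! := by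
  have h1 := Matrix.det_le (A := Matrix.of fun i j => pweight t (z.1 j - x.1 i))
    (abv := AbsoluteValue.abs) (x := Real.exp t) fun i j => abs_pweight_le ht _
  rw [Fintype.card_fin, ← Real.exp_nat_mul, nsmul_eq_mul] at h1
  have h1' : |(Matrix.of fun i j => pweight t (z.1 j - x.1 i)).det| ≤ N ! * Real.exp (N * t) := h1
  have hx := one_le_vandermonde x
  have hz := vandermonde_pos z
  rw [kmTransition, abs_mul, abs_mul, abs_of_pos (Real.exp_pos _),
    abs_of_pos (div_pos hz (vandermonde_pos x))]
  calc _ ≤ vandermonde z / 1 * (Real.exp (-(N * t)) * (N ! * Real.exp (N * t))) := by gcongr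
    _ = vandermonde z * N ! * (Real.exp (-(N * t)) * Real.exp (N * t)) := by ring
    _ = _ := by rw [← Real.exp_add]; simp

end

/-! ### Uniqueness of the transition function with the given rates. -/

section

variable {N : ℕ} {S : Type*} {p : ℝ≥0 → S → S → ℝ}

theorem IsTransitionFunction.le_one (hp : IsTransitionFunction p) (t : ℝ≥0) (x y : S) :
    p t x y ≤ 1 := by
  have := sum_le_hasSum {y} (fun z _ => hp.nonneg t x z) (hp.hasSum_one t x)
  simpa using this

theorem IsTransitionFunction.zero_of_ne (hp : IsTransitionFunction p) {x y : S} (h : x ≠ y) :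
    p 0 x y = 0 := by
  classical
  have := sum_le_hasSum {x, y} (fun z _ => hp.nonneg 0 x z) (hp.hasSum_one 0 x)
  rw [Finset.sum_pair h, hp.zero_self] at this
  linarith [hp.nonneg 0 x y]

theorem IsTransitionFunction.sum_zero (hp : IsTransitionFunction p) {x : S} {F : Finset S}
    (hx : x ∈ F) (f : S → ℝ) : ∑ y ∈ F, p 0 x y * f y = f x := by
  rw [Finset.sum_eq_single_of_mem x hx fun y _ hy => by rw [hp.zero_of_ne hy.symm, zero_mul],
    hp.zero_self, one_mul]

theorem IsTransitionFunction.sum_le (hp : IsTransitionFunction p) (h t : ℝ≥0) (x z : S)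
    (F : Finset S) : ∑ y ∈ F, p h x y * p t y z ≤ p (h + t) x z :=
  sum_le_hasSum F (fun _ _ => mul_nonneg (hp.nonneg _ _ _) (hp.nonneg _ _ _))
    (hp.chapman_kolmogorov h t x z)

/-- In the Chapman–Kolmogorov sum the states outside F contribute at most their total mass, because
p ≤ 1. -/
theorem IsTransitionFunction.le_sum_add (hp : IsTransitionFunction p) (h t : ℝ≥0) (x z : S)
    (F : Finset S) :
    p (h + t) x z ≤ ∑ y ∈ F, p h x y * p t y z + (1 - ∑ y ∈ F, p h x y) := by
  have h1 := (hp.hasSum_one h x).sub (hp.chapman_kolmogorov h t x z)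
  have h2 := sum_le_hasSum F (fun y _ => by
    have := mul_le_mul_of_nonneg_left (hp.le_one t y z) (hp.nonneg h x y)
    linarith) h1
  rw [Finset.sum_sub_distrib] at h2
  linarith

theorem IsTransitionFunction.abs_sub_le (hp : IsTransitionFunction p) (h t : ℝ≥0) (x z : S) :
    |p (h + t) x z - p t x z| ≤ 1 - p h x x := by
  have h1 := hp.sum_le h t x z {x}
  have h2 := hp.le_sum_add h t x z {x}
  rw [Finset.sum_singleton] at h1 h2
  rw [Finset.sum_singleton] at h2
  have h3 := hp.le_one t x z
  have h4 := hp.nonneg t x z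
  have h5 := hp.le_one h x x
  rw [abs_le]
  constructor <;> nlinarith

theorem tendsto_transition_zero {q : S → S → ℝ} (hq : HasJumpRates p q) (x y : S) :
    Tendsto (fun h => p h x y) (𝓝 0) (𝓝 (p 0 x y)) := by
  have h1 : Tendsto (fun h : ℝ≥0 => (h : ℝ)) (𝓝[>] 0) (𝓝 0) :=
    tendsto_nhdsWithin_of_tendsto_nhds (NNReal.continuous_coe.tendsto 0)
  have h2 := ((hq x y).mul h1).add_const (p 0 x y)
  rw [mul_zero, zero_add] at h2
  have h3 : ContinuousWithinAt (fun h => p h x y) (Set.Ioi 0) 0 := by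
    refine h2.congr' ?_
    filter_upwards [self_mem_nhdsWithin] with h hh
    have : (h : ℝ) ≠ 0 := by exact_mod_cast (ne_of_gt hh)
    rw [div_mul_cancel₀ _ this, sub_add_cancel]
  rw [continuousWithinAt_Ioi_iff_Ici] at h3
  have h4 : Set.Ici (0 : ℝ≥0) = Set.univ := by ext; simp
  rwa [h4, continuousWithinAt_univ] at h3

theorem continuous_transition (hp : IsTransitionFunction p) {q : S → S → ℝ}
    (hq : HasJumpRates p q) (x z : S) : Continuous fun t => p t x z := by
  rw [continuous_iff_continuousAt]
  intro t
  -- With truncated subtraction this expression is |s - t|, which treats both sides of t at once.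
  have h1 : Tendsto (fun s : ℝ≥0 => (s - t) + (t - s)) (𝓝 t) (𝓝 0) := by
    have : Continuous fun s : ℝ≥0 => (s - t) + (t - s) := by fun_prop
    simpa using this.tendsto t
  have h2 := ((tendsto_transition_zero hq x x).comp h1).const_sub 1
  rw [hp.zero_self, sub_self] at h2
  refine tendsto_iff_dist_tendsto_zero.2 (squeeze_zero (fun _ => dist_nonneg) (fun s => ?_) h2)
  simp only [Function.comp, Real.dist_eq]
  rcases le_total s t with h | h
  · rw [tsub_eq_zero_of_le h, zero_add, abs_sub_comm]
    have := hp.abs_sub_le (t - s) s x z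
    rwa [tsub_add_cancel_of_le h] at this
  · rw [tsub_eq_zero_of_le h, add_zero]
    have := hp.abs_sub_le (s - t) t x z
    rwa [tsub_add_cancel_of_le h] at this

/-- The Kolmogorov backward equation. -/
theorem tendsto_transition_slope {p : ℝ≥0 → Weyl N → Weyl N → ℝ} (hp : IsTransitionFunction p)
    (hq : HasJumpRates p poissonRate) (t : ℝ≥0) (x z : Weyl N) :
    Tendsto (fun h : ℝ≥0 => (p (h + t) x z - p t x z) / (h : ℝ)) (𝓝[>] 0)
      (𝓝 (generator (fun y => p t y z) x)) := by
  obtain ⟨F, hxF, hF⟩ := exists_sum_rate_eq_generator x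
  have h1 : ∀ f : Weyl N → ℝ, Tendsto
      (fun h : ℝ≥0 => ∑ y ∈ F, (p h x y - p 0 x y) / (h : ℝ) * f y) (𝓝[>] 0)
      (𝓝 (generator f x)) := fun f => by
    rw [← hF]
    exact tendsto_finsetSum _ fun y _ => (hq x y).mul_const _
  have h2 := h1 fun y => p t y z
  -- The gap between the lower and upper bounds is governed by the mass escaping F. Its rate
  -- vanishes since the generator kills constants, so a squeeze replaces exchanging a limit with an
  -- infinite sum.
  have h3 := h2.sub (h1 fun _ => 1)
  rw [generator_one, sub_zero] at h3
  refine tendsto_of_tendsto_of_tendsto_of_le_of_le' h2 h3 ?_ ?_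
  · filter_upwards [self_mem_nhdsWithin] with h hh
    have hh' : 0 < (h : ℝ) := by exact_mod_cast hh
    have h4 := hp.sum_le h t x z F
    rw [le_div_iff₀ hh', Finset.sum_mul]
    have h5 : ∑ y ∈ F, (p h x y - p 0 x y) / (h : ℝ) * p t y z * h =
        ∑ y ∈ F, p h x y * p t y z - ∑ y ∈ F, p 0 x y * p t y z := by
      rw [← Finset.sum_sub_distrib]
      refine Finset.sum_congr rfl fun y _ => ?_
      field_simp
    rw [h5, hp.sum_zero hxF]
    linarith
  · filter_upwards [self_mem_nhdsWithin] with h hh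
    have hh' : 0 < (h : ℝ) := by exact_mod_cast hh
    have h4 := hp.le_sum_add h t x z F
    rw [div_le_iff₀ hh', sub_mul, Finset.sum_mul, Finset.sum_mul]
    have h5 : ∀ f : Weyl N → ℝ, ∑ y ∈ F, (p h x y - p 0 x y) / (h : ℝ) * f y * h =
        ∑ y ∈ F, p h x y * f y - f x := by
      intro f
      rw [← hp.sum_zero hxF f, ← Finset.sum_sub_distrib]
      refine Finset.sum_congr rfl fun y _ => ?_
      field_simp
    rw [h5 fun y => p t y z, h5 fun _ => 1]
    simp only [mul_one]
    linarith

theorem hasDerivWithinAt_transition {p : ℝ≥0 → Weyl N → Weyl N → ℝ} (hp : IsTransitionFunction p)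
    (hq : HasJumpRates p poissonRate) {t : ℝ} (ht : 0 ≤ t) (x z : Weyl N) :
    HasDerivWithinAt (fun s : ℝ => p s.toNNReal x z)
      (generator (fun y => p t.toNNReal y z) x) (Set.Ici t) t := by
  rw [← hasDerivWithinAt_Ioi_iff_Ici, hasDerivWithinAt_iff_tendsto_slope' (by simp)]
  have h1 : Tendsto (fun s : ℝ => (s - t).toNNReal) (𝓝[>] t) (𝓝[>] 0) := by
    refine tendsto_nhdsWithin_iff.2 ⟨?_, ?_⟩
    · have : Continuous fun s : ℝ => (s - t).toNNReal := by fun_prop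
      have h := this.tendsto t
      rw [sub_self, Real.toNNReal_zero] at h
      exact tendsto_nhdsWithin_of_tendsto_nhds h
    · filter_upwards [self_mem_nhdsWithin] with s hs
      exact Real.toNNReal_pos.2 (sub_pos.2 hs)
  refine ((tendsto_transition_slope hp hq t.toNNReal x z).comp h1).congr' ?_
  filter_upwards [self_mem_nhdsWithin] with s hs
  have hs' : t < s := hs
  simp only [Function.comp, slope_def_field]
  rw [Real.coe_toNNReal _ (sub_nonneg.2 hs'.le), ← Real.toNNReal_add (sub_nonneg.2 hs'.le) ht,
    sub_add_cancel]

/-- The transition function of the noncolliding Poisson random walk is determined by its jump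
rates. -/
theorem transition_eq_kmTransition {p : ℝ≥0 → Weyl N → Weyl N → ℝ} (hp : IsTransitionFunction p)
    (hq : HasJumpRates p poissonRate) (t : ℝ≥0) (x z : Weyl N) :
    p t x z = kmTransition t x z := by
  set D : ℝ → Weyl N → ℝ := fun s y => p s.toNNReal y z - kmTransition s y z with hD
  set B : ℝ := 1 + vandermonde z * N ! with hB
  have hB0 : 0 ≤ B := by have := vandermonde_pos z; positivity
  have hder : ∀ (y : Weyl N) (s : ℝ), 0 ≤ s →
      HasDerivWithinAt (fun s => D s y) (generator (D s) y) (Set.Ici s) s := by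
    intro y s hs
    rw [hD]
    simp only
    rw [generator_sub]
    exact (hasDerivWithinAt_transition hp hq hs y z).fun_sub
      (hasDerivAt_kmTransition s y z).hasDerivWithinAt
  have hcont : ∀ y : Weyl N, Continuous fun s => D s y := by
    intro y
    refine ((continuous_transition hp hq y z).comp continuous_real_toNNReal).sub ?_
    exact continuous_iff_continuousAt.2 fun s => (hasDerivAt_kmTransition s y z).continuousAt
  have hzero : ∀ y, D 0 y = 0 := by
    intro y
    simp only [hD, Real.toNNReal_zero]
    by_cases h : y = z
    · subst h; rw [hp.zero_self, kmTransition_zero_self, sub_self]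
    · rw [hp.zero_of_ne h, kmTransition_zero_of_ne h, sub_self]
  -- Picard iteration: D vanishes at time 0 and its right derivative is bounded by 2N times the
  -- previous bound, uniformly in y. Letting n → ∞ forces D = 0.
  have key : ∀ (n : ℕ) (s : ℝ), 0 ≤ s → ∀ y, |D s y| ≤ B * ((2 * N * s) ^ n / n !) := by
    intro n
    induction n with
    | zero =>
      intro s hs y
      simp only [pow_zero, Nat.factorial_zero, Nat.cast_one, div_one, mul_one]
      refine (abs_sub _ _).trans (add_le_add ?_ (abs_kmTransition_le hs y z))
      rw [abs_of_nonneg (hp.nonneg _ _ _)]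
      exact hp.le_one _ _ _
    | succ n ih =>
      intro s hs y
      have hb : ∀ r : ℝ, HasDerivAt (fun r : ℝ => B * ((2 * N * r) ^ (n + 1) / (n + 1)!))
          (2 * N * (B * ((2 * N * r) ^ n / n !))) r := by
        intro r
        have h1 := ((((hasDerivAt_id' r).const_mul (2 * N : ℝ)).fun_pow (n + 1)).div_const
          ((n + 1)! : ℝ)).const_mul B
        refine h1.congr_deriv ?_
        have h2 : (n ! : ℝ) ≠ 0 := by exact_mod_cast n.factorial_ne_zero
        rw [Nat.factorial_succ, Nat.add_sub_cancel]
        push_cast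
        field_simp
      have := image_norm_le_of_norm_deriv_right_le_deriv_boundary (a := 0) (b := s)
        (f := fun s => D s y) (f' := fun s => generator (D s) y) (hcont y).continuousOn
        (fun r hr => hder y r hr.1) (by simp [hzero]) hb
        (fun r hr => abs_generator_le (ih r hr.1) y)
      exact this ⟨hs, le_rfl⟩
  have hlim := (FloorSemiring.tendsto_pow_div_factorial_atTop (2 * N * (t : ℝ))).const_mul B
  rw [mul_zero] at hlim
  have h0 : |D t x| ≤ 0 := ge_of_tendsto' hlim fun n => key n t t.2 x
  have h1 := abs_nonpos_iff.1 h0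
  simp only [hD, Real.toNNReal_coe] at h1
  exact sub_eq_zero.1 h1

end

/-! ### Backward propagation of the weights through determinants. -/

section

variable {N k : ℕ}

theorem prod_one_add_ite_unique {ι : Type*} (s : Finset ι) (P : ι → Prop) [DecidablePred P]
    [Decidable (∃ i ∈ s, P i)] (u : ℝ) (h : ∀ i ∈ s, ∀ j ∈ s, P i → P j → i = j) :
    ∏ i ∈ s, (1 + u * if P i then 1 else 0) = 1 + u * if ∃ i ∈ s, P i then 1 else 0 := by
  split_ifs with h0
  · obtain ⟨i, hi, hPi⟩ := h0
    rw [Finset.prod_eq_single_of_mem i hi, if_pos hPi]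
    intro j hj hji
    rw [if_neg fun hPj => hji (h j hj i hi hPj hPi), mul_zero, add_zero]
  · push Not at h0
    rw [mul_zero, add_zero]
    refine Finset.prod_eq_one fun i hi => ?_
    rw [if_neg (h0 i hi), mul_zero, add_zero]

/-- Transition weights between the space-time points `(τ_α, y_α)`, directed forward in time. -/
def forwardMatrix (τ : Fin k → ℝ≥0) (y : Fin k → ℤ) : Matrix (Fin k) (Fin k) ℝ :=
  Matrix.of fun β α => if τ β < τ α then pweight (τ α - τ β) (y α - y β) else 0

/-- The backward evolved Lagrange polynomials at the space-time points. -/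
def terminalMatrix (a : Weyl N) (τ : Fin k → ℝ≥0) (y : Fin k → ℤ) : Matrix (Fin k) (Fin N) ℝ :=
  Matrix.of fun β r => expShift (-τ β) (fun n => (lagrange a r).eval (n : ℝ)) (y β)

/-- Transition weights from the initial points `a_r` to the space-time points. -/
def initialMatrix (a : Weyl N) (τ : Fin k → ℝ≥0) (y : Fin k → ℤ) : Matrix (Fin N) (Fin k) ℝ :=
  Matrix.of fun r α => pweight (τ α) (y α - a.1 r)

/-- The solution `G` of `(1 - u Φ) G = Ψ`. -/
def resolvent (a : Weyl N) (τ : Fin k → ℝ≥0) (y : Fin k → ℤ) (u : ℝ) :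
    Matrix (Fin k) (Fin N) ℝ :=
  (1 - u • forwardMatrix τ y)⁻¹ * terminalMatrix a τ y

/-- The forward weights strictly increase time, so the matrix is block triangular with identity
blocks on equal times. -/
theorem det_one_sub_forwardMatrix (τ : Fin k → ℝ≥0) (y : Fin k → ℤ) (u : ℝ) :
    (1 - u • forwardMatrix τ y).det = 1 := by
  have h : Matrix.BlockTriangular (1 - u • forwardMatrix τ y) τ := by
    intro i j hij
    have hne : i ≠ j := fun h => by subst h; exact lt_irrefl _ hij
    simp [forwardMatrix, Matrix.one_apply_ne hne, hij.not_gt]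
  rw [h.det]
  refine Finset.prod_eq_one fun t _ => ?_
  have : (1 - u • forwardMatrix τ y).toSquareBlock τ t = 1 := by
    ext i j
    have h1 : τ i.1 = τ j.1 := i.2.trans j.2.symm
    simp [Matrix.toSquareBlock_def, forwardMatrix, h1, Matrix.one_apply, Subtype.ext_iff]
  rw [this, Matrix.det_one]

theorem resolvent_eq (a : Weyl N) (τ : Fin k → ℝ≥0) (y : Fin k → ℤ) (u : ℝ) (β : Fin k)
    (r : Fin N) : resolvent a τ y u β r = terminalMatrix a τ y β r +
      u * ∑ α, forwardMatrix τ y β α * resolvent a τ y u α r := by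
  have h1 : (1 - u • forwardMatrix τ y) * resolvent a τ y u = terminalMatrix a τ y := by
    rw [resolvent, Matrix.mul_nonsing_inv_cancel_left]
    rw [det_one_sub_forwardMatrix]; exact isUnit_one
  rw [Matrix.sub_mul, Matrix.one_mul, Matrix.smul_mul] at h1
  have h2 := congrFun (congrFun h1 β) r
  rw [Matrix.sub_apply, Matrix.smul_apply, Matrix.mul_apply, smul_eq_mul] at h2
  linarith

/-- The functions that are propagated backward in time through the weights
`1 + u 1_{y_α}` at the times `τ_α`. -/
def backward (a : Weyl N) (τ : Fin k → ℝ≥0) (y : Fin k → ℤ) (u : ℝ) (s : ℝ≥0) (r : Fin N)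
    (x : ℤ) : ℝ :=
  expShift (-s) (fun n => (lagrange a r).eval (n : ℝ)) x +
    ∑ β with s < τ β, u * resolvent a τ y u β r * expShift (τ β - s) (pointMass (y β)) x

theorem expSummable_backward (a : Weyl N) (τ : Fin k → ℝ≥0) (y : Fin k → ℤ) (u : ℝ) (s : ℝ≥0)
    (r : Fin N) : ExpSummable (backward a τ y u s r) :=
  ((expSummable_lagrange a r).expShift _).add
    (ExpSummable.sum fun β _ => ((expSummable_pointMass (y β)).expShift _).const_mul _)

/-- This is the self-consistency behind the resolvent: the coefficient of each point mass must be u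
times the value of the propagated function at that point. -/
theorem backward_self (a : Weyl N) (τ : Fin k → ℝ≥0) (y : Fin k → ℤ) (u : ℝ) (β : Fin k)
    (r : Fin N) : backward a τ y u (τ β) r (y β) = resolvent a τ y u β r := by
  rw [resolvent_eq, backward, Finset.mul_sum, Finset.sum_filter]
  congr 1
  refine Finset.sum_congr rfl fun α _ => ?_
  rw [expShift_pointMass, forwardMatrix, Matrix.of_apply]
  split_ifs
  · ring
  · simp

/-- The weight at the time `t`. -/
def timeWeight (τ : Fin k → ℝ≥0) (y : Fin k → ℤ) (u : ℝ) (t : ℝ≥0) (x : ℤ) : ℝ :=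
  ∏ β with τ β = t, (1 + u * pointMass (y β) x)

/-- Marked points at a common time are distinct, so at most one factor differs from 1 at x.
Multiplying f by 1 + u 1_y adds u f(y) 1_y, and f(y) is the resolvent entry. -/
theorem timeWeight_mul_backward (a : Weyl N) {τ : Fin k → ℝ≥0} {y : Fin k → ℤ}
    (hinj : Function.Injective fun i => (τ i, y i)) (u : ℝ) (t : ℝ≥0) (r : Fin N) (x : ℤ) :
    timeWeight τ y u t x * backward a τ y u t r x = backward a τ y u t r x +
      ∑ β with τ β = t, u * resolvent a τ y u β r * pointMass (y β) x := by
  classical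
  have huniq : ∀ α β, τ α = t → τ β = t → x = y α → x = y β → α = β :=
    fun α β h1 h2 h3 h4 => hinj (Prod.ext (h1.trans h2.symm) (h3.symm.trans h4))
  unfold timeWeight pointMass
  rw [prod_one_add_ite_unique]
  · split_ifs with h
    · obtain ⟨β, hβ, hx⟩ := h
      have hβt := (Finset.mem_filter.1 hβ).2
      rw [Finset.sum_eq_single_of_mem β hβ, if_pos hx, ← backward_self, hβt, hx]
      · ring
      · intro α hα hne
        rw [if_neg, mul_zero]
        exact fun hxα => hne (huniq α β (Finset.mem_filter.1 hα).2 hβt hxα hx)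
    · push Not at h
      rw [Finset.sum_eq_zero]
      · ring
      · intro β hβ
        rw [if_neg (h β hβ), mul_zero]
  · intro α hα β hβ h1 h2
    exact huniq α β (Finset.mem_filter.1 hα).2 (Finset.mem_filter.1 hβ).2 h1 h2

theorem expSummable_timeWeight_mul_backward (a : Weyl N) {τ : Fin k → ℝ≥0} {y : Fin k → ℤ}
    (hinj : Function.Injective fun i => (τ i, y i)) (u : ℝ) (t : ℝ≥0) (r : Fin N) :
    ExpSummable fun x => timeWeight τ y u t x * backward a τ y u t r x := by
  simp_rw [timeWeight_mul_backward a hinj]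
  exact (expSummable_backward a τ y u t r).add
    (ExpSummable.sum fun β _ => (expSummable_pointMass (y β)).const_mul _)

theorem filter_lt_eq_union {τ : Fin k → ℝ≥0} {s t : ℝ≥0} (hst : s < t)
    (hgap : ∀ α, s < τ α → t ≤ τ α) :
    (Finset.univ.filter fun β => s < τ β) =
      (Finset.univ.filter fun β => t < τ β) ∪ Finset.univ.filter fun β => τ β = t := by
  ext β
  simp only [Finset.mem_filter, Finset.mem_univ, true_and, Finset.mem_union]
  constructor
  · intro h
    rcases (hgap β h).lt_or_eq with h1 | h1
    · exact Or.inl h1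
    · exact Or.inr h1.symm
  · rintro (h | h)
    · exact hst.trans h
    · rwa [h]

theorem disjoint_filter_lt_eq (τ : Fin k → ℝ≥0) (t : ℝ≥0) :
    Disjoint (Finset.univ.filter fun β => t < τ β) (Finset.univ.filter fun β => τ β = t) := by
  rw [Finset.disjoint_filter]
  exact fun β _ h h' => h.ne' h'

/-- By the group law each term is carried from t to s. As no marked time lies strictly between, the
point masses created at t are exactly the new terms of the sum at s. -/
theorem expShift_timeWeight_mul_backward (a : Weyl N) {τ : Fin k → ℝ≥0} {y : Fin k → ℤ}
    (hinj : Function.Injective fun i => (τ i, y i)) (u : ℝ) {s t : ℝ≥0} (hst : s < t)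
    (hgap : ∀ α, s < τ α → t ≤ τ α) (r : Fin N) (x : ℤ) :
    expShift ((t : ℝ) - s) (fun x => timeWeight τ y u t x * backward a τ y u t r x) x =
      backward a τ y u s r x := by
  simp_rw [timeWeight_mul_backward a hinj]
  rw [expShift_add (expSummable_backward a τ y u t r)
    (ExpSummable.sum fun β _ => (expSummable_pointMass (y β)).const_mul _),
    expShift_sum fun β _ => (expSummable_pointMass (y β)).const_mul _]
  simp_rw [expShift_const_mul]
  have h1 : expShift ((t : ℝ) - s) (backward a τ y u t r) x =
      expShift (-s) (fun n => (lagrange a r).eval (n : ℝ)) x +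
      ∑ β with t < τ β, u * resolvent a τ y u β r * expShift (τ β - s) (pointMass (y β)) x := by
    change expShift ((t : ℝ) - s) (fun x => expShift (-t) (fun n => (lagrange a r).eval (n : ℝ)) x +
      ∑ β with t < τ β, u * resolvent a τ y u β r * expShift (τ β - t) (pointMass (y β)) x) x = _
    rw [expShift_add ((expSummable_lagrange a r).expShift _)
      (ExpSummable.sum fun β _ => ((expSummable_pointMass (y β)).expShift _).const_mul _),
      expShift_sum fun β _ => ((expSummable_pointMass (y β)).expShift _).const_mul _]
    simp_rw [expShift_const_mul]
    congr 1
    · rw [expShift_expShift (expSummable_lagrange a r)]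
      congr 1; ring
    · refine Finset.sum_congr rfl fun β _ => ?_
      rw [expShift_expShift (expSummable_pointMass _)]
      congr 2; ring
  rw [h1, backward, filter_lt_eq_union hst hgap, Finset.sum_union (disjoint_filter_lt_eq τ t),
    add_assoc]
  congr 2
  refine Finset.sum_congr rfl fun β hβ => ?_
  rw [(Finset.mem_filter.1 hβ).2]

/-- The conditional expectation of the remaining weights, given the position `b` at time `s`. -/
def condWeight (a : Weyl N) (τ : Fin k → ℝ≥0) (y : Fin k → ℤ) (u : ℝ) (s : ℝ≥0) (b : Weyl N) : ℝ :=
  Real.exp (N * s) * (vandermonde a / vandermonde b) *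
    (Matrix.of fun i r => backward a τ y u s r (b.1 i)).det

theorem condWeight_eq_one (a : Weyl N) {τ : Fin k → ℝ≥0} (y : Fin k → ℤ) (u : ℝ) {s : ℝ≥0}
    (hs : ∀ α, ¬ s < τ α) (b : Weyl N) : condWeight a τ y u s b = 1 := by
  have h1 : (Finset.univ.filter fun β => s < τ β) = ∅ :=
    Finset.filter_eq_empty_iff.2 fun β _ => hs β
  unfold condWeight backward
  rw [h1]
  simp only [Finset.sum_empty, add_zero]
  rw [det_expShift_lagrange]
  have h2 := (vandermonde_pos a).ne'
  have h3 := (vandermonde_pos b).ne'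
  calc _ = (Real.exp (N * s) * Real.exp (N * -s)) * ((vandermonde a / vandermonde b) *
        (vandermonde b / vandermonde a)) := by ring
    _ = 1 := by
      rw [← Real.exp_add, div_mul_div_cancel₀ h3, div_self h2]; simp

/-- The weights at time t are absorbed into the rows of the second determinant, and Cauchy–Binet
composes it with the Karlin–McGregor determinant. The Vandermonde factors of c cancel and the
exponentials combine. -/
theorem hasSum_condWeight (a : Weyl N) {τ : Fin k → ℝ≥0} {y : Fin k → ℤ}
    (hinj : Function.Injective fun i => (τ i, y i)) (u : ℝ) {s t : ℝ≥0} (hst : s < t)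
    (hgap : ∀ α, s < τ α → t ≤ τ α) (b : Weyl N) :
    HasSum (fun c : Weyl N => kmTransition ((t : ℝ) - s) b c *
      ((∏ j, timeWeight τ y u t (c.1 j)) * condWeight a τ y u t c)) (condWeight a τ y u s b) := by
  have h1 : ∀ i r, HasSum (fun x : ℤ => pweight ((t : ℝ) - s) (x - b.1 i) *
      (timeWeight τ y u t x * backward a τ y u t r x)) (backward a τ y u s r (b.1 i)) := by
    intro i r
    rw [← expShift_timeWeight_mul_backward a hinj u hst hgap r]
    exact (expSummable_timeWeight_mul_backward a hinj u t r).hasSum_pweight _ _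
  have h2 := hasSum_det_mul_det (A := fun i x => pweight ((t : ℝ) - s) (x - b.1 i))
    (B := fun x r => timeWeight τ y u t x * backward a τ y u t r x) fun i r => (h1 i r).summable
  simp_rw [fun i r => (h1 i r).tsum_eq] at h2
  have h3 := h2.mul_left (Real.exp (N * s) * (vandermonde a / vandermonde b))
  refine h3.congr_fun fun c => ?_
  have h4 := Matrix.det_mul_column (fun j => timeWeight τ y u t (c.1 j))
    (Matrix.of fun j r => backward a τ y u t r (c.1 j))
  simp only [Matrix.of_apply] at h4
  rw [h4, kmTransition, condWeight]
  have h5 := (vandermonde_pos c).ne'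
  have h6 := (vandermonde_pos b).ne'
  have h7 : Real.exp (N * (s : ℝ)) = Real.exp (-(N * ((t : ℝ) - s))) * Real.exp (N * t) := by
    rw [← Real.exp_add]; congr 1; ring
  rw [h7]
  field_simp

open Classical in
theorem prod_timeWeight (τ : Fin k → ℝ≥0) (y : Fin k → ℤ) (u : ℝ) (t : ℝ≥0) (c : Weyl N) :
    ∏ j, timeWeight τ y u t (c.1 j) =
      ∏ β with τ β = t, (1 + u * if ∃ j, c.1 j = y β then 1 else 0) := by
  unfold timeWeight pointMass
  rw [Finset.prod_comm]
  refine Finset.prod_congr rfl fun β _ => ?_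
  rw [prod_one_add_ite_unique]
  · simp
  · exact fun i _ j _ h1 h2 => c.2.injective (h1.trans h2.symm)

end

/-! ### The generating function of the correlations along the Markov chain. -/

section

variable {N k : ℕ} {Ω : Type*} {X : ℝ≥0 → Ω → Weyl N}

open Classical in
/-- The weight of a trajectory at the space-time point `(τ, y)`. -/
def pointWeight (X : ℝ≥0 → Ω → Weyl N) (u : ℝ) (τ : ℝ≥0) (y : ℤ) (ω : Ω) : ℝ :=
  1 + u * if ∃ j, (X τ ω).1 j = y then 1 else 0

theorem norm_pointWeight_le (u : ℝ) (t : ℝ≥0) (y : ℤ) (ω : Ω) :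
    ‖pointWeight X u t y ω‖ ≤ 1 + |u| := by
  unfold pointWeight
  refine (norm_add_le _ _).trans ?_
  rw [norm_one, norm_mul, Real.norm_eq_abs]
  gcongr
  split_ifs <;> simp

theorem setOf_snoc_eq {n : ℕ} (t : Fin (n + 1) → ℝ≥0) (x : Fin (n + 1) → Weyl N) (t' : ℝ≥0)
    (c : Weyl N) :
    {ω | ∀ i : Fin (n + 2), X ((Fin.snoc t t' : Fin (n + 2) → ℝ≥0) i) ω =
      (Fin.snoc x c : Fin (n + 2) → Weyl N) i} =
    {ω | (∀ i, X (t i) ω = x i) ∧ X t' ω = c} := by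
  ext ω
  simp only [Set.mem_ofPred_eq, Fin.forall_fin_succ' (n := n + 1), Fin.snoc_castSucc, Fin.snoc_last]

theorem monotone_snoc {n : ℕ} {t : Fin (n + 1) → ℝ≥0} (ht : Monotone t) {t' : ℝ≥0}
    (h : t (Fin.last n) ≤ t') : Monotone (Fin.snoc t t' : Fin (n + 2) → ℝ≥0) := by
  intro i j hij
  induction j using Fin.lastCases with
  | last =>
    rw [Fin.snoc_last]
    induction i using Fin.lastCases with
    | last => rw [Fin.snoc_last]
    | cast i => rw [Fin.snoc_castSucc]; exact (ht (Fin.le_last i)).trans h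
  | cast j =>
    induction i using Fin.lastCases with
    | last => exact absurd hij (not_le.2 (Fin.castSucc_lt_last j))
    | cast i =>
      rw [Fin.snoc_castSucc, Fin.snoc_castSucc]
      exact ht (Fin.castSucc_le_castSucc_iff.1 hij)

variable [MeasurableSpace Ω] {μ : Measure Ω}

theorem measurableSet_contains (hX : ∀ t x, MeasurableSet {ω | X t ω = x}) (t : ℝ≥0)
    (A : Set (Weyl N)) : MeasurableSet {ω | X t ω ∈ A} := by
  have : {ω | X t ω ∈ A} = ⋃ x ∈ A, {ω | X t ω = x} := by ext; simp
  rw [this]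
  exact MeasurableSet.biUnion A.to_countable fun x _ => hX t x

open Classical in
theorem measurable_pointWeight (hX : ∀ t x, MeasurableSet {ω | X t ω = x}) (u : ℝ) (t : ℝ≥0)
    (y : ℤ) : Measurable (pointWeight X u t y) := by
  unfold pointWeight
  refine measurable_const.add (measurable_const.mul (Measurable.ite ?_ measurable_const
    measurable_const))
  exact measurableSet_contains hX t {x | ∃ j, x.1 j = y}

theorem integrable_prod_pointWeight [IsFiniteMeasure μ]
    (hX : ∀ t x, MeasurableSet {ω | X t ω = x}) (u : ℝ) (τ : Fin k → ℝ≥0) (y : Fin k → ℤ)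
    (s : Finset (Fin k)) :
    Integrable (fun ω => ∏ α ∈ s, pointWeight X u (τ α) (y α) ω) μ := by
  refine Integrable.of_bound (C := ∏ α ∈ s, (1 + |u|)) ?_ (Eventually.of_forall fun ω => ?_)
  · exact (Finset.measurable_fun_prod s fun α _ =>
      measurable_pointWeight hX u (τ α) (y α)).aestronglyMeasurable
  · rw [norm_prod]
    exact Finset.prod_le_prod (fun _ _ => norm_nonneg _) fun α _ => norm_pointWeight_le _ _ _ _

/-- Induction on the number of marks still in the future. Arbitrary finite histories are allowed
because each step appends the next marked time to the history before invoking the hypothesis. -/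
theorem setIntegral_prod_pointWeight [IsProbabilityMeasure μ] {p : ℝ≥0 → Weyl N → Weyl N → ℝ}
    (hp : ∀ (t : ℝ≥0) x z, p t x z = kmTransition t x z) {a : Weyl N}
    (hX : IsMarkovChain μ X p a) {τ : Fin k → ℝ≥0} {y : Fin k → ℤ}
    (hinj : Function.Injective fun i => (τ i, y i)) (u : ℝ) (m : ℕ) :
    ∀ (n : ℕ) (t : Fin (n + 1) → ℝ≥0) (x : Fin (n + 1) → Weyl N), Monotone t →
      (Finset.univ.filter fun α => t (Fin.last n) < τ α).card ≤ m →
      ∫ ω in {ω | ∀ i, X (t i) ω = x i},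
          ∏ α with t (Fin.last n) < τ α, pointWeight X u (τ α) (y α) ω ∂μ =
        μ.real {ω | ∀ i, X (t i) ω = x i} *
          condWeight a τ y u (t (Fin.last n)) (x (Fin.last n)) := by
  classical
  induction m with
  | zero =>
    intro n t x _ hc
    have h0 := Finset.card_eq_zero.1 (Nat.le_zero.1 hc)
    rw [h0, condWeight_eq_one a y u fun α => Finset.filter_eq_empty_iff.1 h0 (Finset.mem_univ α)]
    simp
  | succ m ih =>
    intro n t x ht hc
    rcases (Finset.univ.filter fun α => t (Fin.last n) < τ α).eq_empty_or_nonempty with h0 | hne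
    · exact ih n t x ht (by rw [h0]; simp)
    set s := t (Fin.last n) with hs
    -- The earliest remaining marked time: conditioning on the position there consumes all marks at
    -- that time.
    obtain ⟨α₀, hα₀, hmin⟩ := Finset.exists_min_image _ τ hne
    set t' := τ α₀ with ht'
    have hst : s < t' := (Finset.mem_filter.1 hα₀).2
    have hgap : ∀ α, s < τ α → t' ≤ τ α := fun α hα =>
      hmin α (Finset.mem_filter.2 ⟨Finset.mem_univ α, hα⟩)
    have hunion := filter_lt_eq_union hst hgap
    have hdisj := disjoint_filter_lt_eq τ t'
    set A : Set Ω := {ω | ∀ i, X (t i) ω = x i} with hA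
    have hAc : ∀ c, MeasurableSet {ω | (∀ i, X (t i) ω = x i) ∧ X t' ω = c} := fun c => by
      have h1 : MeasurableSet A := by
        rw [hA, Set.ofPred_forall]
        exact MeasurableSet.iInter fun i => hX.measurableSet _ _
      exact h1.inter (hX.measurableSet _ _)
    have hAU : A = ⋃ c, {ω | (∀ i, X (t i) ω = x i) ∧ X t' ω = c} := by
      ext ω; simp [hA]
    have hsum := hasSum_integral_iUnion hAc (fun c d hcd => Set.disjoint_left.2 fun ω h1 h2 =>
      hcd (h1.2.symm.trans h2.2)) (integrable_prod_pointWeight (μ := μ) hX.measurableSet u τ y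
        (Finset.univ.filter fun α => s < τ α)).integrableOn
    rw [← hAU] at hsum
    have hlast : (Fin.snoc t t' : Fin (n + 2) → ℝ≥0) (Fin.last (n + 1)) = t' := Fin.snoc_last _ _
    have hcard : (Finset.univ.filter fun α => t' < τ α).card ≤ m := by
      rw [hunion, Finset.card_union_of_disjoint hdisj] at hc
      have : 0 < (Finset.univ.filter fun β => τ β = t').card :=
        Finset.card_pos.2 ⟨α₀, Finset.mem_filter.2 ⟨Finset.mem_univ _, rfl⟩⟩
      lia
    have hterm : ∀ c, ∫ ω in {ω | (∀ i, X (t i) ω = x i) ∧ X t' ω = c},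
        ∏ α with s < τ α, pointWeight X u (τ α) (y α) ω ∂μ =
        μ.real A * (kmTransition ((t' : ℝ) - s) (x (Fin.last n)) c *
          ((∏ j, timeWeight τ y u t' (c.1 j)) * condWeight a τ y u t' c)) := by
      intro c
      have h1 := ih (n + 1) (Fin.snoc t t') (Fin.snoc x c) (monotone_snoc ht hst.le)
        (by rw [hlast]; exact hcard)
      rw [hlast, setOf_snoc_eq, Fin.snoc_last] at h1
      have h2 := hX.markov n t ht x (t' - s) c
      rw [← hs, add_tsub_cancel_of_le hst.le, hp, NNReal.coe_sub hst.le] at h2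
      have h3 : ∀ ω ∈ {ω | (∀ i, X (t i) ω = x i) ∧ X t' ω = c},
          ∏ α with s < τ α, pointWeight X u (τ α) (y α) ω =
          (∏ j, timeWeight τ y u t' (c.1 j)) *
            ∏ α with t' < τ α, pointWeight X u (τ α) (y α) ω := by
        rintro ω ⟨-, hω⟩
        rw [hunion, Finset.prod_union hdisj, mul_comm, prod_timeWeight]
        congr 1
        refine Finset.prod_congr rfl fun β hβ => ?_
        rw [pointWeight, (Finset.mem_filter.1 hβ).2, hω]
      rw [setIntegral_congr_fun (hAc c) h3, integral_const_mul, h1, h2]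
      ring
    simp_rw [hterm] at hsum
    exact hsum.unique ((hasSum_condWeight a hinj u hst hgap _).mul_left _)

/-- At time 0 the Lagrange polynomials form the identity on the nodes, which leaves an N × N
determinant det(1 + uΦ₀G), with Φ₀ the initial matrix and G the resolvent. Sylvester's identity
makes it k × k, and multiplying by 1 - uΦ, with Φ the forward matrix and determinant 1, clears the
inverse in G and yields the transpose of 1 + uK. -/
theorem condWeight_zero (a : Weyl N) {τ : Fin k → ℝ≥0} (hτ : ∀ i, 0 < τ i) (y : Fin k → ℤ)
    (u : ℝ) : condWeight a τ y u 0 a = (1 + u • Matrix.of fun α β =>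
      biorthKernel a (τ α) (y α) (τ β) (y β)).det := by
  have h1 : (Matrix.of fun i r => backward a τ y u 0 r (a.1 i)) =
      1 + (u • initialMatrix a τ y) * resolvent a τ y u := by
    ext i r
    have hf : (Finset.univ.filter fun β => 0 < τ β) = Finset.univ :=
      Finset.filter_true_of_mem fun β _ => hτ β
    rw [Matrix.of_apply, Matrix.add_apply, Matrix.mul_apply, backward, hf]
    congr 1
    · rw [NNReal.coe_zero, neg_zero, expShift, tsum_eq_single 0]
      · simp [lagrange_eval_node, Matrix.one_apply]
      · intro n hn; simp [hn]
    · refine Finset.sum_congr rfl fun β _ => ?_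
      rw [expShift_pointMass, initialMatrix, Matrix.smul_apply, Matrix.of_apply, NNReal.coe_zero,
        sub_zero, smul_eq_mul]
      ring
  have hdet := det_one_sub_forwardMatrix τ y u
  have hinv : (1 - u • forwardMatrix τ y) * (1 - u • forwardMatrix τ y)⁻¹ = 1 :=
    Matrix.mul_nonsing_inv _ (by rw [hdet]; exact isUnit_one)
  have h2 : (1 - u • forwardMatrix τ y) * (1 + resolvent a τ y u * (u • initialMatrix a τ y)) =
      (1 + u • Matrix.of fun α β => biorthKernel a (τ α) (y α) (τ β) (y β)).transpose := by
    rw [resolvent, Matrix.mul_add, Matrix.mul_one, Matrix.mul_assoc, ← Matrix.mul_assoc, hinv,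
      Matrix.one_mul]
    ext β α
    simp only [Matrix.add_apply, Matrix.sub_apply, Matrix.transpose_apply, Matrix.smul_apply,
      Matrix.mul_apply, Matrix.of_apply, forwardMatrix, terminalMatrix, initialMatrix,
      biorthKernel, smul_eq_mul, NNReal.coe_lt_coe]
    rw [Matrix.one_apply, Matrix.one_apply, mul_add, Finset.mul_sum]
    simp only [eq_comm (a := β)]
    have : ∀ r, u * (pweight (τ α) (y α - a.1 r) *
        expShift (-τ β) (fun n => (lagrange a r).eval (n : ℝ)) (y β)) =
        expShift (-τ β) (fun n => (lagrange a r).eval (n : ℝ)) (y β) *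
          (u * pweight (τ α) (y α - a.1 r)) := fun r => by ring
    simp_rw [this]
    ring
  rw [condWeight, h1, Matrix.det_one_add_mul_comm, div_self (vandermonde_pos a).ne',
    ← Matrix.det_transpose (1 + u • Matrix.of fun α β => biorthKernel a (τ α) (y α) (τ β) (y β)),
    ← h2, Matrix.det_mul, hdet]
  simp

theorem integral_prod_pointWeight [IsProbabilityMeasure μ] {p : ℝ≥0 → Weyl N → Weyl N → ℝ}
    (hp : ∀ (t : ℝ≥0) x z, p t x z = kmTransition t x z) {a : Weyl N}
    (hX : IsMarkovChain μ X p a) {τ : Fin k → ℝ≥0} {y : Fin k → ℤ} (hτ : ∀ i, 0 < τ i)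
    (hinj : Function.Injective fun i => (τ i, y i)) (u : ℝ) :
    ∫ ω, ∏ α, pointWeight X u (τ α) (y α) ω ∂μ =
      (1 + u • Matrix.of fun α β => biorthKernel a (τ α) (y α) (τ β) (y β)).det := by
  have h := setIntegral_prod_pointWeight hp hX hinj u k 0 (fun _ => 0) (fun _ => a)
    (fun _ _ _ => le_rfl) ((Finset.card_filter_le _ _).trans (by simp))
  have hf : (Finset.univ.filter fun β => 0 < τ β) = Finset.univ :=
    Finset.filter_true_of_mem fun β _ => hτ β
  have hset : ({ω | ∀ _ : Fin (0 + 1), X 0 ω = a} : Set Ω) =ᵐ[μ] Set.univ := by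
    rw [eventuallyEq_univ]
    filter_upwards [hX.start] with ω hω using fun _ => hω
  rw [hf, condWeight_zero a hτ, setIntegral_congr_set hset, setIntegral_univ,
    measureReal_congr hset, probReal_univ, one_mul] at h
  exact h

open Classical in
-- Putting u = 1/v and multiplying by v^k makes the top coefficient in u the value at v = 0, which
-- is then reached by continuity.
theorem integral_prod_add_indicator [IsProbabilityMeasure μ]
    {p : ℝ≥0 → Weyl N → Weyl N → ℝ} (hp : ∀ (t : ℝ≥0) x z, p t x z = kmTransition t x z)
    {a : Weyl N} (hX : IsMarkovChain μ X p a) {τ : Fin k → ℝ≥0} {y : Fin k → ℤ}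
    (hτ : ∀ i, 0 < τ i) (hinj : Function.Injective fun i => (τ i, y i)) {v : ℝ} (hv : v ≠ 0) :
    ∫ ω, ∏ α, (v + if ∃ j, (X (τ α) ω).1 j = y α then 1 else 0) ∂μ =
      (v • (1 : Matrix (Fin k) (Fin k) ℝ) +
        Matrix.of fun α β => biorthKernel a (τ α) (y α) (τ β) (y β)).det := by
  have h1 : v • (1 : Matrix (Fin k) (Fin k) ℝ) +
      Matrix.of (fun α β => biorthKernel a (τ α) (y α) (τ β) (y β)) =
      v • (1 + v⁻¹ • Matrix.of fun α β => biorthKernel a (τ α) (y α) (τ β) (y β)) := by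
    rw [smul_add, smul_smul, mul_inv_cancel₀ hv, one_smul]
  rw [h1, Matrix.det_smul, ← integral_prod_pointWeight hp hX hτ hinj, ← integral_const_mul]
  refine integral_congr_ae (Eventually.of_forall fun ω => ?_)
  simp only [← Finset.card_univ, ← Finset.prod_const, ← Finset.prod_mul_distrib]
  refine Finset.prod_congr rfl fun α _ => ?_
  rw [pointWeight]
  field_simp

open Classical in
theorem tendsto_integral_prod_add_indicator [IsProbabilityMeasure μ]
    (hX : ∀ t x, MeasurableSet {ω | X t ω = x}) (τ : Fin k → ℝ≥0) (y : Fin k → ℤ) :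
    Tendsto (fun v : ℝ => ∫ ω, ∏ α, (v + if ∃ j, (X (τ α) ω).1 j = y α then 1 else 0) ∂μ)
      (𝓝[>] 0) (𝓝 (μ.real {ω | ∀ i, ∃ j, (X (τ i) ω).1 j = y i})) := by
  have hset : ∀ i, MeasurableSet {ω | ∃ j, (X (τ i) ω).1 j = y i} := fun i =>
    measurableSet_contains hX (τ i) {x | ∃ j, x.1 j = y i}
  have hall : MeasurableSet {ω | ∀ i, ∃ j, (X (τ i) ω).1 j = y i} := by
    rw [Set.ofPred_forall]
    exact MeasurableSet.iInter hset
  rw [← integral_indicator_one hall]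
  refine tendsto_integral_filter_of_dominated_convergence (fun _ => 2 ^ k) ?_ ?_
    (integrable_const _) ?_
  · refine Eventually.of_forall fun v => Measurable.aestronglyMeasurable ?_
    exact Finset.measurable_fun_prod _ fun α _ =>
      measurable_const.add (Measurable.ite (hset α) measurable_const measurable_const)
  · filter_upwards [Ioo_mem_nhdsGT (zero_lt_one' ℝ)] with v hv
    refine Eventually.of_forall fun ω => ?_
    rw [norm_prod]
    refine (Finset.prod_le_prod (fun _ _ => norm_nonneg _) fun α _ => ?_).trans_eq
      (by rw [Finset.prod_const, Finset.card_univ, Fintype.card_fin])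
    rw [Real.norm_eq_abs, abs_le]
    split_ifs <;> constructor <;> linarith [hv.1, hv.2]
  · refine Eventually.of_forall fun ω => ?_
    have h1 : Tendsto (fun v : ℝ => ∏ α, (v + if ∃ j, (X (τ α) ω).1 j = y α then (1 : ℝ) else 0))
        (𝓝 0) (𝓝 (∏ α, (0 + if ∃ j, (X (τ α) ω).1 j = y α then (1 : ℝ) else 0))) :=
      tendsto_finsetProd _ fun α _ => tendsto_id.add_const _
    convert! tendsto_nhdsWithin_of_tendsto_nhds h1 using 2
    simp only [zero_add, Set.indicator_apply, Set.mem_ofPred_eq, Pi.one_apply]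
    rw [Finset.prod_ite_zero]
    simp

theorem measureReal_contains_eq_det [IsProbabilityMeasure μ]
    {p : ℝ≥0 → Weyl N → Weyl N → ℝ} (hp : ∀ (t : ℝ≥0) x z, p t x z = kmTransition t x z)
    {a : Weyl N} (hX : IsMarkovChain μ X p a) {τ : Fin k → ℝ≥0} {y : Fin k → ℤ}
    (hτ : ∀ i, 0 < τ i) (hinj : Function.Injective fun i => (τ i, y i)) :
    μ.real {ω | ∀ i, ∃ j, (X (τ i) ω).1 j = y i} =
      (Matrix.of fun α β => biorthKernel a (τ α) (y α) (τ β) (y β)).det := by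
  classical
  refine tendsto_nhds_unique (tendsto_integral_prod_add_indicator hX.measurableSet τ y) ?_
  have h1 : Continuous fun v : ℝ => (v • (1 : Matrix (Fin k) (Fin k) ℝ) +
      Matrix.of fun α β => biorthKernel a (τ α) (y α) (τ β) (y β)).det :=
    Continuous.matrix_det (by fun_prop)
  have h2 := h1.tendsto 0
  rw [zero_smul, zero_add] at h2
  refine (tendsto_nhdsWithin_of_tendsto_nhds h2).congr' ?_
  filter_upwards [self_mem_nhdsWithin] with v hv
  exact (integral_prod_add_indicator hp hX hτ hinj (ne_of_gt hv)).symm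

theorem isDeterminantal_poissonKernel [IsProbabilityMeasure μ] {a : Weyl N}
    (C : ∀ x₁ x₂ : ℤ, PoissonContour a x₁ x₂) (hX : IsNoncollidingPoissonWalk μ X a) :
    IsDeterminantal μ X (poissonKernel a C) := by
  obtain ⟨p, hp, hq, hX⟩ := hX
  intro k τ y hτ hinj
  rw [measureReal_contains_eq_det (transition_eq_kmTransition hp hq) hX hτ hinj]
  have h1 := RingHom.map_det Complex.ofRealHom
    (Matrix.of fun α β => biorthKernel a (τ α) (y α) (τ β) (y β))
  rw [Complex.ofRealHom_eq_coe] at h1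
  rw [h1]
  congr 1
  ext α β
  rw [Matrix.of_apply, poissonKernel_eq a C (NNReal.coe_pos.2 (hτ α)) (NNReal.coe_pos.2 (hτ β))]
  rfl

end

end NoncollidingWalk
end

open NoncollidingWalk in
theorem theoremA1 {N : ℕ} (a : Weyl N)
    (C : ∀ x₁ x₂ : ℤ, PoissonContour a x₁ x₂)
    (B : ∀ (t₁ : ℕ) (x₁ : ℤ) (t₂ : ℕ) (x₂ : ℤ), BernoulliContour a t₁ x₁ t₂ x₂) :
    -- the outer integral in the kernel converges absolutely
    (∀ (x₁ x₂ : ℤ) (τ₁ τ₂ : ℝ), 0 < τ₁ → 0 < τ₂ →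
      Complex.VerticalIntegrable (poissonInner a (C x₁ x₂) τ₁ τ₂) ((x₂ : ℝ) - 1 / 2)) ∧
    -- the noncolliding Poisson random walk started from `a` is determinantal
    (∀ (Ω : Type*) [MeasurableSpace Ω] (μ : Measure Ω) [IsProbabilityMeasure μ]
      (X : ℝ≥0 → Ω → Weyl N), IsNoncollidingPoissonWalk μ X a →
      IsDeterminantal μ X (poissonKernel a C)) ∧
    -- the kernel is the limit of the gauge transformed Bernoulli kernel
    (∀ (x₁ x₂ : ℤ) (τ₁ τ₂ : ℝ), 0 < τ₁ → 0 < τ₂ →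
      Tendsto
        (fun β : ℝ => (-(β : ℂ)) ^ (x₁ - x₂) *
          bernoulliKernel a B β ⌊τ₁ / β⌋₊ x₁ ⌊τ₂ / β⌋₊ x₂)
        (𝓝[>] 0) (𝓝 (poissonKernel a C τ₁ x₁ τ₂ x₂))) :=
  ⟨fun x₁ x₂ _ _ h₁ h₂ => verticalIntegrable_poissonInner a (C x₁ x₂) h₁ h₂,
    fun _ _ _ _ _ hX => isDeterminantal_poissonKernel C hX,
    fun x₁ x₂ _ _ h₁ h₂ => tendsto_bernoulliKernel a C B x₁ x₂ h₁ h₂⟩
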